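/- Consider the cubic nonlinear Schrödinger equation with nonlinearity concentrated at a point, $$i\psi_t=-\psi_{xx}+\delta(x)|\psi|^2\psi ,\qquad (t,x)\in\mathbb{R}\times\mathbb{R}.\qquad(\mathrm{NLS}_\delta)$$ Let $I\subseteq\mathbb{R}$ be an interval, and let $C_x$ be the space of bounded continuous functions $\mathbb{R}\to\mathbb{C}$ with the supremum norm. A solution of $(\mathrm{NLS}_\delta)$ on $I$ is a bounded continuous map $\psi:I\to L^2(\mathbb{R})$ with $\psi\in L^4_{I,\mathrm{loc}}C_x$ (so that $\psi(t,0)$ is defined for almost every $t\in I$) such that for some $t_0\in I$ and all $t\in I$ $$\psi(t)=e^{i(t-t_0)\partial_x^2}\psi(t_0)-i\int_{t_0}^t e^{i(t-s)\partial_x^2}\bigl[|\psi(s,0)|^2\psi(s,0)\,\delta\bigr]\,ds .$$ Here the integral is understood weakly, in the sense of tempered distributions. Theorem. (1) The equation $(\mathrm{NLS}_\delta)$ is globally well-posed in $L^2(\mathbb{R})$, that is: (a) for every $\psi_0\in L^2(\mathbb{R})$ there is a solution $\psi$ on $\mathbb{R}$ with $\psi(0)=\psi_0$; (b) two solutions on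 intervals $I$ and $J$ that agree at one time in $I\cap J$ agree at all times in $I\cap J$; (c) if $\psi_n$ and $\psi$ are solutions on $\mathbb{R}$ with $\psi_n(0)\to\psi(0)$ in $L^2(\mathbb{R})$, then for every $T>0$ $$\sup_{|t|\le T}\|\psi_n(t)-\psi(t)\|_{L^2}\to0\quad\text{and}\quad\int_{-T}^{T}\sup_{x}|\psi_n(t,x)-\psi(t,x)|^4\,dt\to0 .$$ (2) There is an absolute constant $C$ such that every solution $\psi$ on $\mathbb{R}$ satisfies $$\int_{\mathbb{R}}|\psi(t,0)|^4\,dt\le C\,\|\psi(0)\|_{L^2}^4 .$$ (3) Every solution $\psi$ on $\mathbb{R}$ scatters: there are $\psi_\pm\in L^2(\mathbb{R})$ such that $$\|\psi(t)-e^{it\partial_x^2}\psi_\pm\|_{L^2}\to0\quad\text{as } t\to\pm\infty .$$ -/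

import Mathlib

open MeasureTheory Filter Topology
open scoped ENNReal FourierTransform SchwartzMap BoundedContinuousFunction

noncomputable section

namespace PointNLS

/-- The Hilbert space `L²(ℝ)` of complex-valued functions. -/
abbrev L2 : Type := Lp ℂ 2 (volume : Measure ℝ)

/-- The Fourier symbol of `e^{it∂ₓ²}`. The Fourier transform is normalised by the character
`e^{-2πixξ}`, so that `∂ₓ²` has symbol `-4π²ξ²` and `e^{it∂ₓ²}` has symbol `e^{-4π²itξ²}`. -/
def symbol (t ξ : ℝ) : ℂ :=
  Complex.exp (Complex.I * ((-(4 * Real.pi ^ 2 * t * ξ ^ 2) : ℝ) : ℂ))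

theorem norm_symbol (t ξ : ℝ) : ‖symbol t ξ‖ = 1 := by
  unfold symbol
  rw [mul_comm]
  exact Complex.norm_exp_ofReal_mul_I _

theorem continuous_symbol (t : ℝ) : Continuous (symbol t) := by
  unfold symbol
  fun_prop

theorem memLp_symbol (t : ℝ) : MemLp (symbol t) ∞ (volume : Measure ℝ) :=
  memLp_top_of_bound (continuous_symbol t).aestronglyMeasurable 1
    (Eventually.of_forall fun ξ => (norm_symbol t ξ).le)

theorem hasTemperateGrowth_exp_I :
    Function.HasTemperateGrowth (fun x : ℝ => Complex.exp (Complex.I * (x : ℂ))) := by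
  refine ⟨(contDiff_const.mul Complex.ofRealCLM.contDiff).cexp, fun n => ⟨0, 1, fun x => ?_⟩⟩
  have key : ∀ m : ℕ, iteratedDeriv m (fun x : ℝ => Complex.exp (Complex.I * (x : ℂ)))
      = fun x : ℝ => Complex.I ^ m * Complex.exp (Complex.I * (x : ℂ)) := by
    intro m
    induction m with
    | zero => simp
    | succ k ih =>
      rw [iteratedDeriv_succ, ih]
      funext y
      have h1 : HasDerivAt (fun x : ℝ => Complex.I * (x : ℂ)) (Complex.I * 1) y :=
        (Complex.ofRealCLM.hasDerivAt (x := y)).const_mul Complex.I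
      have h2 := (h1.cexp).const_mul (Complex.I ^ k)
      rw [h2.deriv]
      ring
  rw [norm_iteratedFDeriv_eq_norm_iteratedDeriv, key]
  have h : ‖Complex.exp (Complex.I * (x : ℂ))‖ = 1 := by
    rw [mul_comm]
    exact Complex.norm_exp_ofReal_mul_I _
  simp [h]

/-- The symbol is of temperate growth, so that it acts by multiplication on `𝓢'(ℝ)`. -/
theorem hasTemperateGrowth_symbol (t : ℝ) : Function.HasTemperateGrowth (symbol t) := by
  have h : Function.HasTemperateGrowth (fun ξ : ℝ => -(4 * Real.pi ^ 2 * t * ξ ^ 2)) := by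
    have h2 : Function.HasTemperateGrowth (fun ξ : ℝ => ξ ^ 2) :=
      Function.HasTemperateGrowth.pow Function.HasTemperateGrowth.id' 2
    exact ((Function.HasTemperateGrowth.const (4 * Real.pi ^ 2 * t)).mul h2).neg
  exact hasTemperateGrowth_exp_I.comp h

/-- The free Schrödinger propagator `e^{it∂ₓ²}` on `L²(ℝ)`. -/
def free (t : ℝ) (f : L2) : L2 :=
  𝓕⁻ (((memLp_symbol t).toLp (symbol t) • 𝓕 f : L2))

/-- The free Schrödinger propagator `e^{it∂ₓ²}` on tempered distributions. -/
def freeDist (t : ℝ) : 𝓢'(ℝ, ℂ) →L[ℂ] 𝓢'(ℝ, ℂ) :=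
  TemperedDistribution.fourierMultiplierCLM ℂ (symbol t)

/-- The two propagators agree on `L²(ℝ)`. -/
theorem freeDist_coe (t : ℝ) (f : L2) :
    freeDist t (Lp.toTemperedDistribution f) = Lp.toTemperedDistribution (free t f) := by
  unfold freeDist free
  rw [TemperedDistribution.fourierMultiplierCLM_apply, Lp.fourier_toTemperedDistribution_eq,
    ← Lp.toTemperedDistribution_smul_eq (p := ∞) (q := 2) (r := 2) (hasTemperateGrowth_symbol t) (memLp_symbol t),
    Lp.fourierInv_toTemperedDistribution_eq]

open Classical in
/-- The value `f(x)` of (the continuous representative of) `f ∈ L²(ℝ)`; it is set to `0` if `f` has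
no continuous representative. -/
def pointValue (f : L2) (x : ℝ) : ℂ :=
  if h : ∃ u : C(ℝ, ℂ), (f : ℝ → ℂ) =ᵐ[volume] u then h.choose x else 0

/-- The point value is the value of any continuous representative. -/
theorem pointValue_eq {f : L2} {u : ℝ → ℂ} (hu : Continuous u)
    (h : (f : ℝ → ℂ) =ᵐ[volume] u) (x : ℝ) : pointValue f x = u x := by
  have h' : ∃ v : C(ℝ, ℂ), (f : ℝ → ℂ) =ᵐ[volume] v := ⟨⟨u, hu⟩, h⟩
  unfold pointValue
  rw [dif_pos h']
  have := (h'.choose_spec.symm.trans h)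
  exact congrFun ((Continuous.ae_eq_iff_eq volume h'.choose.continuous hu).1 this) x

/-- `ψ ∈ L⁴_{I,loc} C_x`: there is a map `u` into the Banach space of bounded continuous functions
that represents `ψ` at almost every time in `I` and that belongs to the Bochner space `L⁴` on each
compact subinterval of `I`. -/
def MemL4locC (I : Set ℝ) (ψ : ℝ → L2) : Prop :=
  ∃ u : ℝ → (ℝ →ᵇ ℂ), (∀ᵐ t ∂(volume.restrict I), (ψ t : ℝ → ℂ) =ᵐ[volume] u t) ∧
    ∀ a ∈ I, ∀ b ∈ I, MemLp u 4 (volume.restrict (Set.Icc a b))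

/-- The forcing term `|f(0)|² f(0) δ`. -/
def nonlinearity (f : L2) : 𝓢'(ℝ, ℂ) :=
  ((‖pointValue f 0‖ ^ 2 : ℝ) * pointValue f 0 : ℂ) • TemperedDistribution.delta (0 : ℝ)

/-- The Duhamel formula
`ψ(t) = e^{i(t-t₀)∂ₓ²} ψ(t₀) - i ∫_{t₀}^t e^{i(t-s)∂ₓ²} [|ψ(s)|² ψ(s) δ] ds`
as an identity of tempered distributions; the integral of distributions is the weak one, that is,
the integral is taken after pairing with a test function. -/
def Duhamel (ψ : ℝ → L2) (t₀ t : ℝ) : Prop :=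
  ∀ g : 𝓢(ℝ, ℂ), Lp.toTemperedDistribution (ψ t) g =
    Lp.toTemperedDistribution (free (t - t₀) (ψ t₀)) g
      - Complex.I * ∫ s in t₀..t, freeDist (t - s) (nonlinearity (ψ s)) g

/-- Strong solutions of `i ψ_t = -ψ_xx + δ(x)|ψ|²ψ` on an interval `I`: bounded continuous maps
`ψ : I → L²(ℝ)` in `L⁴_{I,loc} C_x` that satisfy the Duhamel formula. Only the values of `ψ` on `I`
matter. -/
structure IsSolution (I : Set ℝ) (ψ : ℝ → L2) : Prop where
  continuousOn : ContinuousOn ψ I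
  bounded : ∃ M : ℝ, ∀ t ∈ I, ‖ψ t‖ ≤ M
  memL4locC : MemL4locC I ψ
  duhamel : ∃ t₀ ∈ I, ∀ t ∈ I, Duhamel ψ t₀ t

/-- Existence of global solutions for all initial data in `L²(ℝ)`. -/
def GlobalExistence : Prop :=
  ∀ ψ₀ : L2, ∃ ψ : ℝ → L2, IsSolution Set.univ ψ ∧ ψ 0 = ψ₀

/-- Two solutions on intervals that agree at one time agree throughout their common domain. -/
def Uniqueness : Prop :=
  ∀ (I J : Set ℝ), I.OrdConnected → J.OrdConnected → ∀ φ ψ : ℝ → L2,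
    IsSolution I φ → IsSolution J ψ → ∀ t₀ ∈ I ∩ J, φ t₀ = ψ t₀ → Set.EqOn φ ψ (I ∩ J)

/-- If the initial data converge in `L²(ℝ)`, then the global solutions converge in
`C_t L²_x ∩ L⁴_t C_x` on each compact time interval. The spatial norm of `C_x` is the
essential supremum, as the functions in question are continuous at almost every time. -/
def ContinuousDependence : Prop :=
  ∀ (ψ : ℝ → L2) (ψn : ℕ → ℝ → L2), IsSolution Set.univ ψ → (∀ n, IsSolution Set.univ (ψn n)) →
    Tendsto (fun n => ψn n 0) atTop (𝓝 (ψ 0)) → ∀ T : ℝ,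
      TendstoUniformlyOn ψn ψ atTop (Set.Icc (-T) T) ∧
      Tendsto (fun n => ∫⁻ t in Set.Icc (-T) T,
        (eLpNorm (⇑(ψn n t - ψ t) : ℝ → ℂ) ∞ volume) ^ 4) atTop (𝓝 0)

/-- Global well-posedness in `L²(ℝ)`. -/
def GloballyWellPosed : Prop :=
  GlobalExistence ∧ Uniqueness ∧ ContinuousDependence

end PointNLS

end

noncomputable section

namespace PointNLS

open scoped ComplexConjugate

/-! The nonlinearity sees only the boundary value `q(t) = ψ(t,0)`, so the equation reduces to the
scalar Volterra equation `q = f - V(|q|²q)`. Here `f` is the free wave at `x = 0` and `V g(t) = i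
∫_a^t E₀(t-s,0) g(s) ds`, with `E₀` the Schrödinger kernel. Since `|E₀(τ,x)| ≤ |τ|^{-1/2}` uniformly
in `x`, the Hardy–Littlewood–Sobolev inequality gives `V : L^{4/3} → L⁴`. With a `TT*` argument it
also gives every Strichartz estimate needed (`eLpNorm_adjointWave_le`, `exists_strichartz`,
`exists_representsL4C_forced`). These are critical: a contraction alone yields solutions only where
`f` is small.

The global input is monotonicity. Because `i E₀(τ,0) = E₀(-τ,0)` for `τ > 0`, twice the real part of
`⟨g, V g⟩` is a sum of two quadratic forms with the positive semidefinite kernel `E₀(s-t,0)`, hence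
nonnegative (`re_integral_conj_mul_volterra_nonneg`). The map `z ↦ |z|²z` is itself monotone.
Pairing the difference of two Volterra equations with the difference of their cubic terms therefore
discards `V` and leaves `‖(q₁-q₂)W‖_{L²} ≤ 3 ‖(f₁-f₂)W‖_{L²}`, where `W² = |q₁|²+|q₂|²`
(`integral_mul_weight_le`).

Taking `q₂ = 0` gives `‖q‖_{L⁴} ≤ 3‖f‖_{L⁴}` with no smallness and no dependence on the time
interval. In general it gives a Lipschitz bound for `|q|²q` in `L^{4/3}` in terms of `f` in `L⁴`
(`VolterraSol.eLpNorm_cubic_sub_le`), and this is the quantity that Strichartz turns into control of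
`ψ`. Uniqueness, continuous dependence and the spacetime bound follow. Existence is a continuation
argument: small shells are solved by contraction, and the a priori bound prevents the continuation
from stopping (`exists_volterraSol`). Finally `|q|²q ∈ L^{4/3}(ℝ)` makes the profile
`e^{-it∂ₓ²}ψ(t)` Cauchy as `t → ±∞`, which is scattering. -/

/-! ### Hardy–Littlewood–Sobolev inequality for the kernel `|t - s|^{-1/2}` -/

/-- The kernel `|τ|^{-1/2}`. -/
def rieszKernel (τ : ℝ) : ℝ≥0∞ := ENNReal.ofReal (|τ| ^ (-(1 / 2) : ℝ))

theorem measurable_rieszKernel : Measurable rieszKernel := by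
  unfold rieszKernel
  fun_prop

theorem rieszKernel_neg (τ : ℝ) : rieszKernel (-τ) = rieszKernel τ := by
  simp [rieszKernel]

theorem lintegral_Ioc_rpow {r c : ℝ} (hr : -1 < r) (hc : 0 ≤ c) :
    ∫⁻ x in Set.Ioc 0 c, ENNReal.ofReal (x ^ r) = ENNReal.ofReal (c ^ (r + 1) / (r + 1)) := by
  rw [← ofReal_integral_eq_lintegral_ofReal]
  · rw [← intervalIntegral.integral_of_le hc, integral_rpow (Or.inl hr)]
    rw [Real.zero_rpow (by linarith), sub_zero]
  · exact (intervalIntegral.intervalIntegrable_rpow' (a := 0) (b := c) hr).1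
  · filter_upwards [ae_restrict_mem measurableSet_Ioc] with x hx
    exact Real.rpow_nonneg hx.1.le _

theorem lintegral_rieszKernel_Ioc {r : ℝ} (hr : 0 ≤ r) :
    ∫⁻ τ in Set.Ioc 0 r, rieszKernel τ = 2 * ENNReal.ofReal (r ^ (1 / 2 : ℝ)) := by
  have : ∫⁻ τ in Set.Ioc 0 r, rieszKernel τ
      = ∫⁻ x in Set.Ioc 0 r, ENNReal.ofReal (x ^ (-(1 / 2) : ℝ)) := by
    refine setLIntegral_congr_fun measurableSet_Ioc fun x hx => ?_
    simp only [rieszKernel]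
    rw [abs_of_pos hx.1]
  rw [this, lintegral_Ioc_rpow (by norm_num) hr,
    show (2 : ℝ≥0∞) = ENNReal.ofReal 2 by simp, ← ENNReal.ofReal_mul (by norm_num)]
  congr 1
  norm_num
  ring

theorem lintegral_rieszKernel_Ioo {r : ℝ} (hr : 0 ≤ r) :
    ∫⁻ τ in Set.Ioo (-r) r, rieszKernel τ ≤ 4 * ENNReal.ofReal (r ^ (1 / 2 : ℝ)) := by
  have hsub : Set.Ioo (-r) r ⊆ (Set.Ioc 0 r ∪ -(Set.Ioc 0 r)) ∪ {0} := by
    intro x hx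
    rcases lt_trichotomy x 0 with h | h | h
    · left; right
      exact ⟨by linarith, by linarith [hx.1]⟩
    · right; exact h
    · left; left
      exact ⟨h, hx.2.le⟩
  have hneg : ∫⁻ τ in -(Set.Ioc 0 r), rieszKernel τ = ∫⁻ τ in Set.Ioc 0 r, rieszKernel τ := by
    rw [← (Measure.measurePreserving_neg (volume : Measure ℝ)).setLIntegral_comp_preimage_emb
      (MeasurableEquiv.neg ℝ).measurableEmbedding rieszKernel (Set.Ioc 0 r)]
    refine lintegral_congr fun x => (rieszKernel_neg x).symm
  calc ∫⁻ τ in Set.Ioo (-r) r, rieszKernel τ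
      ≤ ∫⁻ τ in (Set.Ioc 0 r ∪ -(Set.Ioc 0 r)) ∪ {0}, rieszKernel τ := lintegral_mono_set hsub
    _ ≤ (∫⁻ τ in Set.Ioc 0 r, rieszKernel τ) + (∫⁻ τ in -(Set.Ioc 0 r), rieszKernel τ)
        + ∫⁻ τ in {0}, rieszKernel τ :=
      (lintegral_union_le _ _ _).trans (by gcongr; exact lintegral_union_le _ _ _)
    _ = 4 * ENNReal.ofReal (r ^ (1 / 2 : ℝ)) := by
      rw [hneg, lintegral_rieszKernel_Ioc hr]
      simp
      ring

/-- Compare `B` with the ball about `s` of radius `r = |B|`. The ball contributes at most `4√r`;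
outside it the kernel is at most `r^{-1/2}`, which contributes at most `r · r^{-1/2} = √r`. -/
theorem setLIntegral_rieszKernel_le {B : Set ℝ} (hB : MeasurableSet B) (s : ℝ) :
    ∫⁻ t in B, rieszKernel (t - s) ≤ 5 * volume B ^ (1 / 2 : ℝ) := by
  rcases eq_or_ne (volume B) ∞ with h | h
  · rw [h]; simp
  rcases eq_or_ne (volume B) 0 with h0 | h0
  · rw [Measure.restrict_eq_zero.2 h0]; simp
  set r : ℝ := (volume B).toReal with hr
  have hr0 : 0 < r := ENNReal.toReal_pos h0 h
  have hvol : volume B = ENNReal.ofReal r := (ENNReal.ofReal_toReal h).symm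
  have hball : MeasurableSet (Set.Ioo (s - r) (s + r)) := measurableSet_Ioo
  have h1 : ∫⁻ t in Set.Ioo (s - r) (s + r), rieszKernel (t - s)
      ≤ 4 * ENNReal.ofReal (r ^ (1 / 2 : ℝ)) := by
    refine le_trans (le_of_eq ?_) (lintegral_rieszKernel_Ioo hr0.le)
    rw [← (measurePreserving_sub_right (volume : Measure ℝ) s).setLIntegral_comp_preimage_emb
      (MeasurableEquiv.subRight s).measurableEmbedding rieszKernel (Set.Ioo (-r) r)]
    congr 2
    ext x
    simp only [Set.mem_Ioo, Set.mem_preimage]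
    constructor <;> rintro ⟨a, b⟩ <;> constructor <;> linarith
  have h2 : ∫⁻ t in B \ Set.Ioo (s - r) (s + r), rieszKernel (t - s)
      ≤ ENNReal.ofReal (r ^ (1 / 2 : ℝ)) := by
    calc ∫⁻ t in B \ Set.Ioo (s - r) (s + r), rieszKernel (t - s)
        ≤ ∫⁻ t in B \ Set.Ioo (s - r) (s + r), ENNReal.ofReal (r ^ (-(1 / 2) : ℝ)) := by
          refine setLIntegral_mono' (hB.diff hball) fun t ht => ?_
          refine ENNReal.ofReal_le_ofReal ?_
          refine Real.rpow_le_rpow_of_nonpos hr0 ?_ (by norm_num)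
          by_contra hlt
          rw [not_le, abs_lt] at hlt
          exact ht.2 ⟨by linarith, by linarith⟩
      _ ≤ ENNReal.ofReal (r ^ (-(1 / 2) : ℝ)) * volume B := by
          rw [setLIntegral_const]
          gcongr
          exact Set.sdiff_subset
      _ = ENNReal.ofReal (r ^ (1 / 2 : ℝ)) := by
          rw [hvol, ← ENNReal.ofReal_mul (by positivity)]
          nth_rw 2 [← Real.rpow_one r]
          rw [← Real.rpow_add hr0]
          norm_num
  calc ∫⁻ t in B, rieszKernel (t - s)
      ≤ ∫⁻ t in Set.Ioo (s - r) (s + r) ∪ (B \ Set.Ioo (s - r) (s + r)), rieszKernel (t - s) :=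
        lintegral_mono_set fun x hx => by
          by_cases h : x ∈ Set.Ioo (s - r) (s + r)
          · exact Or.inl h
          · exact Or.inr ⟨hx, h⟩
    _ ≤ 4 * ENNReal.ofReal (r ^ (1 / 2 : ℝ)) + ENNReal.ofReal (r ^ (1 / 2 : ℝ)) :=
        (lintegral_union_le _ _ _).trans (add_le_add h1 h2)
    _ = 5 * volume B ^ (1 / 2 : ℝ) := by
        rw [hvol, ENNReal.ofReal_rpow_of_nonneg hr0.le (by norm_num)]
        ring

theorem setLIntegral_setLIntegral_rieszKernel_le {A B : Set ℝ} (hA : MeasurableSet A)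
    (hB : MeasurableSet B) :
    ∫⁻ s in A, ∫⁻ t in B, rieszKernel (t - s) ≤
      5 * min (volume A * volume B ^ (1 / 2 : ℝ)) (volume B * volume A ^ (1 / 2 : ℝ)) := by
  have key : ∀ {A B : Set ℝ}, MeasurableSet A → MeasurableSet B →
      ∫⁻ s in A, ∫⁻ t in B, rieszKernel (t - s) ≤ 5 * (volume A * volume B ^ (1 / 2 : ℝ)) := by
    intro A B _ hB
    calc ∫⁻ s in A, ∫⁻ t in B, rieszKernel (t - s)
        ≤ ∫⁻ _ in A, 5 * volume B ^ (1 / 2 : ℝ) :=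
          lintegral_mono fun s => setLIntegral_rieszKernel_le hB s
      _ = 5 * (volume A * volume B ^ (1 / 2 : ℝ)) := by rw [setLIntegral_const]; ring
  rw [mul_min]
  refine le_min (key hA hB) ?_
  rw [lintegral_lintegral_swap]
  · refine le_trans (le_of_eq ?_) (key hB hA)
    refine lintegral_congr fun t => lintegral_congr fun s => ?_
    rw [← rieszKernel_neg, neg_sub]
  · exact (measurable_rieszKernel.comp (measurable_snd.sub measurable_fst)).aemeasurable

/-- Layer cake formula against a density. -/
theorem lintegral_ofReal_mul_eq_lintegral_superlevel {f : ℝ → ℝ} (hf : Measurable f) (hf0 : 0 ≤ f)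
    {h : ℝ → ℝ≥0∞} (hh : Measurable h) :
    ∫⁻ s, ENNReal.ofReal (f s) * h s = ∫⁻ a in Set.Ioi (0 : ℝ), ∫⁻ s in {s | a < f s}, h s := by
  have h1 := lintegral_eq_lintegral_meas_lt (volume.withDensity h) (f := f)
    (Eventually.of_forall hf0) hf.aemeasurable
  rw [lintegral_withDensity_eq_lintegral_mul _ hh hf.ennreal_ofReal] at h1
  calc ∫⁻ s, ENNReal.ofReal (f s) * h s = _ := by
        refine lintegral_congr fun s => ?_
        rw [mul_comm]; rfl
    _ = _ := h1
    _ = _ := by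
      refine lintegral_congr fun a => ?_
      rw [withDensity_apply _ (measurableSet_lt measurable_const hf)]

theorem lintegral_superlevel_rpow {f : ℝ → ℝ} (hf : Measurable f) (hf0 : 0 ≤ f) :
    ∫⁻ a in Set.Ioi (0 : ℝ), volume {s | a < f s} * ENNReal.ofReal (a ^ (1 / 3 : ℝ))
      ≤ ∫⁻ s, ENNReal.ofReal (f s ^ (4 / 3 : ℝ)) := by
  rw [lintegral_rpow_eq_lintegral_meas_lt_mul volume (Eventually.of_forall hf0) hf.aemeasurable
    (p := 4 / 3) (by norm_num)]
  rw [show (4 / 3 : ℝ) - 1 = 1 / 3 by norm_num]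
  refine le_mul_of_one_le_left zero_le ?_
  rw [ENNReal.one_le_ofReal]
  norm_num

/-- Cauchy–Schwarz after inserting `b^{-1/6} b^{1/6}`: the weight `b^{-1/3}` is integrable at `0`,
and `w(b) b^{1/3}` is the layer-cake density of an `L^{4/3}` norm. The sharp constant is `√(3/2)`,
rounded up to `2`. -/
theorem setLIntegral_sqrt_le {w : ℝ → ℝ≥0∞} (hw : Measurable w) {c : ℝ} (hc : 0 ≤ c) :
    ∫⁻ b in Set.Ioc 0 c, w b ^ (1 / 2 : ℝ) ≤
      2 * ENNReal.ofReal (c ^ (1 / 3 : ℝ)) *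
        (∫⁻ b in Set.Ioi (0 : ℝ), w b * ENNReal.ofReal (b ^ (1 / 3 : ℝ))) ^ (1 / 2 : ℝ) := by
  have hH := ENNReal.lintegral_mul_le_Lp_mul_Lq (volume.restrict (Set.Ioc 0 c))
    (p := 2) (q := 2) (by constructor <;> norm_num)
    (f := fun b => ENNReal.ofReal (b ^ (-(1 / 6) : ℝ)))
    (g := fun b => w b ^ (1 / 2 : ℝ) * ENNReal.ofReal (b ^ (1 / 6 : ℝ)))
    (by fun_prop) (by fun_prop)
  have e1 : ∫⁻ b in Set.Ioc 0 c, w b ^ (1 / 2 : ℝ) = ∫⁻ b in Set.Ioc 0 c,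
      ((fun b => ENNReal.ofReal (b ^ (-(1 / 6) : ℝ))) *
        (fun b => w b ^ (1 / 2 : ℝ) * ENNReal.ofReal (b ^ (1 / 6 : ℝ)))) b := by
    refine setLIntegral_congr_fun measurableSet_Ioc fun b hb => ?_
    simp only [Pi.mul_apply]
    rw [mul_left_comm, ← ENNReal.ofReal_mul (Real.rpow_nonneg hb.1.le _), ← Real.rpow_add hb.1]
    norm_num
  have e2 : ∫⁻ b in Set.Ioc 0 c, ENNReal.ofReal (b ^ (-(1 / 6) : ℝ)) ^ (2 : ℝ)
      = ENNReal.ofReal (c ^ (2 / 3 : ℝ) / (2 / 3)) := by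
    rw [show (2 / 3 : ℝ) = -(1 / 3) + 1 by norm_num, ← lintegral_Ioc_rpow (by norm_num) hc]
    refine setLIntegral_congr_fun measurableSet_Ioc fun b hb => ?_
    have hb0 : 0 ≤ b := hb.1.le
    rw [ENNReal.ofReal_rpow_of_nonneg (by positivity) (by norm_num), ← Real.rpow_mul hb0]
    norm_num
  have e3 : ∫⁻ b in Set.Ioc 0 c, (w b ^ (1 / 2 : ℝ) * ENNReal.ofReal (b ^ (1 / 6 : ℝ))) ^ (2 : ℝ)
      ≤ ∫⁻ b in Set.Ioi (0 : ℝ), w b * ENNReal.ofReal (b ^ (1 / 3 : ℝ)) := by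
    refine le_trans (le_of_eq ?_) (lintegral_mono_set
      (show Set.Ioc 0 c ⊆ Set.Ioi 0 from Set.Ioc_subset_Ioi_self))
    refine setLIntegral_congr_fun measurableSet_Ioc fun b hb => ?_
    have hb0 : 0 ≤ b := hb.1.le
    rw [ENNReal.mul_rpow_of_nonneg _ _ (by norm_num), ← ENNReal.rpow_mul,
      ENNReal.ofReal_rpow_of_nonneg (by positivity) (by norm_num), ← Real.rpow_mul hb0]
    norm_num
  rw [e1]
  refine hH.trans ?_
  rw [e2]
  gcongr
  rw [ENNReal.ofReal_rpow_of_nonneg (by positivity) (by norm_num),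
    Real.div_rpow (by positivity) (by norm_num), ← Real.rpow_mul hc,
    show (2 : ℝ≥0∞) = ENNReal.ofReal 2 by simp, ← ENNReal.ofReal_mul (by norm_num)]
  refine ENNReal.ofReal_le_ofReal ?_
  rw [div_le_iff₀ (by positivity)]
  norm_num
  have h1 : (1 / 2 : ℝ) ≤ (2 / 3 : ℝ) ^ (1 / 2 : ℝ) := by
    rw [← Real.sqrt_eq_rpow]
    exact Real.le_sqrt_of_sq_le (by norm_num)
  nlinarith [Real.rpow_nonneg hc (1 / 3)]

theorem lintegral_lintegral_lt_le {v w : ℝ → ℝ≥0∞} (hv : Measurable v) (hw : Measurable w)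
    {l : ℝ} (hl : 0 < l) :
    ∫⁻ a in Set.Ioi (0 : ℝ), ∫⁻ b in Set.Ioc 0 (l * a), v a * w b ^ (1 / 2 : ℝ) ≤
      2 * ENNReal.ofReal (l ^ (1 / 3 : ℝ)) *
        ((∫⁻ a in Set.Ioi (0 : ℝ), v a * ENNReal.ofReal (a ^ (1 / 3 : ℝ))) *
        (∫⁻ b in Set.Ioi (0 : ℝ), w b * ENNReal.ofReal (b ^ (1 / 3 : ℝ))) ^ (1 / 2 : ℝ)) := by
  set G := ∫⁻ b in Set.Ioi (0 : ℝ), w b * ENNReal.ofReal (b ^ (1 / 3 : ℝ)) with hG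
  calc ∫⁻ a in Set.Ioi (0 : ℝ), ∫⁻ b in Set.Ioc 0 (l * a), v a * w b ^ (1 / 2 : ℝ)
      ≤ ∫⁻ a in Set.Ioi (0 : ℝ), (v a * ENNReal.ofReal (a ^ (1 / 3 : ℝ))) *
          (2 * ENNReal.ofReal (l ^ (1 / 3 : ℝ)) * G ^ (1 / 2 : ℝ)) := by
        refine setLIntegral_mono' measurableSet_Ioi fun a ha => ?_
        have ha0 : (0 : ℝ) ≤ a := le_of_lt ha
        rw [lintegral_const_mul _ (by fun_prop)]
        refine (mul_le_mul_right (setLIntegral_sqrt_le hw (by positivity)) _).trans (le_of_eq ?_)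
        rw [Real.mul_rpow hl.le ha0, ENNReal.ofReal_mul (by positivity)]
        ring
    _ = _ := by
        rw [lintegral_mul_const _ (by fun_prop)]
        ring

/-- Hardy–Littlewood–Sobolev inequality with a free scaling parameter. -/
theorem lintegral_rieszKernel_mul_le {f g : ℝ → ℝ} (hf : Measurable f) (hf0 : 0 ≤ f)
    (hg : Measurable g) (hg0 : 0 ≤ g) {d : ℝ} (hd : 0 < d) :
    ∫⁻ s, ENNReal.ofReal (f s) * ∫⁻ t, ENNReal.ofReal (g t) * rieszKernel (t - s) ≤
      10 * (ENNReal.ofReal d * ((∫⁻ s, ENNReal.ofReal (f s ^ (4 / 3 : ℝ))) *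
          (∫⁻ s, ENNReal.ofReal (g s ^ (4 / 3 : ℝ))) ^ (1 / 2 : ℝ)) +
        ENNReal.ofReal d⁻¹ * ((∫⁻ s, ENNReal.ofReal (g s ^ (4 / 3 : ℝ))) *
          (∫⁻ s, ENNReal.ofReal (f s ^ (4 / 3 : ℝ))) ^ (1 / 2 : ℝ))) := by
  set v : ℝ → ℝ≥0∞ := fun a => volume {s | a < f s} with hvdef
  set w : ℝ → ℝ≥0∞ := fun b => volume {s | b < g s} with hwdef
  have hv : Measurable v := Antitone.measurable fun a b hab =>
    measure_mono fun s hs => lt_of_le_of_lt hab hs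
  have hw : Measurable w := Antitone.measurable fun a b hab =>
    measure_mono fun s hs => lt_of_le_of_lt hab hs
  have hker : Measurable fun p : ℝ × ℝ => rieszKernel (p.2 - p.1) :=
    measurable_rieszKernel.comp (measurable_snd.sub measurable_fst)
  have hh : Measurable fun s => ∫⁻ t, ENNReal.ofReal (g t) * rieszKernel (t - s) := by
    refine Measurable.lintegral_prod_right' (f := fun p : ℝ × ℝ =>
      ENNReal.ofReal (g p.2) * rieszKernel (p.2 - p.1)) ?_
    fun_prop
  -- Layer cake in both functions reduces the form to pairs of superlevel sets, where the bound for
  -- indicator functions applies.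
  have step1 : ∫⁻ s, ENNReal.ofReal (f s) * ∫⁻ t, ENNReal.ofReal (g t) * rieszKernel (t - s)
      ≤ ∫⁻ a in Set.Ioi (0 : ℝ), ∫⁻ b in Set.Ioi (0 : ℝ),
        5 * min (v a * w b ^ (1 / 2 : ℝ)) (w b * v a ^ (1 / 2 : ℝ)) := by
    rw [lintegral_ofReal_mul_eq_lintegral_superlevel hf hf0 hh]
    refine lintegral_mono fun a => ?_
    have hA : MeasurableSet {s | a < f s} := measurableSet_lt measurable_const hf
    have hk' : Measurable fun t => ∫⁻ s in {s | a < f s}, rieszKernel (t - s) :=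
      Measurable.lintegral_prod_right' (f := fun p : ℝ × ℝ => rieszKernel (p.1 - p.2))
        (measurable_rieszKernel.comp (measurable_fst.sub measurable_snd))
    calc ∫⁻ s in {s | a < f s}, ∫⁻ t, ENNReal.ofReal (g t) * rieszKernel (t - s)
        = ∫⁻ t, ∫⁻ s in {s | a < f s}, ENNReal.ofReal (g t) * rieszKernel (t - s) :=
          lintegral_lintegral_swap (by
            refine Measurable.aemeasurable (f := fun p : ℝ × ℝ =>
              ENNReal.ofReal (g p.2) * rieszKernel (p.2 - p.1)) ?_
            fun_prop)
      _ = ∫⁻ t, ENNReal.ofReal (g t) * ∫⁻ s in {s | a < f s}, rieszKernel (t - s) := by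
          refine lintegral_congr fun t => ?_
          rw [lintegral_const_mul]
          exact measurable_rieszKernel.comp (measurable_const.sub measurable_id)
      _ = ∫⁻ b in Set.Ioi (0 : ℝ), ∫⁻ t in {t | b < g t}, ∫⁻ s in {s | a < f s},
            rieszKernel (t - s) :=
          lintegral_ofReal_mul_eq_lintegral_superlevel hg hg0 hk'
      _ ≤ _ := by
          refine lintegral_mono fun b => ?_
          have hB : MeasurableSet {s | b < g s} := measurableSet_lt measurable_const hg
          rw [min_comm]
          refine le_trans (le_of_eq ?_) (setLIntegral_setLIntegral_rieszKernel_le hB hA)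
          refine lintegral_congr fun t => lintegral_congr fun s => ?_
          rw [← rieszKernel_neg, neg_sub]
  -- The `(a, b)` quadrant is cut along `b = d³a`, and the favourable branch of the minimum is used
  -- on each side. The cube root of the slope becomes the scaling parameter `d`.
  have hl : 0 < d ^ 3 := by positivity
  have hroot : (d ^ 3) ^ (1 / 3 : ℝ) = d := by
    rw [← Real.rpow_natCast, ← Real.rpow_mul hd.le]; norm_num
  have hroot' : ((d ^ 3)⁻¹) ^ (1 / 3 : ℝ) = d⁻¹ := by
    rw [Real.inv_rpow hl.le, hroot]
  have m1 : Measurable fun p : ℝ × ℝ => v p.1 * w p.2 ^ (1 / 2 : ℝ) := by fun_prop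
  have m2 : Measurable fun p : ℝ × ℝ => w p.2 * v p.1 ^ (1 / 2 : ℝ) := by fun_prop
  set S : Set (ℝ × ℝ) := {p | p.2 ≤ d ^ 3 * p.1} with hS
  set R : Set (ℝ × ℝ) := {p | p.1 ≤ (d ^ 3)⁻¹ * p.2} with hR
  have mS : MeasurableSet S := measurableSet_le (by fun_prop) (by fun_prop)
  have mR : MeasurableSet R := measurableSet_le (by fun_prop) (by fun_prop)
  have step2 : ∫⁻ a in Set.Ioi (0 : ℝ), ∫⁻ b in Set.Ioi (0 : ℝ),
        5 * min (v a * w b ^ (1 / 2 : ℝ)) (w b * v a ^ (1 / 2 : ℝ)) ≤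
      5 * ((∫⁻ a in Set.Ioi (0 : ℝ), ∫⁻ b in Set.Ioi (0 : ℝ),
          S.indicator (fun p => v p.1 * w p.2 ^ (1 / 2 : ℝ)) (a, b)) +
        ∫⁻ a in Set.Ioi (0 : ℝ), ∫⁻ b in Set.Ioi (0 : ℝ),
          R.indicator (fun p => w p.2 * v p.1 ^ (1 / 2 : ℝ)) (a, b)) := by
    rw [← lintegral_add_left (Measurable.lintegral_prod_right' (m1.indicator mS)),
      ← lintegral_const_mul' _ _ (by simp)]
    refine lintegral_mono fun a => ?_
    rw [← lintegral_add_left (f := fun b => S.indicator (fun p => v p.1 * w p.2 ^ (1 / 2 : ℝ)) (a, b))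
      ((m1.indicator mS).comp measurable_prodMk_left), ← lintegral_const_mul' _ _ (by simp)]
    refine lintegral_mono fun b => ?_
    simp only
    gcongr
    by_cases h : (a, b) ∈ S
    · rw [Set.indicator_of_mem h]
      exact (min_le_left _ _).trans le_self_add
    · have h' : (a, b) ∈ R := by
        simp only [hS, hR, Set.mem_ofPred_eq, not_le] at h ⊢
        rw [← div_eq_inv_mul, le_div_iff₀ hl]
        linarith
      rw [Set.indicator_of_mem h']
      exact (min_le_right _ _).trans le_add_self
  have e1 : ∫⁻ a in Set.Ioi (0 : ℝ), ∫⁻ b in Set.Ioi (0 : ℝ),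
      S.indicator (fun p => v p.1 * w p.2 ^ (1 / 2 : ℝ)) (a, b) =
      ∫⁻ a in Set.Ioi (0 : ℝ), ∫⁻ b in Set.Ioc 0 (d ^ 3 * a), v a * w b ^ (1 / 2 : ℝ) := by
    refine lintegral_congr fun a => ?_
    rw [← lintegral_indicator measurableSet_Ioc, ← lintegral_indicator measurableSet_Ioi]
    refine lintegral_congr fun b => ?_
    by_cases h0 : 0 < b <;> by_cases h : b ≤ d ^ 3 * a <;>
      simp [Set.indicator, hS, h0, h]
  have e2 : ∫⁻ a in Set.Ioi (0 : ℝ), ∫⁻ b in Set.Ioi (0 : ℝ),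
      R.indicator (fun p => w p.2 * v p.1 ^ (1 / 2 : ℝ)) (a, b) =
      ∫⁻ b in Set.Ioi (0 : ℝ), ∫⁻ a in Set.Ioc 0 ((d ^ 3)⁻¹ * b), w b * v a ^ (1 / 2 : ℝ) := by
    rw [lintegral_lintegral_swap (f := fun a b =>
      R.indicator (fun p => w p.2 * v p.1 ^ (1 / 2 : ℝ)) (a, b)) (m2.indicator mR).aemeasurable]
    refine lintegral_congr fun b => ?_
    rw [← lintegral_indicator measurableSet_Ioc, ← lintegral_indicator measurableSet_Ioi]
    refine lintegral_congr fun a => ?_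
    by_cases h0 : 0 < a <;> by_cases h : a ≤ (d ^ 3)⁻¹ * b <;>
      simp [Set.indicator, hR, h0, h]
  refine (step1.trans step2).trans ?_
  rw [e1, e2]
  refine (mul_le_mul_right (add_le_add (lintegral_lintegral_lt_le hv hw hl)
    (lintegral_lintegral_lt_le hw hv (inv_pos.2 hl))) _).trans ?_
  rw [hroot, hroot', mul_assoc 2, mul_assoc 2, ← mul_add, ← mul_assoc,
    show (5 : ℝ≥0∞) * 2 = 10 by norm_num]
  have hF := lintegral_superlevel_rpow hf hf0
  have hG := lintegral_superlevel_rpow hg hg0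
  exact mul_le_mul_right (add_le_add
    (mul_le_mul_right (mul_le_mul' hF (ENNReal.rpow_le_rpow hG (by norm_num))) _)
    (mul_le_mul_right (mul_le_mul' hG (ENNReal.rpow_le_rpow hF (by norm_num))) _)) _

/-- Hardy–Littlewood–Sobolev inequality, diagonal case. -/
theorem lintegral_rieszKernel_mul_self_le {f : ℝ → ℝ} (hf : Measurable f) (hf0 : 0 ≤ f) :
    ∫⁻ s, ENNReal.ofReal (f s) * ∫⁻ t, ENNReal.ofReal (f t) * rieszKernel (t - s) ≤
      20 * (∫⁻ s, ENNReal.ofReal (f s ^ (4 / 3 : ℝ))) ^ (3 / 2 : ℝ) := by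
  refine (lintegral_rieszKernel_mul_le hf hf0 hf hf0 one_pos).trans (le_of_eq ?_)
  set F := ∫⁻ s, ENNReal.ofReal (f s ^ (4 / 3 : ℝ))
  have : F * F ^ (1 / 2 : ℝ) = F ^ (3 / 2 : ℝ) := by
    nth_rw 1 [← ENNReal.rpow_one F]
    rw [← ENNReal.rpow_add_of_nonneg _ _ (by norm_num) (by norm_num)]
    norm_num
  rw [this]
  simp
  ring

/-- The Riesz potential of order `1/2`. -/
def riesz (f : ℝ → ℝ) (t : ℝ) : ℝ≥0∞ := ∫⁻ s, ENNReal.ofReal (f s) * rieszKernel (t - s)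

theorem measurable_riesz {f : ℝ → ℝ} (hf : Measurable f) : Measurable (riesz f) := by
  have hker : Measurable fun p : ℝ × ℝ => rieszKernel (p.1 - p.2) :=
    measurable_rieszKernel.comp (measurable_fst.sub measurable_snd)
  refine Measurable.lintegral_prod_right' (f := fun p : ℝ × ℝ =>
      ENNReal.ofReal (f p.2) * rieszKernel (p.1 - p.2)) ?_
  fun_prop

/-- Hardy–Littlewood–Sobolev inequality: the Riesz potential maps `L^{4/3}` to `L⁴`. -/
theorem lintegral_riesz_pow_le {f : ℝ → ℝ} (hf : Measurable f) (hf0 : 0 ≤ f) :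
    ∫⁻ t, riesz f t ^ 4 ≤ 160000 * (∫⁻ s, ENNReal.ofReal (f s ^ (4 / 3 : ℝ))) ^ 3 := by
  set F := ∫⁻ s, ENNReal.ofReal (f s ^ (4 / 3 : ℝ)) with hF
  rcases eq_or_ne F ∞ with hFtop | hFtop
  · rw [hFtop]; simp
  have hker : Measurable fun p : ℝ × ℝ => rieszKernel (p.1 - p.2) :=
    measurable_rieszKernel.comp (measurable_fst.sub measurable_snd)
  have mR := measurable_riesz hf
  rcases eq_or_ne F 0 with hF0 | hF0
  · have hz : ∀ t, riesz f t = 0 := by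
      intro t
      have h0 := (lintegral_eq_zero_iff (by fun_prop)).1 hF0
      have hk : Measurable fun s => rieszKernel (t - s) :=
        measurable_rieszKernel.comp (measurable_const.sub measurable_id)
      unfold riesz
      rw [lintegral_eq_zero_iff (by fun_prop)]
      filter_upwards [h0] with s hs
      simp only [Pi.zero_apply, ENNReal.ofReal_eq_zero] at hs
      have : f s = 0 := by
        by_contra hne
        have : 0 < f s := lt_of_le_of_ne (hf0 s) (Ne.symm hne)
        exact absurd hs (not_le.2 (by positivity))
      simp [this]
    simp [hz]
  -- Duality with the cube of a truncation of the potential: truncating in height and in time makes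
  -- the fourth-power integral finite a priori, so that it can be absorbed. Fatou's lemma removes
  -- the truncation.
  let h : ℕ → ℝ → ℝ := fun n t => (Set.Icc (-(n : ℝ)) n).indicator
    (fun t => (min (riesz f t) n).toReal) t
  have hm : ∀ n, Measurable (h n) := fun n =>
    Measurable.indicator (by fun_prop) measurableSet_Icc
  have hh0 : ∀ n, 0 ≤ h n := fun n t => Set.indicator_nonneg (fun _ _ => ENNReal.toReal_nonneg) t
  have hle : ∀ n t, ENNReal.ofReal (h n t) ≤ riesz f t := by
    intro n t
    by_cases ht : t ∈ Set.Icc (-(n : ℝ)) n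
    · simp only [h, Set.indicator_of_mem ht]
      rw [ENNReal.ofReal_toReal (by simp)]
      exact min_le_left _ _
    · simp [h, Set.indicator_of_notMem ht]
  have hlen : ∀ n t, ENNReal.ofReal (h n t) ≤ (Set.Icc (-(n : ℝ)) n).indicator (fun _ => (n : ℝ≥0∞)) t := by
    intro n t
    by_cases ht : t ∈ Set.Icc (-(n : ℝ)) n
    · simp only [h, Set.indicator_of_mem ht]
      rw [ENNReal.ofReal_toReal (by simp)]
      exact min_le_right _ _
    · simp [h, Set.indicator_of_notMem ht]
  have bound : ∀ n, ∫⁻ t, ENNReal.ofReal (h n t) ^ 4 ≤ 160000 * F ^ 3 := by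
    intro n
    set Y := ∫⁻ t, ENNReal.ofReal (h n t) ^ 4 with hY
    have hYtop : Y ≠ ∞ := by
      have : Y ≤ ∫⁻ t, (Set.Icc (-(n : ℝ)) n).indicator (fun _ => (n : ℝ≥0∞) ^ 4) t := by
        refine lintegral_mono fun t => ?_
        refine (pow_le_pow_left₀ zero_le (hlen n t) 4).trans (le_of_eq ?_)
        by_cases ht : t ∈ Set.Icc (-(n : ℝ)) n <;> simp [Set.indicator, ht]
      refine ne_top_of_le_ne_top ?_ this
      rw [lintegral_indicator measurableSet_Icc, setLIntegral_const]
      exact ENNReal.mul_ne_top (by simp) (by simp)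
    have hG : ∫⁻ s, ENNReal.ofReal ((h n s ^ 3) ^ (4 / 3 : ℝ)) = Y := by
      refine lintegral_congr fun s => ?_
      rw [← ENNReal.ofReal_pow (hh0 n s), ← Real.rpow_natCast, ← Real.rpow_natCast,
        ← Real.rpow_mul (hh0 n s)]
      norm_num
    have hB : ∀ d : ℝ, 0 < d → Y ≤ 10 * (ENNReal.ofReal d * (F * Y ^ (1 / 2 : ℝ)) +
        ENNReal.ofReal d⁻¹ * (Y * F ^ (1 / 2 : ℝ))) := by
      intro d hd
      have h1 := lintegral_rieszKernel_mul_le hf hf0 (g := fun s => h n s ^ 3)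
        ((hm n).pow_const 3) (fun s => pow_nonneg (hh0 n s) 3) hd
      rw [hG] at h1
      refine le_trans ?_ h1
      calc Y ≤ ∫⁻ t, ENNReal.ofReal (h n t ^ 3) * riesz f t := by
            refine lintegral_mono fun t => ?_
            simp only
            rw [ENNReal.ofReal_pow (hh0 n t), pow_succ]
            gcongr
            exact hle n t
        _ = ∫⁻ t, ∫⁻ s, ENNReal.ofReal (h n t ^ 3) * (ENNReal.ofReal (f s) * rieszKernel (t - s)) := by
            refine lintegral_congr fun t => ?_
            rw [riesz, ← lintegral_const_mul' _ _ (by simp)]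
        _ = ∫⁻ s, ∫⁻ t, ENNReal.ofReal (h n t ^ 3) * (ENNReal.ofReal (f s) * rieszKernel (t - s)) := by
            refine lintegral_lintegral_swap (Measurable.aemeasurable (f := fun p : ℝ × ℝ =>
              ENNReal.ofReal (h n p.1 ^ 3) * (ENNReal.ofReal (f p.2) * rieszKernel (p.1 - p.2))) ?_)
            have := hm n
            fun_prop
        _ = _ := by
            refine lintegral_congr fun s => ?_
            rw [← lintegral_const_mul' _ _ (by simp)]
            refine lintegral_congr fun t => ?_
            ring
    obtain ⟨y, hy0, hyY⟩ : ∃ y : ℝ, 0 ≤ y ∧ Y = ENNReal.ofReal y :=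
      ⟨Y.toReal, ENNReal.toReal_nonneg, (ENNReal.ofReal_toReal hYtop).symm⟩
    obtain ⟨φ, hφ0, hφF⟩ : ∃ φ : ℝ, 0 < φ ∧ F = ENNReal.ofReal φ :=
      ⟨F.toReal, ENNReal.toReal_pos hF0 hFtop, (ENNReal.ofReal_toReal hFtop).symm⟩
    have hs : 0 < √φ := Real.sqrt_pos.2 hφ0
    -- With this `d` the second term is exactly half of the left side and is absorbed.
    have hd := hB (20 * √φ) (by positivity)
    rw [hyY, hφF, ENNReal.ofReal_rpow_of_nonneg hy0 (by norm_num),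
      ENNReal.ofReal_rpow_of_nonneg hφ0.le (by norm_num), ← Real.sqrt_eq_rpow,
      ← Real.sqrt_eq_rpow, ← ENNReal.ofReal_mul hφ0.le, ← ENNReal.ofReal_mul hy0,
      ← ENNReal.ofReal_mul (by positivity), ← ENNReal.ofReal_mul (by positivity),
      ← ENNReal.ofReal_add (by positivity) (by positivity),
      show (10 : ℝ≥0∞) = ENNReal.ofReal 10 by simp, ← ENNReal.ofReal_mul (by norm_num),
      ENNReal.ofReal_le_ofReal_iff (by positivity)] at hd
    have e : (20 * √φ)⁻¹ * (y * √φ) = y / 20 := by field_simp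
    rw [e] at hd
    have h2 : y ≤ 400 * √φ * φ * √y := by linarith
    have h3 : √y ≤ 400 * √φ * φ := by
      rcases eq_or_lt_of_le (Real.sqrt_nonneg y) with h0 | h0
      · rw [← h0]; positivity
      · nlinarith [Real.mul_self_sqrt hy0]
    have h4 : y ≤ 160000 * φ ^ 3 := by
      calc y = √y ^ 2 := (Real.sq_sqrt hy0).symm
        _ ≤ (400 * √φ * φ) ^ 2 := by gcongr
        _ = 160000 * (√φ ^ 2) * φ ^ 2 := by ring
        _ = 160000 * φ ^ 3 := by rw [Real.sq_sqrt hφ0.le]; ring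
    rw [hyY, hφF, ← ENNReal.ofReal_pow hφ0.le, show (160000 : ℝ≥0∞) = ENNReal.ofReal 160000 by simp,
      ← ENNReal.ofReal_mul (by norm_num)]
    exact ENNReal.ofReal_le_ofReal h4
  have hlim : ∀ t, Tendsto (fun n => ENNReal.ofReal (h n t) ^ 4) atTop (𝓝 (riesz f t ^ 4)) := by
    intro t
    refine ENNReal.Tendsto.pow ?_
    have h1 : Tendsto (fun n : ℕ => min (riesz f t) n) atTop (𝓝 (riesz f t)) := by
      have := (tendsto_const_nhds (x := riesz f t)).min ENNReal.tendsto_nat_nhds_top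
      simpa using this
    refine h1.congr' ?_
    obtain ⟨N, hN⟩ := exists_nat_ge |t|
    filter_upwards [eventually_ge_atTop N] with n hn
    have hnt : t ∈ Set.Icc (-(n : ℝ)) n := by
      have : |t| ≤ n := hN.trans (by exact_mod_cast hn)
      exact abs_le.1 this
    simp only [h, Set.indicator_of_mem hnt]
    rw [ENNReal.ofReal_toReal (by simp)]
  calc ∫⁻ t, riesz f t ^ 4 = ∫⁻ t, liminf (fun n => ENNReal.ofReal (h n t) ^ 4) atTop := by
        refine lintegral_congr fun t => (hlim t).liminf_eq.symm
    _ ≤ liminf (fun n => ∫⁻ t, ENNReal.ofReal (h n t) ^ 4) atTop :=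
        lintegral_liminf_le fun n => by have := hm n; fun_prop
    _ ≤ 160000 * F ^ 3 := by
        refine (liminf_le_liminf (Eventually.of_forall bound)).trans ?_
        simp

/-! ### The Riesz potential of a complex-valued function. -/

theorem eLpNorm_four_thirds (g : ℝ → ℂ) :
    eLpNorm g (4 / 3) volume = (∫⁻ s, ‖g s‖ₑ ^ (4 / 3 : ℝ)) ^ (3 / 4 : ℝ) := by
  have h : ((4 / 3 : ℝ≥0∞)).toReal = 4 / 3 := by simp [ENNReal.toReal_div]
  rw [eLpNorm_eq_lintegral_rpow_enorm_toReal (by simp) (ENNReal.div_ne_top (by simp) (by simp)), h]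
  norm_num

/-- The Riesz potential of order `1/2` of `|g|`. -/
def rieszPot (g : ℝ → ℂ) (t : ℝ) : ℝ≥0∞ := ∫⁻ s, ‖g s‖ₑ * rieszKernel (t - s)

theorem rieszPot_congr {g g' : ℝ → ℂ} (h : g =ᵐ[volume] g') : rieszPot g = rieszPot g' := by
  ext t
  exact lintegral_congr_ae (h.mono fun s hs => by simp only [hs])

theorem rieszPot_eq_riesz (g : ℝ → ℂ) : rieszPot g = riesz fun s => ‖g s‖ := by
  ext t
  simp [rieszPot, riesz]

theorem measurable_rieszPot {g : ℝ → ℂ} (hg : AEStronglyMeasurable g volume) :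
    Measurable (rieszPot g) := by
  rw [rieszPot_congr hg.ae_eq_mk, rieszPot_eq_riesz]
  exact measurable_riesz hg.stronglyMeasurable_mk.measurable.norm

theorem lintegral_norm_rpow_eq (g : ℝ → ℂ) :
    ∫⁻ s, ENNReal.ofReal (‖g s‖ ^ (4 / 3 : ℝ)) = ∫⁻ s, ‖g s‖ₑ ^ (4 / 3 : ℝ) :=
  lintegral_congr fun s => by
    rw [← ENNReal.ofReal_rpow_of_nonneg (norm_nonneg _) (by norm_num), ofReal_norm]

theorem lintegral_rieszPot_pow_le {g : ℝ → ℂ} (hg : AEStronglyMeasurable g volume) :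
    ∫⁻ t, rieszPot g t ^ 4 ≤ (20 * eLpNorm g (4 / 3) volume) ^ 4 := by
  have h := lintegral_riesz_pow_le hg.stronglyMeasurable_mk.measurable.norm
    (fun s => norm_nonneg _)
  rw [← rieszPot_eq_riesz, ← rieszPot_congr hg.ae_eq_mk, lintegral_norm_rpow_eq] at h
  rw [eLpNorm_congr_ae hg.ae_eq_mk, eLpNorm_four_thirds, mul_pow, ← ENNReal.rpow_natCast,
    ← ENNReal.rpow_natCast, ← ENNReal.rpow_mul]
  refine h.trans (le_of_eq ?_)
  rw [← ENNReal.rpow_natCast]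
  norm_num

theorem lintegral_mul_rieszPot_le {g : ℝ → ℂ} (hg : AEStronglyMeasurable g volume) :
    ∫⁻ t, ‖g t‖ₑ * rieszPot g t ≤ 20 * eLpNorm g (4 / 3) volume ^ 2 := by
  have h := lintegral_rieszKernel_mul_self_le hg.stronglyMeasurable_mk.measurable.norm
    (fun s => norm_nonneg _)
  rw [lintegral_norm_rpow_eq] at h
  rw [eLpNorm_congr_ae hg.ae_eq_mk, eLpNorm_four_thirds, ← ENNReal.rpow_natCast,
    ← ENNReal.rpow_mul]
  have e : ∫⁻ t, ‖g t‖ₑ * rieszPot g t = ∫⁻ t, ‖hg.mk g t‖ₑ * rieszPot (hg.mk g) t := by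
    rw [rieszPot_congr hg.ae_eq_mk]
    exact lintegral_congr_ae (hg.ae_eq_mk.mono fun s hs => by simp only [← hs])
  rw [e]
  refine le_trans (le_of_eq ?_) (h.trans (le_of_eq (by norm_num)))
  refine lintegral_congr fun s => ?_
  simp only [rieszPot, ofReal_norm]
  congr 1
  refine lintegral_congr fun t => ?_
  rw [← rieszKernel_neg, neg_sub]

theorem ae_rieszPot_lt_top {g : ℝ → ℂ} (hg : MemLp g (4 / 3) volume) :
    ∀ᵐ t, rieszPot g t < ∞ := by
  have h : ∫⁻ t, rieszPot g t ^ 4 ≠ ∞ :=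
    ne_top_of_le_ne_top (ENNReal.pow_ne_top (ENNReal.mul_ne_top (by simp) hg.2.ne))
      (lintegral_rieszPot_pow_le hg.1)
  filter_upwards [ae_lt_top ((measurable_rieszPot hg.1).pow_const 4) h] with t ht
  by_contra hc
  rw [not_lt, top_le_iff] at hc
  simp [hc] at ht

/-! ### The Schrödinger kernel and its Gaussian regularisation -/

/-- The exponent `ε + 4π²iτ`. -/
def kernelExp (ε τ : ℝ) : ℂ := (ε : ℂ) + 4 * (Real.pi : ℂ) ^ 2 * Complex.I * (τ : ℂ)

/-- The inverse Fourier transform of `e^{-(ε + 4π²iτ)ξ²}`. -/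
def kernel (ε τ x : ℝ) : ℂ :=
  ((Real.pi : ℂ) / kernelExp ε τ) ^ (1 / 2 : ℂ) *
    Complex.exp (-(2 * Real.pi * x : ℂ) ^ 2 / (4 * kernelExp ε τ))

theorem kernelExp_re (ε τ : ℝ) : (kernelExp ε τ).re = ε := by
  simp [kernelExp, ← Complex.ofReal_pow, ← Complex.ofReal_ofNat]

theorem kernelExp_im (ε τ : ℝ) : (kernelExp ε τ).im = 4 * Real.pi ^ 2 * τ := by
  simp [kernelExp, ← Complex.ofReal_pow, ← Complex.ofReal_ofNat]

theorem kernelExp_ne_zero {ε τ : ℝ} (hτ : τ ≠ 0) : kernelExp ε τ ≠ 0 := by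
  intro h
  have := kernelExp_im ε τ
  rw [h, Complex.zero_im] at this
  have hpi := Real.pi_ne_zero
  exact absurd this.symm (by positivity)

theorem measurable_kernel (ε : ℝ) : Measurable fun p : ℝ × ℝ => kernel ε p.1 p.2 := by
  unfold kernel kernelExp
  fun_prop

theorem continuous_kernel (ε τ : ℝ) : Continuous (kernel ε τ) := by
  unfold kernel
  fun_prop

/-- For `ε ≥ 0` the Gaussian factor has modulus at most one, and the imaginary part alone gives `|ε
+ 4π²iτ| ≥ 4π²|τ|`. The bound is uniform in `ε` and `x`, so it also dominates the passage `ε → 0`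
and survives any choice of positions `x(t)`. -/
theorem norm_kernel_le {ε : ℝ} (hε : 0 ≤ ε) {τ : ℝ} (hτ : τ ≠ 0) (x : ℝ) :
    ‖kernel ε τ x‖ ≤ |τ| ^ (-(1 / 2) : ℝ) := by
  have hb := kernelExp_ne_zero (ε := ε) hτ
  have h1 : ‖Complex.exp (-(2 * Real.pi * x : ℂ) ^ 2 / (4 * kernelExp ε τ))‖ ≤ 1 := by
    rw [Complex.norm_exp, Real.exp_le_one_iff]
    have : -(2 * Real.pi * x : ℂ) ^ 2 / (4 * kernelExp ε τ)
        = ((-(Real.pi * x) ^ 2 : ℝ) : ℂ) * (kernelExp ε τ)⁻¹ := by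
      push_cast
      field_simp
      ring
    rw [this, Complex.re_ofReal_mul, Complex.inv_re, kernelExp_re]
    refine mul_nonpos_of_nonpos_of_nonneg (by nlinarith [sq_nonneg (Real.pi * x)]) ?_
    exact div_nonneg hε (Complex.normSq_nonneg _)
  have h2 : ‖((Real.pi : ℂ) / kernelExp ε τ) ^ (1 / 2 : ℂ)‖ ≤ |τ| ^ (-(1 / 2) : ℝ) := by
    have e : (1 / 2 : ℂ) = ((1 / 2 : ℝ) : ℂ) := by norm_num
    rw [e, Complex.norm_cpow_real, norm_div, Complex.norm_real, Real.norm_of_nonneg Real.pi_pos.le]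
    have h3 : 4 * Real.pi ^ 2 * |τ| ≤ ‖kernelExp ε τ‖ := by
      have := Complex.abs_im_le_norm (kernelExp ε τ)
      rwa [kernelExp_im, abs_mul, abs_of_nonneg (by positivity)] at this
    have h4 : Real.pi / ‖kernelExp ε τ‖ ≤ |τ|⁻¹ := by
      have hτ' : 0 < |τ| := abs_pos.2 hτ
      have hn : 0 < ‖kernelExp ε τ‖ := norm_pos_iff.2 hb
      rw [div_le_iff₀ hn, inv_mul_eq_div, le_div_iff₀ hτ']
      refine le_trans ?_ h3
      nlinarith [Real.pi_gt_three, mul_pos Real.pi_pos hτ']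
    calc (Real.pi / ‖kernelExp ε τ‖) ^ (1 / 2 : ℝ) ≤ (|τ|⁻¹) ^ (1 / 2 : ℝ) := by gcongr
      _ = |τ| ^ (-(1 / 2) : ℝ) := by
        rw [Real.inv_rpow (abs_nonneg _), ← Real.rpow_neg (abs_nonneg _)]
  unfold kernel
  rw [norm_mul]
  calc _ ≤ |τ| ^ (-(1 / 2) : ℝ) * 1 := by gcongr
    _ = _ := mul_one _

theorem enorm_kernel_le {ε : ℝ} (hε : 0 ≤ ε) {τ : ℝ} (hτ : τ ≠ 0) (x : ℝ) :
    ‖kernel ε τ x‖ₑ ≤ rieszKernel τ := by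
  rw [← ofReal_norm]
  exact ENNReal.ofReal_le_ofReal (norm_kernel_le hε hτ x)

/-- Division by zero and `0 ^ (1/2)` both return `0`, so bounds and identities at `ε = 0` need no
exception on the diagonal `τ = 0`. -/
theorem kernel_zero_zero (x : ℝ) : kernel 0 0 x = 0 := by
  simp [kernel, kernelExp]

theorem enorm_kernel_zero_le (τ x : ℝ) : ‖kernel 0 τ x‖ₑ ≤ rieszKernel τ := by
  rcases eq_or_ne τ 0 with rfl | h
  · simp [kernel_zero_zero]
  · exact enorm_kernel_le le_rfl h x

/-- The base of the square root has nonzero imaginary part, hence avoids the branch cut. This allows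
both the limit `ε → 0` and complex conjugation of the principal root. -/
theorem div_kernelExp_mem_slitPlane {τ : ℝ} (hτ : τ ≠ 0) :
    (Real.pi : ℂ) / kernelExp 0 τ ∈ Complex.slitPlane := by
  right
  have hb := kernelExp_ne_zero (ε := 0) hτ
  rw [div_eq_mul_inv, Complex.im_ofReal_mul, Complex.inv_im, kernelExp_im]
  have := Complex.normSq_pos.2 hb
  have hpi := Real.pi_pos
  have : (4 * Real.pi ^ 2 * τ) ≠ 0 := by positivity
  exact mul_ne_zero hpi.ne' (div_ne_zero (neg_ne_zero.2 this) (by positivity))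

theorem tendsto_kernel {τ : ℝ} (hτ : τ ≠ 0) (x : ℝ) :
    Tendsto (fun ε => kernel ε τ x) (𝓝 0) (𝓝 (kernel 0 τ x)) := by
  have hb := kernelExp_ne_zero (ε := 0) hτ
  have hc : ContinuousAt (fun ε : ℝ => kernelExp ε τ) 0 := by
    unfold kernelExp
    fun_prop
  have h1 : ContinuousAt (fun ε : ℝ => ((Real.pi : ℂ) / kernelExp ε τ) ^ (1 / 2 : ℂ)) 0 :=
    ContinuousAt.cpow (continuousAt_const.div hc hb) continuousAt_const
      (div_kernelExp_mem_slitPlane hτ)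
  have h2 : ContinuousAt (fun ε : ℝ =>
      Complex.exp (-(2 * Real.pi * x : ℂ) ^ 2 / (4 * kernelExp ε τ))) 0 :=
    (continuousAt_const.div (continuousAt_const.mul hc) (by simpa using hb)).cexp
  exact h1.mul h2

theorem conj_kernelExp (ε τ : ℝ) : conj (kernelExp ε τ) = kernelExp ε (-τ) := by
  simp [kernelExp, Complex.conj_ofNat]

theorem conj_kernel_zero (τ x : ℝ) : conj (kernel 0 τ x) = kernel 0 (-τ) x := by
  rcases eq_or_ne τ 0 with rfl | hτ
  · simp [kernel_zero_zero]
  unfold kernel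
  rw [map_mul, ← Complex.exp_conj, ← conj_kernelExp]
  congr 1
  · have harg := (Complex.mem_slitPlane_iff_arg.1 (div_kernelExp_mem_slitPlane hτ)).1
    have := Complex.conj_cpow ((Real.pi : ℂ) / kernelExp 0 τ) (1 / 2 : ℂ) harg
    rw [map_div₀, Complex.conj_ofReal] at this
    rw [this]
    simp [Complex.conj_ofNat]
  · simp [Complex.conj_ofNat]

/-- The phase of the kernel at the origin. -/
theorem I_mul_kernel_of_pos {τ : ℝ} (hτ : 0 < τ) :
    Complex.I * kernel 0 τ 0 = kernel 0 (-τ) 0 := by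
  have h1 : (τ : ℂ) ≠ 0 := by exact_mod_cast hτ.ne'
  have h2 : (Real.pi : ℂ) ≠ 0 := by exact_mod_cast Real.pi_ne_zero
  have hneg : (Real.pi : ℂ) / kernelExp 0 (-τ) = (((4 * Real.pi * τ)⁻¹ : ℝ) : ℂ) * Complex.I := by
    unfold kernelExp
    push_cast
    field_simp
    ring_nf
    simp
  have hpos : (Real.pi : ℂ) / kernelExp 0 τ = (((4 * Real.pi * τ)⁻¹ : ℝ) : ℂ) * (-Complex.I) := by
    unfold kernelExp
    push_cast
    field_simp
    ring_nf
    simp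
  have hpi := Real.pi_pos
  have hp : 0 < (4 * Real.pi * τ)⁻¹ := by positivity
  have hp' : (((4 * Real.pi * τ)⁻¹ : ℝ) : ℂ) ≠ 0 := by exact_mod_cast hp.ne'
  unfold kernel
  rw [hneg, hpos, Complex.cpow_def_of_ne_zero (by simpa using hp'),
    Complex.cpow_def_of_ne_zero (by simpa using hp'),
    Complex.log_ofReal_mul hp (by simp), Complex.log_ofReal_mul hp (by simp),
    Complex.log_I, Complex.log_neg_I]
  simp only [Complex.ofReal_zero, mul_zero, ne_eq, OfNat.ofNat_ne_zero, not_false_eq_true,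
    zero_pow, neg_zero, zero_div, Complex.exp_zero, mul_one]
  -- The phases satisfy `e^{iπ/2} e^{-iπ/4} = e^{iπ/4}`.
  nth_rw 1 [← Complex.exp_pi_div_two_mul_I]
  rw [← Complex.exp_add]
  congr 1
  ring

theorem I_mul_kernel_of_neg {τ : ℝ} (hτ : τ < 0) :
    Complex.I * kernel 0 τ 0 = -kernel 0 (-τ) 0 := by
  have h := I_mul_kernel_of_pos (neg_pos.2 hτ)
  rw [neg_neg] at h
  rw [← h, ← mul_assoc, Complex.I_mul_I, neg_one_mul]

/-! ### The dual Strichartz estimate -/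

/-- The character `ξ ↦ e^{-2πi(xξ - 2πsξ²)}`. -/
def wave (x s ξ : ℝ) : ℂ := Complex.exp (-(Complex.I * ((2 * Real.pi * x * ξ : ℝ) : ℂ))) * symbol (-s) ξ

theorem norm_wave (x s ξ : ℝ) : ‖wave x s ξ‖ = 1 := by
  rw [wave, norm_mul, norm_symbol, mul_one, ← mul_neg, mul_comm, ← Complex.ofReal_neg,
    Complex.norm_exp_ofReal_mul_I]

theorem measurable_wave {x : ℝ → ℝ} (hx : Measurable x) :
    Measurable fun p : ℝ × ℝ => wave (x p.1) p.1 p.2 := by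
  unfold wave symbol
  fun_prop

/-- The adjoint of the map `ĥ ↦ (s ↦ (e^{is∂²}h)(x(s)))`. -/
def adjointWave (x : ℝ → ℝ) (g : ℝ → ℂ) (ξ : ℝ) : ℂ := ∫ s, wave (x s) s ξ * g s

theorem integrable_wave_mul {x : ℝ → ℝ} (hx : Measurable x) {g : ℝ → ℂ} (hg : Integrable g)
    (ξ : ℝ) : Integrable fun s => wave (x s) s ξ * g s := by
  refine hg.bdd_mul (c := 1) ?_ (Eventually.of_forall fun s => (norm_wave _ _ _).le)
  exact ((measurable_wave hx).comp measurable_prodMk_right).aestronglyMeasurable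

theorem norm_adjointWave_le (x : ℝ → ℝ) (g : ℝ → ℂ) (ξ : ℝ) :
    ‖adjointWave x g ξ‖ ≤ ∫ s, ‖g s‖ := by
  refine (norm_integral_le_integral_norm _).trans (le_of_eq ?_)
  simp [norm_wave]

theorem continuous_adjointWave {x : ℝ → ℝ} (hx : Measurable x) {g : ℝ → ℂ} (hg : Integrable g) :
    Continuous (adjointWave x g) := by
  refine continuous_of_dominated (fun ξ => (integrable_wave_mul hx hg ξ).1)
    (bound := fun s => ‖g s‖) (fun ξ => Eventually.of_forall fun s => ?_) hg.norm
    (Eventually.of_forall fun s => ?_)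
  · rw [norm_mul, norm_wave, one_mul]
  · unfold wave symbol
    fun_prop

/-- The `TT*` kernel. Without the factor `e^{-εξ²}` the integral in `ξ` does not converge
absolutely; with it, this is the Fourier transform of a Gaussian with complex exponent. -/
theorem integral_gaussian_mul_conj_wave_mul_wave {ε : ℝ} (hε : 0 < ε) (x y t s : ℝ) :
    ∫ ξ : ℝ, (Real.exp (-ε * ξ ^ 2) : ℂ) * (conj (wave x t ξ) * wave y s ξ)
      = kernel ε (t - s) (x - y) := by
  have h := fourierIntegral_gaussian (b := kernelExp ε (t - s)) (by rwa [kernelExp_re])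
    ((2 * Real.pi * (x - y : ℝ) : ℝ) : ℂ)
  unfold kernel
  rw [show (-(2 * Real.pi * ((x - y : ℝ) : ℂ)) ^ 2 / (4 * kernelExp ε (t - s)))
    = -((2 * Real.pi * (x - y : ℝ) : ℝ) : ℂ) ^ 2 / (4 * kernelExp ε (t - s)) by push_cast; rfl, ← h]
  refine integral_congr_ae (Eventually.of_forall fun ξ => ?_)
  simp only [wave, symbol, map_mul, ← Complex.exp_conj]
  simp only [map_neg, map_mul, Complex.conj_I, Complex.conj_ofReal, kernelExp,
    Complex.ofReal_exp]
  simp only [← Complex.exp_add]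
  congr 1
  push_cast
  ring

theorem integrable_gaussian_prod {ε : ℝ} (hε : 0 < ε) {x : ℝ → ℝ} (hx : Measurable x) {g : ℝ → ℂ}
    (hg : Integrable g) :
    Integrable (fun z : ℝ × (ℝ × ℝ) => (Real.exp (-ε * z.1 ^ 2) : ℂ) *
      (conj (wave (x z.2.1) z.2.1 z.1 * g z.2.1) * (wave (x z.2.2) z.2.2 z.1 * g z.2.2)))
      (volume.prod (volume : Measure (ℝ × ℝ))) := by
  have h1 : Integrable (fun ξ : ℝ => (Real.exp (-ε * ξ ^ 2) : ℂ)) :=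
    (integrable_exp_neg_mul_sq hε).ofReal
  have hgc : Integrable (fun s => conj (g s)) :=
    (Complex.conjLIE.toContinuousLinearEquiv.integrable_comp_iff).2 hg
  have h2 : Integrable (fun p : ℝ × ℝ => conj (g p.1) * g p.2) (volume : Measure (ℝ × ℝ)) :=
    hgc.mul_prod hg
  have h3 := h1.mul_prod h2
  have m2 : Measurable fun z : ℝ × (ℝ × ℝ) => wave (x z.2.2) z.2.2 z.1 := by
    unfold wave symbol
    fun_prop
  have m3 : Measurable fun z : ℝ × (ℝ × ℝ) => wave (x z.2.1) z.2.1 z.1 := by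
    unfold wave symbol
    fun_prop
  have hconj : Measurable fun c : ℂ => conj c := Complex.continuous_conj.measurable
  have m1 : Measurable fun z : ℝ × (ℝ × ℝ) => conj (wave (x z.2.1) z.2.1 z.1) := hconj.comp m3
  have hb : ∀ z : ℝ × (ℝ × ℝ),
      ‖conj (wave (x z.2.1) z.2.1 z.1) * wave (x z.2.2) z.2.2 z.1‖ ≤ 1 := fun z => by
    rw [norm_mul, RCLike.norm_conj, norm_wave, norm_wave, one_mul]
  have h4 := h3.bdd_mul (m1.mul m2).aestronglyMeasurable (Eventually.of_forall hb)
  convert h4 using 2 with z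
  simp only [map_mul, Pi.mul_apply]
  ring

theorem integral_gaussian_mul_sq_adjointWave {ε : ℝ} (hε : 0 < ε) {x : ℝ → ℝ} (hx : Measurable x)
    {g : ℝ → ℂ} (hg : Integrable g) :
    ∫ ξ : ℝ, (Real.exp (-ε * ξ ^ 2) : ℂ) * (conj (adjointWave x g ξ) * adjointWave x g ξ)
      = ∫ p : ℝ × ℝ, conj (g p.1) * g p.2 * kernel ε (p.1 - p.2) (x p.1 - x p.2) := by
  have e1 : ∀ ξ : ℝ, (Real.exp (-ε * ξ ^ 2) : ℂ) * (conj (adjointWave x g ξ) * adjointWave x g ξ)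
      = ∫ p : ℝ × ℝ, (Real.exp (-ε * ξ ^ 2) : ℂ) * (conj (wave (x p.1) p.1 ξ * g p.1) *
        (wave (x p.2) p.2 ξ * g p.2)) := by
    intro ξ
    rw [integral_const_mul, Measure.volume_eq_prod, integral_prod_mul
      (fun s => conj (wave (x s) s ξ * g s)) (fun s => wave (x s) s ξ * g s), integral_conj]
    rfl
  simp_rw [e1]
  rw [integral_integral_swap (f := fun (ξ : ℝ) (p : ℝ × ℝ) => (Real.exp (-ε * ξ ^ 2) : ℂ) *
    (conj (wave (x p.1) p.1 ξ * g p.1) * (wave (x p.2) p.2 ξ * g p.2)))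
    (integrable_gaussian_prod hε hx hg)]
  refine integral_congr_ae (Eventually.of_forall fun p => ?_)
  simp only
  rw [← integral_gaussian_mul_conj_wave_mul_wave hε, ← integral_const_mul]
  refine integral_congr_ae (Eventually.of_forall fun ξ => ?_)
  simp only [map_mul]
  ring

theorem ae_fst_ne_snd : ∀ᵐ p : ℝ × ℝ, p.1 - p.2 ≠ 0 := by
  rw [Measure.volume_eq_prod]
  have hm : MeasurableSet {p : ℝ × ℝ | p.1 - p.2 ≠ 0} :=
    (measurableSet_eq_fun (f := fun p : ℝ × ℝ => p.1 - p.2) (by fun_prop) measurable_const).compl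
  rw [Measure.ae_prod_iff_ae_ae hm]
  refine Eventually.of_forall fun a => ?_
  have : ∀ᵐ b : ℝ, b ≠ a := by simp [ae_iff]
  filter_upwards [this] with b hb h
  exact hb (by linarith)

theorem lintegral_prod_enorm_mul_rieszKernel_le {g : ℝ → ℂ} (hg : AEStronglyMeasurable g volume) :
    ∫⁻ p : ℝ × ℝ, ‖g p.1‖ₑ * ‖g p.2‖ₑ * rieszKernel (p.1 - p.2)
      ≤ 20 * eLpNorm g (4 / 3) volume ^ 2 := by
  have hm : AEMeasurable (fun p : ℝ × ℝ => ‖g p.1‖ₑ * ‖g p.2‖ₑ * rieszKernel (p.1 - p.2))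
      (volume.prod volume) :=
    (hg.comp_fst.enorm.mul hg.comp_snd.enorm).mul
      (measurable_rieszKernel.comp (measurable_fst.sub measurable_snd)).aemeasurable
  rw [Measure.volume_eq_prod, lintegral_prod _ hm]
  refine le_trans (le_of_eq ?_) (lintegral_mul_rieszPot_le hg)
  refine lintegral_congr fun t => ?_
  rw [rieszPot, ← lintegral_const_mul' _ _ (by simp)]
  simp only [mul_assoc]

/-- Dual Strichartz estimate, linearised in the position variable. -/
theorem eLpNorm_adjointWave_le {x : ℝ → ℝ} (hx : Measurable x) {g : ℝ → ℂ} (hg : Integrable g) :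
    eLpNorm (adjointWave x g) 2 volume ^ 2 ≤ 20 * eLpNorm g (4 / 3) volume ^ 2 := by
  have hc := continuous_adjointWave hx hg
  -- The regularised square of the `L²` norm is a double integral against `kernel ε`, whose modulus
  -- is at most `|t-s|^{-1/2}` whatever the positions `x`; Hardy–Littlewood–Sobolev finishes,
  -- uniformly in `ε`, and Fatou lets `ε → 0`.
  have bound : ∀ ε : ℝ, 0 < ε →
      ∫⁻ ξ, ENNReal.ofReal (Real.exp (-ε * ξ ^ 2)) * ‖adjointWave x g ξ‖ₑ ^ 2
        ≤ 20 * eLpNorm g (4 / 3) volume ^ 2 := by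
    intro ε hε
    have h1 : Integrable (fun ξ => Real.exp (-ε * ξ ^ 2) * ‖adjointWave x g ξ‖ ^ 2) := by
      refine (integrable_exp_neg_mul_sq hε).mul_bdd (c := (∫ s, ‖g s‖) ^ 2)
        (by fun_prop) (Eventually.of_forall fun ξ => ?_)
      rw [norm_pow, norm_norm]
      exact pow_le_pow_left₀ (norm_nonneg _) (norm_adjointWave_le _ _ _) 2
    have h2 := integral_gaussian_mul_sq_adjointWave hε hx hg
    have h3 : ((∫ ξ, Real.exp (-ε * ξ ^ 2) * ‖adjointWave x g ξ‖ ^ 2 : ℝ) : ℂ)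
        = ∫ p : ℝ × ℝ, conj (g p.1) * g p.2 * kernel ε (p.1 - p.2) (x p.1 - x p.2) := by
      rw [← h2, ← integral_complex_ofReal]
      refine integral_congr_ae (Eventually.of_forall fun ξ => ?_)
      simp only [RCLike.conj_mul]
      push_cast
      rfl
    calc ∫⁻ ξ, ENNReal.ofReal (Real.exp (-ε * ξ ^ 2)) * ‖adjointWave x g ξ‖ₑ ^ 2
        = ∫⁻ ξ, ENNReal.ofReal (Real.exp (-ε * ξ ^ 2) * ‖adjointWave x g ξ‖ ^ 2) := by
          refine lintegral_congr fun ξ => ?_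
          rw [ENNReal.ofReal_mul (by positivity), ENNReal.ofReal_pow (norm_nonneg _), ofReal_norm]
      _ = ENNReal.ofReal (∫ ξ, Real.exp (-ε * ξ ^ 2) * ‖adjointWave x g ξ‖ ^ 2) :=
          (ofReal_integral_eq_lintegral_ofReal h1 (Eventually.of_forall fun ξ => by positivity)).symm
      _ ≤ ‖((∫ ξ, Real.exp (-ε * ξ ^ 2) * ‖adjointWave x g ξ‖ ^ 2 : ℝ) : ℂ)‖ₑ := by
          rw [← ofReal_norm, Complex.norm_real]
          exact ENNReal.ofReal_le_ofReal (Real.le_norm_self _)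
      _ ≤ ∫⁻ p : ℝ × ℝ, ‖conj (g p.1) * g p.2 * kernel ε (p.1 - p.2) (x p.1 - x p.2)‖ₑ := by
          rw [h3]
          exact enorm_integral_le_lintegral_enorm _
      _ ≤ ∫⁻ p : ℝ × ℝ, ‖g p.1‖ₑ * ‖g p.2‖ₑ * rieszKernel (p.1 - p.2) := by
          refine lintegral_mono_ae (ae_fst_ne_snd.mono fun p hp => ?_)
          rw [enorm_mul, enorm_mul, RCLike.enorm_conj]
          gcongr
          exact enorm_kernel_le hε.le hp _
      _ ≤ _ := lintegral_prod_enorm_mul_rieszKernel_le hg.1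
  have e : eLpNorm (adjointWave x g) 2 volume ^ 2 = ∫⁻ ξ, ‖adjointWave x g ξ‖ₑ ^ 2 := by
    rw [eLpNorm_eq_lintegral_rpow_enorm_toReal (by simp) (by simp), ← ENNReal.rpow_natCast,
      ← ENNReal.rpow_mul]
    simp
  rw [e]
  let ε : ℕ → ℝ := fun n => 1 / ((n : ℝ) + 1)
  have hε : Tendsto ε atTop (𝓝 0) := tendsto_one_div_add_atTop_nhds_zero_nat
  have hlim : ∀ ξ, Tendsto (fun n => ENNReal.ofReal (Real.exp (-ε n * ξ ^ 2)) *
      ‖adjointWave x g ξ‖ₑ ^ 2) atTop (𝓝 (‖adjointWave x g ξ‖ₑ ^ 2)) := by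
    intro ξ
    have h1 : Tendsto (fun n => Real.exp (-ε n * ξ ^ 2)) atTop (𝓝 1) := by
      have : Continuous fun e : ℝ => Real.exp (-e * ξ ^ 2) := by fun_prop
      have h0 := (this.tendsto 0).comp hε
      rw [neg_zero, zero_mul, Real.exp_zero] at h0
      exact h0
    have h2 := ENNReal.Tendsto.mul_const (b := ‖adjointWave x g ξ‖ₑ ^ 2)
      (ENNReal.tendsto_ofReal h1) (Or.inl (by simp))
    simpa using h2
  calc ∫⁻ ξ, ‖adjointWave x g ξ‖ₑ ^ 2
      = ∫⁻ ξ, liminf (fun n => ENNReal.ofReal (Real.exp (-ε n * ξ ^ 2)) *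
        ‖adjointWave x g ξ‖ₑ ^ 2) atTop := lintegral_congr fun ξ => (hlim ξ).liminf_eq.symm
    _ ≤ liminf (fun n => ∫⁻ ξ, ENNReal.ofReal (Real.exp (-ε n * ξ ^ 2)) *
        ‖adjointWave x g ξ‖ₑ ^ 2) atTop := lintegral_liminf_le fun n => by fun_prop
    _ ≤ _ := by
        refine (liminf_le_liminf (Eventually.of_forall fun n => bound (ε n) ?_)).trans ?_
        · exact Nat.one_div_pos_of_nat
        · simp

/-! ### Positivity -/

theorem integrable_prod_kernel {g : ℝ → ℂ} (hg : MemLp g (4 / 3) volume) :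
    Integrable (fun p : ℝ × ℝ => conj (g p.1) * g p.2 * kernel 0 (p.2 - p.1) 0) := by
  have hgm := hg.1
  refine ⟨?_, ?_⟩
  · rw [Measure.volume_eq_prod]
    refine AEStronglyMeasurable.mul ?_ ?_
    · exact (Complex.continuous_conj.comp_aestronglyMeasurable hgm.comp_fst).mul hgm.comp_snd
    · exact ((measurable_kernel 0).comp (by fun_prop : Measurable
        fun p : ℝ × ℝ => (p.2 - p.1, (0 : ℝ)))).aestronglyMeasurable
  · refine lt_of_le_of_lt (lintegral_mono fun p => ?_)
      (lt_of_le_of_lt (lintegral_prod_enorm_mul_rieszKernel_le hgm)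
        (ENNReal.mul_lt_top (by simp) (ENNReal.pow_lt_top hg.2)))
    rw [enorm_mul, enorm_mul, RCLike.enorm_conj, ← rieszKernel_neg (p.1 - p.2), neg_sub]
    gcongr
    exact enorm_kernel_zero_le _ _

/-- The kernel `E₀(s - t, 0)` is positive semidefinite. -/
theorem re_integral_prod_kernel_nonneg {g : ℝ → ℂ} (hg : MemLp g (4 / 3) volume)
    (hgi : Integrable g) :
    0 ≤ (∫ p : ℝ × ℝ, conj (g p.1) * g p.2 * kernel 0 (p.2 - p.1) 0).re := by
  -- Exchanging the variables replaces `g` by its conjugate and reverses the time difference. The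
  -- form is then the limit of `∫ e^{-εξ²} |T*ḡ(ξ)|² dξ`, with all positions equal to `0`.
  have hswap : ∫ p : ℝ × ℝ, conj (g p.1) * g p.2 * kernel 0 (p.2 - p.1) 0
      = ∫ p : ℝ × ℝ, conj (conj (g p.1)) * conj (g p.2) * kernel 0 (p.1 - p.2) 0 := by
    rw [Measure.volume_eq_prod, ← integral_prod_swap]
    refine integral_congr_ae (Eventually.of_forall fun p => ?_)
    simp only [Prod.fst_swap, Prod.snd_swap, Complex.conj_conj]
    ring
  rw [hswap]
  have hgc : Integrable (fun s => conj (g s)) :=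
    (Complex.conjLIE.toContinuousLinearEquiv.integrable_comp_iff).2 hgi
  let ε : ℕ → ℝ := fun n => 1 / ((n : ℝ) + 1)
  have hε : Tendsto ε atTop (𝓝 0) := tendsto_one_div_add_atTop_nhds_zero_nat
  have hε0 : ∀ n, 0 < ε n := fun n => Nat.one_div_pos_of_nat
  have hlim : Tendsto (fun n => ∫ p : ℝ × ℝ, conj (conj (g p.1)) * conj (g p.2) *
      kernel (ε n) (p.1 - p.2) 0) atTop
      (𝓝 (∫ p : ℝ × ℝ, conj (conj (g p.1)) * conj (g p.2) * kernel 0 (p.1 - p.2) 0)) := by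
    have hgm := hgc.1
    refine tendsto_integral_of_dominated_convergence
      (fun p : ℝ × ℝ => ‖g p.1‖ * ‖g p.2‖ * |p.1 - p.2| ^ (-(1 / 2) : ℝ)) (fun n => ?_) ?_ ?_ ?_
    · rw [Measure.volume_eq_prod]
      refine AEStronglyMeasurable.mul ?_ ?_
      · exact (Complex.continuous_conj.comp_aestronglyMeasurable hgm.comp_fst).mul hgm.comp_snd
      · exact ((measurable_kernel _).comp (by fun_prop : Measurable
          fun p : ℝ × ℝ => (p.1 - p.2, (0 : ℝ)))).aestronglyMeasurable
    · refine ⟨?_, ?_⟩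
      · rw [Measure.volume_eq_prod]
        exact ((hg.1.comp_fst.norm.mul hg.1.comp_snd.norm)).mul
          (by fun_prop : Measurable fun p : ℝ × ℝ => |p.1 - p.2| ^ (-(1 / 2) : ℝ)).aestronglyMeasurable
      · refine lt_of_le_of_lt (lintegral_mono fun p => ?_)
          (lt_of_le_of_lt (lintegral_prod_enorm_mul_rieszKernel_le hg.1)
            (ENNReal.mul_lt_top (by simp) (ENNReal.pow_lt_top hg.2)))
        rw [enorm_mul, enorm_mul, enorm_norm, enorm_norm, rieszKernel,
          Real.enorm_of_nonneg (by positivity)]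
    · intro n
      filter_upwards [ae_fst_ne_snd] with p hp
      rw [norm_mul, norm_mul, RCLike.norm_conj, RCLike.norm_conj, RCLike.norm_conj]
      gcongr
      exact norm_kernel_le (hε0 n).le hp _
    · filter_upwards [ae_fst_ne_snd] with p hp
      exact tendsto_const_nhds.mul ((tendsto_kernel hp 0).comp hε)
  refine ge_of_tendsto ((Complex.continuous_re.tendsto _).comp hlim)
    (Eventually.of_forall fun n => ?_)
  have h2 := integral_gaussian_mul_sq_adjointWave (hε0 n) (x := fun _ => 0) measurable_const hgc
  simp only [sub_zero] at h2
  simp only [Function.comp_apply]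
  rw [← h2]
  have h3 : ∫ ξ : ℝ, (Real.exp (-ε n * ξ ^ 2) : ℂ) * (conj (adjointWave (fun _ => 0)
      (fun s => conj (g s)) ξ) * adjointWave (fun _ => 0) (fun s => conj (g s)) ξ)
      = ((∫ ξ, Real.exp (-ε n * ξ ^ 2) * ‖adjointWave (fun _ => 0)
        (fun s => conj (g s)) ξ‖ ^ 2 : ℝ) : ℂ) := by
    rw [← integral_complex_ofReal]
    refine integral_congr_ae (Eventually.of_forall fun ξ => ?_)
    simp only [RCLike.conj_mul]
    push_cast
    rfl
  rw [h3, Complex.ofReal_re]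
  exact integral_nonneg fun ξ => by positivity

/-! ### Dominated convergence in `Lᵖ` -/

theorem continuous_toLp_of_dominated {p : ℝ≥0∞} [Fact (1 ≤ p)] (hp : p ≠ ∞) {F : ℝ → ℝ → ℂ}
    (hFm : ∀ t, Measurable (F t)) (hF : ∀ t, MemLp (F t) p volume) {B : ℝ → ℝ} (hB : MemLp B p volume)
    (hle : ∀ t ξ, ‖F t ξ‖ ≤ B ξ) (hc : ∀ ξ, Continuous fun t => F t ξ) :
    Continuous fun t => (hF t).toLp (F t) := by
  have hp0 : p ≠ 0 := (lt_of_lt_of_le one_pos (Fact.out : 1 ≤ p)).ne'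
  have hpos : 0 < p.toReal := ENNReal.toReal_pos hp0 hp
  refine continuous_iff_continuousAt.2 fun t₀ => ?_
  rw [ContinuousAt, Lp.tendsto_Lp_iff_tendsto_eLpNorm'']
  have h : Tendsto (fun t => ∫⁻ ξ, ‖F t ξ - F t₀ ξ‖ₑ ^ p.toReal) (𝓝 t₀) (𝓝 0) := by
    have h0 : ∫⁻ ξ, ‖F t₀ ξ - F t₀ ξ‖ₑ ^ p.toReal = 0 := by simp [hpos]
    rw [← h0]
    refine tendsto_lintegral_filter_of_dominated_convergence
      (fun ξ => ‖(2 : ℝ) * B ξ‖ₑ ^ p.toReal) (Eventually.of_forall fun t => ?_)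
      (Eventually.of_forall fun t => Eventually.of_forall fun ξ => ?_) ?_
      (Eventually.of_forall fun ξ => ?_)
    · exact ((hFm t).sub (hFm t₀)).enorm.pow_const _
    · refine ENNReal.rpow_le_rpow ?_ hpos.le
      rw [← ofReal_norm, ← ofReal_norm]
      refine ENNReal.ofReal_le_ofReal ?_
      refine (norm_sub_le _ _).trans (le_trans ?_ (Real.le_norm_self _))
      linarith [hle t ξ, hle t₀ ξ]
    · exact (lintegral_rpow_enorm_lt_top_of_eLpNorm_lt_top hp0 hp (hB.const_mul 2).2).ne
    · refine Tendsto.ennrpow_const _ ?_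
      refine Tendsto.enorm ?_
      exact ((hc ξ).tendsto t₀).sub_const _
  have h2 := h.ennrpow_const (1 / p.toReal)
  rw [ENNReal.zero_rpow_of_pos (by positivity)] at h2
  refine h2.congr fun t => ?_
  rw [eLpNorm_eq_lintegral_rpow_enorm_toReal hp0 hp]
  rfl

/-! ### The free propagator -/

theorem fourier_free (t : ℝ) (f : L2) :
    𝓕 (free t f) = ((memLp_symbol t).toLp (symbol t) • 𝓕 f : L2) :=
  FourierTransform.fourier_fourierInv_eq _

theorem fourier_free_ae (t : ℝ) (f : L2) :
    (𝓕 (free t f) : L2) =ᵐ[volume] fun ξ => symbol t ξ * (𝓕 f : L2) ξ := by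
  rw [fourier_free]
  filter_upwards [Lp.coeFn_lpSMul (r := 2) ((memLp_symbol t).toLp (symbol t)) (𝓕 f : L2),
    (memLp_symbol t).coeFn_toLp] with ξ h1 h2
  rw [h1, Pi.smul_apply', h2, smul_eq_mul]

theorem fourier_injective {f g : L2} (h : (𝓕 f : L2) = 𝓕 g) : f = g := by
  rw [← FourierTransform.fourierInv_fourier_eq (F := L2) f, h,
    FourierTransform.fourierInv_fourier_eq (F := L2) g]

theorem symbol_add (s t ξ : ℝ) : symbol (s + t) ξ = symbol s ξ * symbol t ξ := by
  unfold symbol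
  rw [← Complex.exp_add]
  congr 1
  push_cast
  ring

theorem symbol_zero (ξ : ℝ) : symbol 0 ξ = 1 := by simp [symbol]

theorem free_add (t : ℝ) (f g : L2) : free t (f + g) = free t f + free t g := by
  unfold free
  rw [FourierTransform.fourier_add, Lp.add_smul, FourierTransform.fourierInv_add]

theorem free_smul (t : ℝ) (c : ℂ) (f : L2) : free t (c • f) = c • free t f := by
  refine fourier_injective (Lp.ext ?_)
  rw [FourierTransform.fourier_smul]
  filter_upwards [fourier_free_ae t (c • f), Lp.coeFn_smul c (𝓕 (free t f) : L2),
    fourier_free_ae t f, Lp.coeFn_smul c (𝓕 f : L2)] with ξ h1 h2 h3 h4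
  rw [h1, h2, Pi.smul_apply, h3, FourierTransform.fourier_smul, h4, Pi.smul_apply]
  simp only [smul_eq_mul]
  ring

/-- The free propagator as a linear map. -/
def freeₗ (t : ℝ) : L2 →ₗ[ℂ] L2 where
  toFun := free t
  map_add' := free_add t
  map_smul' := free_smul t

theorem free_sub (t : ℝ) (f g : L2) : free t (f - g) = free t f - free t g :=
  (freeₗ t).map_sub f g

theorem free_free (s t : ℝ) (f : L2) : free s (free t f) = free (s + t) f := by
  refine fourier_injective (Lp.ext ?_)
  filter_upwards [fourier_free_ae s (free t f), fourier_free_ae t f,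
    fourier_free_ae (s + t) f] with ξ h1 h2 h3
  rw [h1, h2, h3, symbol_add]
  ring

theorem free_zero (f : L2) : free 0 f = f := by
  refine fourier_injective (Lp.ext ?_)
  filter_upwards [fourier_free_ae 0 f] with ξ h1
  rw [h1, symbol_zero, one_mul]

theorem norm_free (t : ℝ) (f : L2) : ‖free t f‖ = ‖f‖ := by
  rw [← Lp.norm_fourier_eq, ← Lp.norm_fourier_eq f, Lp.norm_def, Lp.norm_def]
  congr 1
  refine eLpNorm_congr_norm_ae ?_
  filter_upwards [fourier_free_ae t f] with ξ h
  rw [h, norm_mul, norm_symbol, one_mul]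

theorem continuous_symbol_left (ξ : ℝ) : Continuous fun t => symbol t ξ := by
  unfold symbol
  fun_prop

theorem memLp_symbol_mul {p : ℝ≥0∞} (t : ℝ) {F : ℝ → ℂ} (hF : MemLp F p volume) :
    MemLp (fun ξ => symbol t ξ * F ξ) p volume := by
  refine hF.of_le ((continuous_symbol t).aestronglyMeasurable.mul hF.1)
    (Eventually.of_forall fun ξ => ?_)
  rw [norm_mul, norm_symbol, one_mul]

theorem free_eq_fourierInv (t : ℝ) (f : L2) :
    free t f = 𝓕⁻ ((memLp_symbol_mul t (Lp.memLp (𝓕 f : L2))).toLp _ : L2) := by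
  refine fourier_injective (Lp.ext ?_)
  rw [FourierTransform.fourier_fourierInv_eq (E := L2)]
  filter_upwards [fourier_free_ae t f,
    (memLp_symbol_mul t (Lp.memLp (𝓕 f : L2))).coeFn_toLp] with ξ h1 h2
  rw [h1, h2]

theorem continuous_free_left (f : L2) : Continuous fun t => free t f := by
  simp_rw [free_eq_fourierInv]
  refine (Lp.fourierTransformₗᵢ ℝ ℂ).symm.continuous.comp ?_
  refine continuous_toLp_of_dominated (by simp) (fun t => (continuous_symbol t).measurable.mul
    (Lp.stronglyMeasurable (𝓕 f : L2)).measurable) _ (Lp.memLp (𝓕 f : L2)).norm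
    (fun t ξ => ?_) (fun ξ => ?_)
  · rw [Pi.mul_apply, norm_mul, norm_symbol, one_mul]
  · exact (continuous_symbol_left ξ).mul continuous_const

/-- Strong continuity in `t` becomes joint continuity because each propagator is a linear isometry.
-/
theorem continuous_free : Continuous fun p : ℝ × L2 => free p.1 p.2 := by
  refine continuous_iff_continuousAt.2 fun p₀ => ?_
  rw [ContinuousAt, tendsto_iff_norm_sub_tendsto_zero]
  have h1 : Tendsto (fun p : ℝ × L2 => ‖p.2 - p₀.2‖ + ‖free p.1 p₀.2 - free p₀.1 p₀.2‖)
      (𝓝 p₀) (𝓝 0) := by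
    have hc : Continuous fun p : ℝ × L2 => ‖p.2 - p₀.2‖ + ‖free p.1 p₀.2 - free p₀.1 p₀.2‖ := by
      have := (continuous_free_left p₀.2).comp (continuous_fst (X := ℝ) (Y := L2))
      simp only [Function.comp_def] at this
      fun_prop
    simpa using hc.tendsto p₀
  refine squeeze_zero (fun _ => norm_nonneg _) (fun p => ?_) h1
  calc ‖free p.1 p.2 - free p₀.1 p₀.2‖
      = ‖free p.1 (p.2 - p₀.2) + (free p.1 p₀.2 - free p₀.1 p₀.2)‖ := by
        rw [free_sub]; congr 1; abel
    _ ≤ _ := (norm_add_le _ _).trans (by rw [norm_free])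

/-! ### Forcing by a point source -/

/-- The source `g` restricted to the oriented interval from `a` to `t`. -/
def cut (a t : ℝ) (g : ℝ → ℂ) : ℝ → ℂ :=
  (Set.uIoc a t).indicator fun s => (if a ≤ t then (1 : ℂ) else -1) * g s

theorem intervalIntegral_mul_eq_integral_cut (a t : ℝ) (F g : ℝ → ℂ) :
    ∫ s in a..t, F s * g s = ∫ s, F s * cut a t g s := by
  rw [intervalIntegral.intervalIntegral_eq_integral_uIoc, ← integral_indicator measurableSet_uIoc,
    ← integral_smul]
  refine integral_congr_ae (Eventually.of_forall fun s => ?_)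
  simp only [cut, Set.indicator]
  split_ifs <;> simp

theorem enorm_cut (a t : ℝ) (g : ℝ → ℂ) (s : ℝ) :
    ‖cut a t g s‖ₑ = ‖(Set.uIoc a t).indicator g s‖ₑ := by
  simp only [cut, Set.indicator]
  split_ifs <;> simp

theorem enorm_cut_le (a t : ℝ) (g : ℝ → ℂ) (s : ℝ) : ‖cut a t g s‖ₑ ≤ ‖g s‖ₑ := by
  rw [enorm_cut]
  exact enorm_indicator_le_enorm_self _ _

theorem eLpNorm_cut (a t : ℝ) (g : ℝ → ℂ) (p : ℝ≥0∞) :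
    eLpNorm (cut a t g) p volume = eLpNorm g p (volume.restrict (Set.uIoc a t)) := by
  rw [← eLpNorm_indicator_eq_eLpNorm_restrict measurableSet_uIoc]
  exact eLpNorm_congr_enorm_ae (Eventually.of_forall fun s => enorm_cut a t g s)

theorem memLp_cut (a t : ℝ) {g : ℝ → ℂ} {p : ℝ≥0∞} (hg : MemLp g p volume) :
    MemLp (cut a t g) p volume := by
  refine ⟨?_, (eLpNorm_mono_enorm fun s => enorm_cut_le a t g s).trans_lt hg.2⟩
  exact (aestronglyMeasurable_const.mul hg.1).indicator measurableSet_uIoc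

theorem one_le_four_thirds : (1 : ℝ≥0∞) ≤ 4 / 3 := by
  rw [ENNReal.le_div_iff_mul_le (by simp) (by simp)]
  norm_num

instance fact_one_le_four_thirds : Fact ((1 : ℝ≥0∞) ≤ 4 / 3) := ⟨one_le_four_thirds⟩

theorem integrable_cut (a t : ℝ) {g : ℝ → ℂ} (hg : MemLp g (4 / 3) volume) :
    Integrable (cut a t g) := by
  have h : IntegrableOn g (Set.uIoc a t) :=
    (hg.locallyIntegrable one_le_four_thirds).integrableOn_isCompact isCompact_uIcc |>.mono_set
      Set.uIoc_subset_uIcc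
  exact (integrable_indicator_iff measurableSet_uIoc).2 (h.const_mul _)

theorem intervalIntegrable_of_memLp (a t : ℝ) {g : ℝ → ℂ} (hg : MemLp g (4 / 3) volume) :
    IntervalIntegrable g volume a t := by
  rw [intervalIntegrable_iff]
  exact (hg.locallyIntegrable one_le_four_thirds).integrableOn_isCompact isCompact_uIcc |>.mono_set
      Set.uIoc_subset_uIcc

/-- The Fourier transform of `∫_a^t e^{-is∂ₓ²} δ g(s) ds`. -/
def forcedHat (a t : ℝ) (g : ℝ → ℂ) (ξ : ℝ) : ℂ := ∫ s in a..t, symbol (-s) ξ * g s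

theorem forcedHat_eq_adjointWave (a t : ℝ) (g : ℝ → ℂ) :
    forcedHat a t g = adjointWave (fun _ => 0) (cut a t g) := by
  ext ξ
  rw [forcedHat, intervalIntegral_mul_eq_integral_cut, adjointWave]
  simp [wave]

theorem continuous_forcedHat (a t : ℝ) {g : ℝ → ℂ} (hg : MemLp g (4 / 3) volume) :
    Continuous (forcedHat a t g) := by
  rw [forcedHat_eq_adjointWave]
  exact continuous_adjointWave measurable_const (integrable_cut a t hg)

/-- The dual Strichartz estimate with the position frozen at `0`; the factor `5` bounds `√20`.
Keeping the norm over the interval between `a` and `t` yields both continuity in time and the Cauchy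
property at infinity. -/
theorem eLpNorm_forcedHat_le (a t : ℝ) {g : ℝ → ℂ} (hg : MemLp g (4 / 3) volume) :
    eLpNorm (forcedHat a t g) 2 volume ≤ 5 * eLpNorm g (4 / 3) (volume.restrict (Set.uIoc a t)) := by
  have h := eLpNorm_adjointWave_le (x := fun _ => 0) measurable_const (integrable_cut a t hg)
  rw [← forcedHat_eq_adjointWave, eLpNorm_cut] at h
  rw [← ENNReal.pow_le_pow_left_iff two_ne_zero, mul_pow]
  refine h.trans ?_
  gcongr
  norm_num

theorem memLp_forcedHat (a t : ℝ) {g : ℝ → ℂ} (hg : MemLp g (4 / 3) volume) :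
    MemLp (forcedHat a t g) 2 volume := by
  refine ⟨(continuous_forcedHat a t hg).aestronglyMeasurable,
    (eLpNorm_forcedHat_le a t hg).trans_lt (ENNReal.mul_lt_top (by simp) ?_)⟩
  exact (eLpNorm_mono_measure _ Measure.restrict_le_self).trans_lt hg.2

open Classical in
/-- The element of `L²(ℝ)` with a given Fourier transform; it is `0` if there is none. -/
def ofFourier (F : ℝ → ℂ) : L2 :=
  if h : MemLp F 2 volume then 𝓕⁻ (h.toLp _ : L2) else 0

theorem ofFourier_eq {F : ℝ → ℂ} (h : MemLp F 2 volume) : ofFourier F = 𝓕⁻ (h.toLp _ : L2) :=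
  dif_pos h

/-- The function `∫_a^t e^{-is∂ₓ²} δ g(s) ds`, for `g ∈ L^{4/3}`. -/
def forced (a t : ℝ) (g : ℝ → ℂ) : L2 := ofFourier (forcedHat a t g)

theorem fourier_forced_ae (a t : ℝ) {g : ℝ → ℂ} (hg : MemLp g (4 / 3) volume) :
    (𝓕 (forced a t g) : L2) =ᵐ[volume] forcedHat a t g := by
  rw [forced, ofFourier_eq (memLp_forcedHat a t hg), FourierTransform.fourier_fourierInv_eq (E := L2)]
  exact MemLp.coeFn_toLp _

theorem enorm_forced_le (a t : ℝ) {g : ℝ → ℂ} (hg : MemLp g (4 / 3) volume) :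
    ‖forced a t g‖ₑ ≤ 5 * eLpNorm g (4 / 3) (volume.restrict (Set.uIoc a t)) := by
  refine le_trans (le_of_eq ?_) (eLpNorm_forcedHat_le a t hg)
  rw [← eLpNorm_congr_ae (fourier_forced_ae a t hg), ← ofReal_norm, ← Lp.norm_fourier_eq,
    Lp.norm_def, ENNReal.ofReal_toReal (Lp.eLpNorm_ne_top _)]

theorem forced_sub (a t : ℝ) {g₁ g₂ : ℝ → ℂ} (h₁ : MemLp g₁ (4 / 3) volume)
    (h₂ : MemLp g₂ (4 / 3) volume) : forced a t (g₁ - g₂) = forced a t g₁ - forced a t g₂ := by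
  refine fourier_injective (Lp.ext ?_)
  have e : (𝓕 (forced a t g₁ - forced a t g₂) : L2)
      = (𝓕 (forced a t g₁) : L2) - (𝓕 (forced a t g₂) : L2) :=
    (Lp.fourierTransformₗᵢ ℝ ℂ).map_sub _ _
  rw [e]
  filter_upwards [fourier_forced_ae a t (h₁.sub h₂), fourier_forced_ae a t h₁,
    fourier_forced_ae a t h₂, Lp.coeFn_sub (𝓕 (forced a t g₁) : L2) (𝓕 (forced a t g₂) : L2)]
    with ξ e1 e2 e3 e4
  rw [e1, e4, Pi.sub_apply, e2, e3]
  simp only [forcedHat, Pi.sub_apply, mul_sub]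
  have hi : ∀ {g : ℝ → ℂ}, MemLp g (4 / 3) volume →
      IntervalIntegrable (fun s => symbol (-s) ξ * g s) volume a t := fun hg =>
    (intervalIntegrable_of_memLp a t hg).continuousOn_mul
      ((continuous_symbol_left ξ).comp continuous_neg).continuousOn
  exact intervalIntegral.integral_sub (hi h₁) (hi h₂)

theorem forced_add_adjacent (a b c : ℝ) {g : ℝ → ℂ} (hg : MemLp g (4 / 3) volume) :
    forced a b g + forced b c g = forced a c g := by
  refine fourier_injective (Lp.ext ?_)
  rw [FourierTransform.fourier_add]
  filter_upwards [fourier_forced_ae a b hg, fourier_forced_ae b c hg,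
    fourier_forced_ae a c hg, Lp.coeFn_add (𝓕 (forced a b g) : L2) (𝓕 (forced b c g) : L2)]
    with ξ e1 e2 e3 e4
  rw [e4, Pi.add_apply, e1, e2, e3]
  have hi : ∀ a t, IntervalIntegrable (fun s => symbol (-s) ξ * g s) volume a t := fun a t =>
    (intervalIntegrable_of_memLp a t hg).continuousOn_mul
      ((continuous_symbol_left ξ).comp continuous_neg).continuousOn
  exact intervalIntegral.integral_add_adjacent_intervals (hi a b) (hi b c)

theorem forced_self (a : ℝ) {g : ℝ → ℂ} (hg : MemLp g (4 / 3) volume) : forced a a g = 0 := by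
  have := forced_add_adjacent a a a hg
  simpa using this

theorem forced_congr {a t : ℝ} {g₁ g₂ : ℝ → ℂ}
    (h : ∀ᵐ s, s ∈ Set.uIoc a t → g₁ s = g₂ s) : forced a t g₁ = forced a t g₂ := by
  have : forcedHat a t g₁ = forcedHat a t g₂ := by
    ext ξ
    refine intervalIntegral.integral_congr_ae (h.mono fun s hs hst => ?_)
    rw [hs hst]
  rw [forced, this, forced]

/-- The increment is the forced part between `t₀` and `t`, so absolute continuity of the integral of
`|g|^{4/3}` suffices. -/
theorem continuous_forced (a : ℝ) {g : ℝ → ℂ} (hg : MemLp g (4 / 3) volume) :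
    Continuous fun t => forced a t g := by
  refine continuous_iff_continuousAt.2 fun t₀ => ?_
  rw [ContinuousAt, tendsto_iff_edist_tendsto_0]
  have hle : ∀ t, edist (forced a t g) (forced a t₀ g)
      ≤ 5 * eLpNorm g (4 / 3) (volume.restrict (Set.uIoc t₀ t)) := by
    intro t
    rw [edist_eq_enorm_sub, ← forced_add_adjacent a t₀ t hg, add_sub_cancel_left]
    exact enorm_forced_le t₀ t hg
  have h43 : ((4 / 3 : ℝ≥0∞)).toReal = 4 / 3 := by simp [ENNReal.toReal_div]
  have hfin : ∫⁻ s, ‖g s‖ₑ ^ (4 / 3 : ℝ) ≠ ∞ := by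
    have := lintegral_rpow_enorm_lt_top_of_eLpNorm_lt_top (by simp)
      (ENNReal.div_ne_top (by simp) (by simp)) hg.2
    rw [h43] at this
    exact this.ne
  have hlim : Tendsto (fun t => ∫⁻ s in Set.uIoc t₀ t, ‖g s‖ₑ ^ (4 / 3 : ℝ)) (𝓝 t₀) (𝓝 0) := by
    refine tendsto_setLIntegral_zero hfin ?_
    have : Tendsto (fun t => ENNReal.ofReal |t - t₀|) (𝓝 t₀) (𝓝 0) := by
      have hc : Continuous fun t => ENNReal.ofReal |t - t₀| :=
        ENNReal.continuous_ofReal.comp (by fun_prop)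
      simpa using hc.tendsto t₀
    refine this.congr fun t => ?_
    simp [Set.uIoc, Real.volume_Ioc, max_sub_min_eq_abs]
  have h2 := ENNReal.Tendsto.const_mul (a := 5) (hlim.ennrpow_const (3 / 4 : ℝ))
    (Or.inr (by simp))
  rw [ENNReal.zero_rpow_of_pos (by norm_num), mul_zero] at h2
  refine tendsto_of_tendsto_of_tendsto_of_le_of_le tendsto_const_nhds h2 (fun _ => zero_le)
    fun t => (hle t).trans (le_of_eq ?_)
  rw [eLpNorm_eq_lintegral_rpow_enorm_toReal (by simp) (ENNReal.div_ne_top (by simp) (by simp)), h43]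
  norm_num

/-! ### Pairing with test functions -/

theorem ae_eq_of_pairing {f h : ℝ → ℂ} (hf : LocallyIntegrable f) (hh : LocallyIntegrable h)
    (H : ∀ φ : 𝓢(ℝ, ℂ), ∫ x, φ x * f x = ∫ x, φ x * h x) : f =ᵐ[volume] h := by
  refine ae_eq_of_integral_contDiff_smul_eq hf hh fun g g_smooth g_cpt => ?_
  have hg₁ : HasCompactSupport (Complex.ofRealCLM ∘ g) := g_cpt.comp_left rfl
  have hg₂ : ContDiff ℝ (⊤ : ℕ∞) (Complex.ofRealCLM ∘ g) := by fun_prop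
  have := H (hg₁.toSchwartzMap hg₂)
  simpa using this

theorem L2_ext_of_pairing {f h : L2}
    (H : ∀ φ : 𝓢(ℝ, ℂ), Lp.toTemperedDistribution f φ = Lp.toTemperedDistribution h φ) : f = h := by
  refine Lp.ext (ae_eq_of_pairing ((Lp.memLp f).locallyIntegrable (by simp))
    ((Lp.memLp h).locallyIntegrable (by simp)) fun φ => ?_)
  simpa using H φ

theorem pairing_eq_integral_fourier (f : L2) (φ : 𝓢(ℝ, ℂ)) :
    Lp.toTemperedDistribution f φ = ∫ ξ, (𝓕⁻ φ : 𝓢(ℝ, ℂ)) ξ * (𝓕 f : L2) ξ := by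
  have h : f = 𝓕⁻ (𝓕 f : L2) := (FourierTransform.fourierInv_fourier_eq (F := L2) f).symm
  conv_lhs => rw [h]
  rw [← Lp.fourierInv_toTemperedDistribution_eq, TemperedDistribution.fourierInv_apply,
    Lp.toTemperedDistribution_apply]
  simp only [smul_eq_mul]

theorem freeDist_smul_delta (t : ℝ) (c : ℂ) (φ : 𝓢(ℝ, ℂ)) :
    freeDist t (c • TemperedDistribution.delta (0 : ℝ)) φ
      = c * ∫ ξ, symbol t ξ * (𝓕⁻ φ : 𝓢(ℝ, ℂ)) ξ := by
  unfold freeDist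
  rw [TemperedDistribution.fourierMultiplierCLM_apply_apply]
  have : (c • TemperedDistribution.delta (0 : ℝ) : 𝓢'(ℝ, ℂ))
      (𝓕 (SchwartzMap.smulLeftCLM ℂ (symbol t) (𝓕⁻ φ)))
      = c * (𝓕 (SchwartzMap.smulLeftCLM ℂ (symbol t) (𝓕⁻ φ)) : 𝓢(ℝ, ℂ)) 0 := rfl
  rw [this, SchwartzMap.fourier_coe, Real.fourier_eq]
  congr 1
  refine integral_congr_ae (Eventually.of_forall fun ξ => ?_)
  simp [SchwartzMap.smulLeftCLM_apply_apply (hasTemperateGrowth_symbol t)]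

/-- Identifies the `L²` object with the weak Duhamel integral: on the Fourier side both are the same
double integral, and Fubini applies since `g` is integrable between `a` and `t` and the inverse
transform of the test function is integrable. -/
theorem pairing_free_forced (a t : ℝ) {g : ℝ → ℂ} (hg : MemLp g (4 / 3) volume) (φ : 𝓢(ℝ, ℂ)) :
    Lp.toTemperedDistribution (free t (forced a t g)) φ
      = ∫ s in a..t, (∫ ξ, symbol (t - s) ξ * (𝓕⁻ φ : 𝓢(ℝ, ℂ)) ξ) * g s := by
  have hgi := integrable_cut a t hg
  have hφ : Integrable (𝓕⁻ φ : 𝓢(ℝ, ℂ)) := (𝓕⁻ φ : 𝓢(ℝ, ℂ)).integrable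
  rw [pairing_eq_integral_fourier, intervalIntegral_mul_eq_integral_cut]
  have e1 : ∫ ξ, (𝓕⁻ φ : 𝓢(ℝ, ℂ)) ξ * (𝓕 (free t (forced a t g)) : L2) ξ
      = ∫ ξ, ∫ s, (symbol (t - s) ξ * (𝓕⁻ φ : 𝓢(ℝ, ℂ)) ξ) * cut a t g s := by
    refine integral_congr_ae ?_
    filter_upwards [fourier_free_ae t (forced a t g), fourier_forced_ae a t hg] with ξ h1 h2
    rw [h1, h2, forcedHat, intervalIntegral_mul_eq_integral_cut, ← integral_const_mul,
      ← integral_const_mul]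
    refine integral_congr_ae (Eventually.of_forall fun s => ?_)
    simp only [sub_eq_add_neg, symbol_add]
    ring
  have hint : Integrable (Function.uncurry fun (ξ s : ℝ) =>
      (symbol (t - s) ξ * (𝓕⁻ φ : 𝓢(ℝ, ℂ)) ξ) * cut a t g s) (volume.prod volume) := by
    have h1 := hφ.mul_prod hgi
    have hm : Measurable fun z : ℝ × ℝ => symbol (t - z.2) z.1 := by
      unfold symbol
      fun_prop
    refine (h1.bdd_mul (c := 1) hm.aestronglyMeasurable
      (Eventually.of_forall fun z => (norm_symbol _ _).le)).congr
      (Eventually.of_forall fun z => ?_)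
    simp only [Function.uncurry]
    ring
  rw [e1, integral_integral_swap hint]
  refine integral_congr_ae (Eventually.of_forall fun s => ?_)
  simp only
  rw [integral_mul_const]

theorem conj_wave_mul_wave_zero (x τ ξ : ℝ) :
    conj (wave x τ ξ) * wave 0 0 ξ = Complex.exp (Complex.I * ((2 * Real.pi * x * ξ : ℝ) : ℂ)) *
      symbol τ ξ := by
  simp only [wave, symbol, map_mul, ← Complex.exp_conj]
  simp only [map_neg, map_mul, Complex.conj_I, Complex.conj_ofReal]
  simp only [← Complex.exp_add]
  congr 1
  push_cast
  ring

theorem fourierInv_apply_eq_integral (f : ℝ → ℂ) (x : ℝ) :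
    𝓕⁻ f x = ∫ ξ, Complex.exp (Complex.I * ((2 * Real.pi * x * ξ : ℝ) : ℂ)) * f ξ := by
  rw [Real.fourierInv_eq']
  refine integral_congr_ae (Eventually.of_forall fun ξ => ?_)
  simp only [smul_eq_mul, RCLike.inner_apply, conj_trivial]
  congr 2
  push_cast
  ring

/-- The kernel of `e^{iτ∂ₓ²}`, tested against a Schwartz function. -/
theorem integral_symbol_mul_fourierInv {τ : ℝ} (hτ : τ ≠ 0) (φ : 𝓢(ℝ, ℂ)) :
    ∫ ξ, symbol τ ξ * (𝓕⁻ φ : 𝓢(ℝ, ℂ)) ξ = ∫ x, kernel 0 τ x * φ x := by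
  have hφ : Integrable φ := φ.integrable
  have hφ' : Integrable (𝓕⁻ φ : 𝓢(ℝ, ℂ)) := (𝓕⁻ φ : 𝓢(ℝ, ℂ)).integrable
  -- The Gaussian factor makes Fubini legitimate; both sides then converge by dominated convergence,
  -- since `τ ≠ 0` keeps the kernels bounded uniformly in `ε`.
  have key : ∀ ε : ℝ, 0 < ε → ∫ ξ, (Real.exp (-ε * ξ ^ 2) : ℂ) *
      (symbol τ ξ * (𝓕⁻ φ : 𝓢(ℝ, ℂ)) ξ) = ∫ x, kernel ε τ x * φ x := by
    intro ε hε
    have e1 : ∀ ξ : ℝ, (Real.exp (-ε * ξ ^ 2) : ℂ) * (symbol τ ξ * (𝓕⁻ φ : 𝓢(ℝ, ℂ)) ξ)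
        = ∫ x, ((Real.exp (-ε * ξ ^ 2) : ℂ) * (conj (wave x τ ξ) * wave 0 0 ξ)) * φ x := by
      intro ξ
      rw [SchwartzMap.fourierInv_coe, fourierInv_apply_eq_integral, ← integral_const_mul,
        ← integral_const_mul]
      refine integral_congr_ae (Eventually.of_forall fun x => ?_)
      simp only [conj_wave_mul_wave_zero]
      rw [mul_right_comm (2 * Real.pi) x ξ]
      ring
    simp_rw [e1]
    have hint : Integrable (Function.uncurry fun (ξ x : ℝ) =>
        ((Real.exp (-ε * ξ ^ 2) : ℂ) * (conj (wave x τ ξ) * wave 0 0 ξ)) * φ x)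
        (volume.prod volume) := by
      have h0 : Integrable (fun ξ : ℝ => (Real.exp (-ε * ξ ^ 2) : ℂ)) :=
        (integrable_exp_neg_mul_sq hε).ofReal
      have h1 := h0.mul_prod hφ
      have hm : Measurable fun z : ℝ × ℝ => conj (wave z.2 τ z.1) * wave 0 0 z.1 := by
        simp only [conj_wave_mul_wave_zero]
        unfold symbol
        fun_prop
      refine (h1.bdd_mul (c := 1) hm.aestronglyMeasurable
        (Eventually.of_forall fun z => ?_)).congr (Eventually.of_forall fun z => ?_)
      · rw [norm_mul, RCLike.norm_conj, norm_wave, norm_wave, one_mul]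
      · simp only [Function.uncurry]
        ring
    rw [integral_integral_swap hint]
    refine integral_congr_ae (Eventually.of_forall fun x => ?_)
    simp only
    rw [integral_mul_const, integral_gaussian_mul_conj_wave_mul_wave hε, sub_zero, sub_zero]
  let ε : ℕ → ℝ := fun n => 1 / ((n : ℝ) + 1)
  have hε : Tendsto ε atTop (𝓝 0) := tendsto_one_div_add_atTop_nhds_zero_nat
  have hε0 : ∀ n, 0 < ε n := fun n => Nat.one_div_pos_of_nat
  have lim1 : Tendsto (fun n => ∫ ξ, (Real.exp (-ε n * ξ ^ 2) : ℂ) *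
      (symbol τ ξ * (𝓕⁻ φ : 𝓢(ℝ, ℂ)) ξ)) atTop (𝓝 (∫ ξ, symbol τ ξ * (𝓕⁻ φ : 𝓢(ℝ, ℂ)) ξ)) := by
    refine tendsto_integral_of_dominated_convergence (fun ξ => ‖(𝓕⁻ φ : 𝓢(ℝ, ℂ)) ξ‖)
      (fun n => ?_) hφ'.norm (fun n => Eventually.of_forall fun ξ => ?_)
      (Eventually.of_forall fun ξ => ?_)
    · have := continuous_symbol τ
      have := (𝓕⁻ φ : 𝓢(ℝ, ℂ)).continuous
      exact Continuous.aestronglyMeasurable (by fun_prop)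
    · rw [norm_mul, norm_mul, norm_symbol, one_mul, Complex.norm_real,
        Real.norm_of_nonneg (Real.exp_pos _).le]
      refine mul_le_of_le_one_left (norm_nonneg _) ?_
      rw [Real.exp_le_one_iff]
      nlinarith [hε0 n, sq_nonneg ξ]
    · have hc : Continuous fun e : ℝ => (Real.exp (-e * ξ ^ 2) : ℂ) *
          (symbol τ ξ * (𝓕⁻ φ : 𝓢(ℝ, ℂ)) ξ) := by fun_prop
      have h0 := (hc.tendsto 0).comp hε
      rw [neg_zero, zero_mul, Real.exp_zero, Complex.ofReal_one, one_mul] at h0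
      exact h0
  have lim2 : Tendsto (fun n => ∫ x, kernel (ε n) τ x * φ x) atTop
      (𝓝 (∫ x, kernel 0 τ x * φ x)) := by
    refine tendsto_integral_of_dominated_convergence (fun x => |τ| ^ (-(1 / 2) : ℝ) * ‖φ x‖)
      (fun n => ((continuous_kernel _ _).mul φ.continuous).aestronglyMeasurable)
      (hφ.norm.const_mul _) (fun n => Eventually.of_forall fun x => ?_)
      (Eventually.of_forall fun x => ?_)
    · rw [norm_mul]
      gcongr
      exact norm_kernel_le (hε0 n).le hτ x
    · exact ((tendsto_kernel hτ x).comp hε).mul_const _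
  refine tendsto_nhds_unique lim1 (lim2.congr fun n => ?_)
  rw [key (ε n) (hε0 n)]

/-! ### The continuous representative of the forced part -/

/-- The value at `x` of `∫_a^t e^{i(t-s)∂ₓ²} δ g(s) ds`. -/
def forcedVal (a t : ℝ) (g : ℝ → ℂ) (x : ℝ) : ℂ := ∫ s in a..t, kernel 0 (t - s) x * g s

theorem aestronglyMeasurable_kernel_mul (t x : ℝ) {g : ℝ → ℂ} (hg : AEStronglyMeasurable g volume) :
    AEStronglyMeasurable (fun s => kernel 0 (t - s) x * g s) volume := by
  have hm : Measurable fun s => kernel 0 (t - s) x := by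
    unfold kernel kernelExp
    fun_prop
  exact hm.aestronglyMeasurable.mul hg

theorem rieszPot_cut_le (a t u : ℝ) (g : ℝ → ℂ) : rieszPot (cut a t g) u ≤ rieszPot g u :=
  lintegral_mono fun s => mul_le_mul_left (enorm_cut_le a t g s) _

theorem integrable_norm_mul_rpow {t : ℝ} {g : ℝ → ℂ} (hg : AEStronglyMeasurable g volume)
    (ht : rieszPot g t < ∞) : Integrable fun s => |t - s| ^ (-(1 / 2) : ℝ) * ‖g s‖ := by
  refine ⟨?_, lt_of_le_of_lt (le_of_eq (lintegral_congr fun s => ?_)) ht⟩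
  · exact (by fun_prop : Measurable fun s : ℝ => |t - s| ^ (-(1 / 2) : ℝ)).aestronglyMeasurable.mul
      hg.norm
  · rw [enorm_mul, enorm_norm, rieszKernel, Real.enorm_of_nonneg (by positivity), mul_comm]

theorem norm_kernel_zero_le (τ x : ℝ) : ‖kernel 0 τ x‖ ≤ |τ| ^ (-(1 / 2) : ℝ) := by
  rcases eq_or_ne τ 0 with rfl | h
  · rw [kernel_zero_zero, norm_zero]; positivity
  · exact norm_kernel_le le_rfl h x

theorem integrable_kernel_mul (t x : ℝ) {g : ℝ → ℂ} (hg : AEStronglyMeasurable g volume)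
    (ht : rieszPot g t < ∞) : Integrable fun s => kernel 0 (t - s) x * g s := by
  refine (integrable_norm_mul_rpow hg ht).mono' (aestronglyMeasurable_kernel_mul t x hg)
    (Eventually.of_forall fun s => ?_)
  rw [norm_mul]
  gcongr
  exact norm_kernel_zero_le _ _

theorem forcedVal_eq (a t : ℝ) (g : ℝ → ℂ) (x : ℝ) :
    forcedVal a t g x = ∫ s, kernel 0 (t - s) x * cut a t g s :=
  intervalIntegral_mul_eq_integral_cut a t _ g

theorem enorm_forcedVal_le (a t : ℝ) (g : ℝ → ℂ) (x : ℝ) :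
    ‖forcedVal a t g x‖ₑ ≤ rieszPot (cut a t g) t := by
  rw [forcedVal_eq]
  refine (enorm_integral_le_lintegral_enorm _).trans (lintegral_mono fun s => ?_)
  rw [enorm_mul, mul_comm]
  gcongr
  exact enorm_kernel_zero_le _ _

theorem continuous_forcedVal (a t : ℝ) {g : ℝ → ℂ} (hg : MemLp g (4 / 3) volume)
    (ht : rieszPot g t < ∞) : Continuous (forcedVal a t g) := by
  have ht' := (rieszPot_cut_le a t t g).trans_lt ht
  have hm := (memLp_cut a t hg).1
  simp_rw [funext fun x => forcedVal_eq a t g x]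
  refine continuous_of_dominated (fun x => aestronglyMeasurable_kernel_mul t x hm)
    (fun x => Eventually.of_forall fun s => ?_) (integrable_norm_mul_rpow hm ht')
    (Eventually.of_forall fun s => (continuous_kernel 0 (t - s)).mul continuous_const)
  rw [norm_mul]
  gcongr
  exact norm_kernel_zero_le _ _

/-- Finiteness of the Riesz potential at `t` makes the kernel integral absolutely convergent at
every `x`. It holds at almost every `t`, which is why solutions have a trace at almost every time
only. Both functions have the same pairing with every test function; the kernel formula may be used
for all `s ≠ t`. -/
theorem free_forced_ae_eq (a t : ℝ) {g : ℝ → ℂ} (hg : MemLp g (4 / 3) volume)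
    (ht : rieszPot g t < ∞) : (free t (forced a t g) : ℝ → ℂ) =ᵐ[volume] forcedVal a t g := by
  have hc := continuous_forcedVal a t hg ht
  have ht' := (rieszPot_cut_le a t t g).trans_lt ht
  have hm := (memLp_cut a t hg).1
  refine ae_eq_of_pairing ((Lp.memLp _).locallyIntegrable (by simp)) hc.locallyIntegrable
    fun φ => ?_
  have h1 := pairing_free_forced a t hg φ
  rw [Lp.toTemperedDistribution_apply] at h1
  simp only [smul_eq_mul] at h1
  rw [h1, intervalIntegral_mul_eq_integral_cut]
  have e1 : ∫ s, (∫ ξ, symbol (t - s) ξ * (𝓕⁻ φ : 𝓢(ℝ, ℂ)) ξ) * cut a t g s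
      = ∫ s, ∫ x, φ x * (kernel 0 (t - s) x * cut a t g s) := by
    have hne : ∀ᵐ s : ℝ, s ≠ t := by simp [ae_iff]
    refine integral_congr_ae (hne.mono fun s hs => ?_)
    simp only
    rw [integral_symbol_mul_fourierInv (sub_ne_zero.2 (Ne.symm hs)), ← integral_mul_const]
    refine integral_congr_ae (Eventually.of_forall fun x => ?_)
    simp only
    ring
  have hint : Integrable (Function.uncurry fun (s x : ℝ) =>
      φ x * (kernel 0 (t - s) x * cut a t g s)) (volume.prod volume) := by
    have h0 := (integrable_norm_mul_rpow hm ht').mul_prod (φ.integrable (μ := volume)).norm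
    refine h0.mono' ?_ (Eventually.of_forall fun z => ?_)
    · have hk : Measurable fun z : ℝ × ℝ => kernel 0 (t - z.1) z.2 := by
        unfold kernel kernelExp
        fun_prop
      exact (φ.continuous.comp continuous_snd).aestronglyMeasurable.mul
        (hk.aestronglyMeasurable.mul hm.comp_fst)
    · simp only [Function.uncurry]
      rw [norm_mul, norm_mul, mul_comm]
      gcongr
      exact norm_kernel_zero_le _ _
  rw [e1, integral_integral_swap hint]
  refine integral_congr_ae (Eventually.of_forall fun x => ?_)
  simp only
  rw [integral_const_mul, forcedVal_eq]

theorem eLpNorm_free_forced_le (a t : ℝ) {g : ℝ → ℂ} (hg : MemLp g (4 / 3) volume)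
    (ht : rieszPot g t < ∞) :
    eLpNorm (free t (forced a t g)) ∞ volume ≤ rieszPot (cut a t g) t := by
  rw [eLpNorm_congr_ae (free_forced_ae_eq a t hg ht), eLpNorm_exponent_top]
  exact eLpNormEssSup_le_of_ae_enorm_bound (Eventually.of_forall fun x => enorm_forcedVal_le a t g x)

/-! ### Functions with integrable Fourier transform -/

theorem integral_mul_fourierInv_eq (φ : 𝓢(ℝ, ℂ)) {F : ℝ → ℂ} (hF : Integrable F) :
    ∫ x, φ x * 𝓕⁻ F x = ∫ ξ, (𝓕⁻ φ : 𝓢(ℝ, ℂ)) ξ * F ξ := by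
  have hφ : Integrable φ := φ.integrable
  have hint : Integrable (Function.uncurry fun (x ξ : ℝ) =>
      φ x * (Complex.exp (Complex.I * ((2 * Real.pi * x * ξ : ℝ) : ℂ)) * F ξ))
      (volume.prod volume) := by
    have h1 := hφ.mul_prod hF
    have hm : Measurable fun z : ℝ × ℝ =>
      Complex.exp (Complex.I * ((2 * Real.pi * z.1 * z.2 : ℝ) : ℂ)) := by fun_prop
    refine (h1.bdd_mul (c := 1) hm.aestronglyMeasurable
      (Eventually.of_forall fun z => ?_)).congr (Eventually.of_forall fun z => ?_)
    · rw [mul_comm, Complex.norm_exp_ofReal_mul_I]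
    · simp only [Function.uncurry]
      ring
  simp_rw [fourierInv_apply_eq_integral, ← integral_const_mul]
  rw [integral_integral_swap hint]
  refine integral_congr_ae (Eventually.of_forall fun ξ => ?_)
  simp only
  rw [SchwartzMap.fourierInv_coe, fourierInv_apply_eq_integral, ← integral_mul_const]
  refine integral_congr_ae (Eventually.of_forall fun x => ?_)
  simp only
  rw [mul_right_comm (2 * Real.pi) x ξ]
  ring

theorem ae_eq_fourierInv_of_integrable {f : L2} {F : ℝ → ℂ} (h : (𝓕 f : L2) =ᵐ[volume] F)
    (hF : Integrable F) {u : ℝ →ᵇ ℂ} (hu : ∀ x, u x = 𝓕⁻ F x) : (f : ℝ → ℂ) =ᵐ[volume] u := by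
  refine ae_eq_of_pairing ((Lp.memLp _).locallyIntegrable (by simp))
    u.continuous.locallyIntegrable fun φ => ?_
  have h1 := pairing_eq_integral_fourier f φ
  rw [Lp.toTemperedDistribution_apply] at h1
  simp only [smul_eq_mul] at h1
  simp_rw [h1, hu]
  rw [integral_mul_fourierInv_eq φ hF]
  exact integral_congr_ae (h.mono fun ξ hξ => by simp only [hξ])

/-- A common integrable majorant makes the symbols continuous in `L¹`, and the inverse Fourier
transform is bounded from `L¹` to bounded continuous functions. This supplies the strong
measurability demanded by the Bochner space `L⁴_t C_x`. -/
theorem exists_continuous_fourierInv {F : ℝ → ℝ → ℂ} (hFm : ∀ t, Measurable (F t))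
    {B : ℝ → ℝ} (hB : Integrable B) (hle : ∀ t ξ, ‖F t ξ‖ ≤ B ξ)
    (hc : ∀ ξ, Continuous fun t => F t ξ) :
    ∃ u : ℝ → (ℝ →ᵇ ℂ), Continuous u ∧ ∀ t x, u t x = 𝓕⁻ (F t) x := by
  have hF : ∀ t, MemLp (F t) 1 volume := fun t => memLp_one_iff_integrable.2
    (hB.mono' (hFm t).aestronglyMeasurable (Eventually.of_forall (hle t)))
  refine ⟨fun t => Real.Lp.fourierTransformInvCLM ℝ ℂ ((hF t).toLp (F t)),
    (Real.Lp.fourierTransformInvCLM ℝ ℂ).continuous.comp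
      (continuous_toLp_of_dominated (by simp) hFm hF (memLp_one_iff_integrable.2 hB) hle hc),
    fun t x => ?_⟩
  change Real.Lp.fourierTransformInvCLM ℝ ℂ ((hF t).toLp (F t)) x = _
  rw [Real.Lp.fourierTransformInvCLM_apply, Real.Lp.fourierTransformInv_toLp]

/-! ### Sup norms of continuous functions -/

theorem enorm_le_of_forall_dense {u : ℝ →ᵇ ℂ} {S : ℝ≥0∞} {D : Set ℝ} (hD : Dense D)
    (h : ∀ x ∈ D, ‖u x‖ₑ ≤ S) : ‖u‖ₑ ≤ S := by
  have hcl : IsClosed {x | ‖u x‖ₑ ≤ S} := isClosed_le (by fun_prop) continuous_const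
  have hall : ∀ x, ‖u x‖ₑ ≤ S := fun x => hcl.closure_subset_iff.2 h (hD x)
  rcases eq_or_ne S ∞ with rfl | hS
  · exact le_top
  rw [← ofReal_norm, ENNReal.ofReal_le_iff_le_toReal hS,
    BoundedContinuousFunction.norm_le ENNReal.toReal_nonneg]
  intro x
  rw [← ENNReal.ofReal_le_iff_le_toReal hS, ofReal_norm]
  exact hall x

theorem enorm_le_eLpNorm_top {f : ℝ → ℂ} {u : ℝ →ᵇ ℂ} (h : f =ᵐ[volume] u) :
    ‖u‖ₑ ≤ eLpNorm f ∞ volume := by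
  rw [eLpNorm_congr_ae h, eLpNorm_exponent_top]
  exact enorm_le_of_forall_dense (Measure.dense_of_ae (enorm_ae_le_eLpNormEssSup u volume))
    fun x hx => hx

theorem eLpNorm_top_le_enorm {f : ℝ → ℂ} {u : ℝ →ᵇ ℂ} (h : f =ᵐ[volume] u) :
    eLpNorm f ∞ volume ≤ ‖u‖ₑ := by
  rw [eLpNorm_congr_ae h, eLpNorm_exponent_top]
  refine eLpNormEssSup_le_of_ae_enorm_bound (Eventually.of_forall fun x => ?_)
  rw [← ofReal_norm, ← ofReal_norm]
  exact ENNReal.ofReal_le_ofReal (u.norm_coe_le_norm x)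

theorem enorm_apply_le (u : ℝ →ᵇ ℂ) (x : ℝ) : ‖u x‖ₑ ≤ ‖u‖ₑ := by
  rw [← ofReal_norm, ← ofReal_norm]
  exact ENNReal.ofReal_le_ofReal (u.norm_coe_le_norm x)

theorem eLpNorm_four {α E : Type*} [MeasurableSpace α] [NormedAddCommGroup E] (μ : Measure α)
    (f : α → E) : eLpNorm f 4 μ ^ 4 = ∫⁻ t, ‖f t‖ₑ ^ 4 ∂μ := by
  rw [eLpNorm_eq_lintegral_rpow_enorm_toReal (by simp) (by simp), ← ENNReal.rpow_natCast,
    ← ENNReal.rpow_mul]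
  simp

/-! ### The homogeneous Strichartz estimate -/

/-- Duality with the dual Strichartz estimate along the moving point `x(t)`. On a bounded window `Y
= ∫|F|⁴` equals `⟨T*g, ĥ⟩` for `g = |F|²F`, hence `Y ≤ 5 Y^{3/4} ‖h‖`. Integrability of `ĥ` makes
`F` bounded, so `Y` is finite and may be divided out. -/
theorem lintegral_four_le_of_linearised {h : L2} (hh : Integrable (𝓕 h : L2))
    {x : ℝ → ℝ} (hx : Measurable x) {F : ℝ → ℂ} (hFm : Measurable F)
    (hF : ∀ t, F t = ∫ ξ, conj (wave (x t) t ξ) * (𝓕 h : L2) ξ) :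
    ∫⁻ t, ‖F t‖ₑ ^ 4 ≤ (5 * ‖h‖ₑ) ^ 4 := by
  set M : ℝ := ∫ ξ, ‖(𝓕 h : L2) ξ‖ with hM
  have hM0 : 0 ≤ M := integral_nonneg fun _ => norm_nonneg _
  have hFM : ∀ t, ‖F t‖ ≤ M := fun t => by
    rw [hF]
    refine (norm_integral_le_integral_norm _).trans (le_of_eq ?_)
    simp [norm_wave, hM]
  have bound : ∀ n : ℕ, ∫⁻ t in Set.Icc (-(n : ℝ)) n, ‖F t‖ₑ ^ 4 ≤ (5 * ‖h‖ₑ) ^ 4 := by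
    intro n
    set A := Set.Icc (-(n : ℝ)) n with hA
    have hAm : MeasurableSet A := measurableSet_Icc
    set Y := ∫⁻ t in A, ‖F t‖ₑ ^ 4 with hY
    let g : ℝ → ℂ := A.indicator fun t => (‖F t‖ ^ 2 : ℝ) * F t
    have hgm : Measurable g := (by fun_prop : Measurable fun t => ((‖F t‖ ^ 2 : ℝ) : ℂ) * F t).indicator
      measurableSet_Icc
    have hgi : Integrable g := by
      refine (integrable_indicator_iff measurableSet_Icc).2 ?_
      refine Measure.integrableOn_of_bounded (M := M ^ 3) (by simp)
        (by fun_prop) (Eventually.of_forall fun t => ?_)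
      rw [norm_mul, Complex.norm_real, norm_pow, norm_norm, ← pow_succ]
      exact pow_le_pow_left₀ (norm_nonneg _) (hFM t) 3
    have hYtop : Y ≠ ∞ := by
      have : Y ≤ ∫⁻ t in A, ENNReal.ofReal M ^ 4 := by
        refine lintegral_mono fun t => ?_
        rw [← ofReal_norm]
        gcongr
        exact hFM t
      refine ne_top_of_le_ne_top ?_ this
      rw [setLIntegral_const]
      exact ENNReal.mul_ne_top (by simp) (by simp [hA])
    have hg43 : eLpNorm g (4 / 3) volume = Y ^ (3 / 4 : ℝ) := by
      rw [eLpNorm_four_thirds, hY, ← lintegral_indicator hAm]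
      congr 1
      refine lintegral_congr fun t => ?_
      by_cases ht : t ∈ A
      · simp only [g, Set.indicator_of_mem ht]
        rw [← ofReal_norm, norm_mul, Complex.norm_real, norm_pow, norm_norm, ← pow_succ,
          ENNReal.ofReal_rpow_of_nonneg (by positivity) (by norm_num), ← Real.rpow_natCast,
          ← Real.rpow_mul (norm_nonneg _), ← ofReal_norm, ← ENNReal.ofReal_pow (norm_nonneg _),
          ← Real.rpow_natCast]
        norm_num
      · simp [g, Set.indicator_of_notMem ht]
    have hduality : ∫ t, conj (g t) * F t = ∫ ξ, conj (adjointWave x g ξ) * (𝓕 h : L2) ξ := by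
      have hgc : Integrable (fun s => conj (g s)) :=
        (Complex.conjLIE.toContinuousLinearEquiv.integrable_comp_iff).2 hgi
      have hint : Integrable (Function.uncurry fun (t ξ : ℝ) =>
          conj (g t) * (conj (wave (x t) t ξ) * (𝓕 h : L2) ξ)) (volume.prod volume) := by
        have h1 := hgc.mul_prod hh
        have hm : Measurable fun z : ℝ × ℝ => conj (wave (x z.1) z.1 z.2) := by
          unfold wave symbol
          fun_prop
        refine (h1.bdd_mul (c := 1) hm.aestronglyMeasurable
          (Eventually.of_forall fun z => ?_)).congr (Eventually.of_forall fun z => ?_)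
        · rw [RCLike.norm_conj, norm_wave]
        · simp only [Function.uncurry]
          ring
      simp_rw [hF, ← integral_const_mul]
      rw [integral_integral_swap hint]
      refine integral_congr_ae (Eventually.of_forall fun ξ => ?_)
      simp only [adjointWave]
      rw [← integral_conj, ← integral_mul_const]
      refine integral_congr_ae (Eventually.of_forall fun t => ?_)
      simp only [map_mul]
      ring
    have hYeq : ‖∫ t, conj (g t) * F t‖ₑ = Y := by
      have e : ∫ t, conj (g t) * F t = ((∫ t in A, ‖F t‖ ^ 4 : ℝ) : ℂ) := by
        rw [← integral_complex_ofReal, ← integral_indicator hAm]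
        refine integral_congr_ae (Eventually.of_forall fun t => ?_)
        by_cases ht : t ∈ A
        · simp only [g, Set.indicator_of_mem ht, map_mul, Complex.conj_ofReal]
          rw [mul_assoc, Complex.conj_mul']
          push_cast
          ring
        · simp [g, Set.indicator_of_notMem ht]
      rw [e, ← ofReal_norm, Complex.norm_real, Real.norm_of_nonneg (by positivity),
        integral_eq_lintegral_of_nonneg_ae (Eventually.of_forall fun t => by positivity)
        (by fun_prop)]
      have e2 : ∫⁻ t in A, ENNReal.ofReal (‖F t‖ ^ 4) = Y := by
        refine lintegral_congr fun t => ?_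
        rw [ENNReal.ofReal_pow (norm_nonneg _), ofReal_norm]
      rw [e2, ENNReal.ofReal_toReal hYtop]
    have hCS : ‖∫ ξ, conj (adjointWave x g ξ) * (𝓕 h : L2) ξ‖ₑ
        ≤ eLpNorm (adjointWave x g) 2 volume * ‖h‖ₑ := by
      have hH := ENNReal.lintegral_mul_le_Lp_mul_Lq volume (p := 2) (q := 2)
        (by constructor <;> norm_num)
        (f := fun ξ => ‖adjointWave x g ξ‖ₑ) (g := fun ξ => ‖(𝓕 h : L2) ξ‖ₑ)
        (continuous_adjointWave hx hgi).aestronglyMeasurable.enorm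
        (Lp.aestronglyMeasurable (𝓕 h : L2)).enorm
      have e1 : ‖h‖ₑ = eLpNorm (𝓕 h : L2) 2 volume := by
        rw [← ofReal_norm, ← Lp.norm_fourier_eq, Lp.norm_def,
          ENNReal.ofReal_toReal (Lp.eLpNorm_ne_top _)]
      rw [e1, eLpNorm_eq_lintegral_rpow_enorm_toReal (by simp) (by simp),
        eLpNorm_eq_lintegral_rpow_enorm_toReal (by simp) (by simp)]
      refine (enorm_integral_le_lintegral_enorm _).trans (le_trans (le_of_eq ?_) hH)
      refine lintegral_congr fun ξ => ?_
      rw [enorm_mul, RCLike.enorm_conj]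
      rfl
    have hdual : eLpNorm (adjointWave x g) 2 volume ≤ 5 * Y ^ (3 / 4 : ℝ) := by
      have := eLpNorm_adjointWave_le hx hgi
      rw [hg43] at this
      rw [← ENNReal.pow_le_pow_left_iff two_ne_zero, mul_pow]
      refine this.trans ?_
      gcongr
      norm_num
    have hfinal : Y ≤ (5 * Y ^ (3 / 4 : ℝ)) * ‖h‖ₑ := by
      calc Y = ‖∫ ξ, conj (adjointWave x g ξ) * (𝓕 h : L2) ξ‖ₑ := by rw [← hduality, hYeq]
        _ ≤ _ := hCS.trans (by gcongr)
    rcases eq_or_ne Y 0 with h0 | h0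
    · rw [h0]; exact zero_le
    have hY34 : Y ^ (3 / 4 : ℝ) ≠ 0 := by
      simp [ENNReal.rpow_eq_zero_iff, h0, hYtop]
    have hY34' : Y ^ (3 / 4 : ℝ) ≠ ∞ := ENNReal.rpow_ne_top_of_nonneg (by norm_num) hYtop
    have hsplit : Y = Y ^ (3 / 4 : ℝ) * Y ^ (1 / 4 : ℝ) := by
      rw [← ENNReal.rpow_add _ _ h0 hYtop]
      norm_num
    have h14 : Y ^ (1 / 4 : ℝ) ≤ 5 * ‖h‖ₑ := by
      rw [← ENNReal.mul_le_mul_iff_right hY34 hY34', ← hsplit]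
      refine hfinal.trans (le_of_eq ?_)
      ring
    calc Y = (Y ^ (1 / 4 : ℝ)) ^ 4 := by
          rw [← ENNReal.rpow_natCast, ← ENNReal.rpow_mul]; norm_num
      _ ≤ _ := by gcongr
  have hmono : Monotone fun n : ℕ => Set.Icc (-(n : ℝ)) n := fun m n hmn =>
    Set.Icc_subset_Icc (by simpa using hmn) (by simpa using hmn)
  have hunion : ⋃ n : ℕ, Set.Icc (-(n : ℝ)) n = Set.univ := by
    refine Set.eq_univ_of_forall fun t => ?_
    obtain ⟨n, hn⟩ := exists_nat_ge |t|
    exact Set.mem_iUnion.2 ⟨n, abs_le.1 hn⟩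
  calc ∫⁻ t, ‖F t‖ₑ ^ 4 = ∫⁻ t in ⋃ n : ℕ, Set.Icc (-(n : ℝ)) n, ‖F t‖ₑ ^ 4 := by
        rw [hunion, setLIntegral_univ]
    _ = ⨆ n : ℕ, ∫⁻ t in Set.Icc (-(n : ℝ)) n, ‖F t‖ₑ ^ 4 :=
        setLIntegral_iUnion_of_directed _ (directed_of_isDirected_le hmono)
    _ ≤ _ := iSup_le bound

/-- A sequence of measurable points along which `|u(t, ·)|` increases to its supremum. -/
def nearMax (a : ℕ → ℝ) (u : ℝ → (ℝ →ᵇ ℂ)) : ℕ → ℝ → ℝ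
  | 0 => fun _ => a 0
  | n + 1 => fun t => if ‖u t (nearMax a u n t)‖ₑ < ‖u t (a (n + 1))‖ₑ then a (n + 1)
      else nearMax a u n t

theorem measurable_apply {u : ℝ → (ℝ →ᵇ ℂ)} (hu : Continuous u) {x : ℝ → ℝ} (hx : Measurable x) :
    Measurable fun t => u t (x t) := by
  have h1 : Continuous fun p : ℝ × ℝ => u p.1 p.2 := by fun_prop
  exact h1.measurable.comp (measurable_id.prodMk hx)

theorem measurable_nearMax (a : ℕ → ℝ) {u : ℝ → (ℝ →ᵇ ℂ)} (hu : Continuous u) (n : ℕ) :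
    Measurable (nearMax a u n) := by
  induction n with
  | zero => exact measurable_const
  | succ n ih =>
    refine Measurable.ite (measurableSet_lt ?_ ?_) measurable_const ih
    · exact (measurable_apply hu ih).enorm
    · exact (measurable_apply hu measurable_const).enorm

theorem monotone_nearMax (a : ℕ → ℝ) (u : ℝ → (ℝ →ᵇ ℂ)) (t : ℝ) :
    Monotone fun n => ‖u t (nearMax a u n t)‖ₑ := by
  refine monotone_nat_of_le_succ fun n => ?_
  simp only [nearMax]
  split_ifs with h
  · exact h.le
  · exact le_rfl

theorem le_nearMax (a : ℕ → ℝ) (u : ℝ → (ℝ →ᵇ ℂ)) (t : ℝ) (n : ℕ) :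
    ‖u t (a n)‖ₑ ≤ ‖u t (nearMax a u n t)‖ₑ := by
  cases n with
  | zero => exact le_rfl
  | succ n =>
    simp only [nearMax]
    split_ifs with h
    · exact le_rfl
    · exact not_lt.1 h

/-- The bound along moving points does not depend on the choice of points. Choosing among finitely
many terms of a dense sequence is measurable, and the chosen moduli increase to the supremum over
`x`; monotone convergence puts the supremum inside the time integral. -/
theorem exists_strichartz_of_integrable {h : L2} (hh : Integrable (𝓕 h : L2)) :
    ∃ u : ℝ → (ℝ →ᵇ ℂ), Continuous u ∧ (∀ t, (free t h : ℝ → ℂ) =ᵐ[volume] u t) ∧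
      ∫⁻ t, ‖u t‖ₑ ^ 4 ≤ (5 * ‖h‖ₑ) ^ 4 := by
  have hm : ∀ t, Measurable fun ξ => symbol t ξ * (𝓕 h : L2) ξ := fun t =>
    (continuous_symbol t).measurable.mul (Lp.stronglyMeasurable (𝓕 h : L2)).measurable
  have hle : ∀ t ξ, ‖symbol t ξ * (𝓕 h : L2) ξ‖ ≤ ‖(𝓕 h : L2) ξ‖ := fun t ξ => by
    rw [norm_mul, norm_symbol, one_mul]
  obtain ⟨u, hu, huF⟩ := exists_continuous_fourierInv hm hh.norm hle
    fun ξ => (continuous_symbol_left ξ).mul continuous_const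
  refine ⟨u, hu, fun t => ae_eq_fourierInv_of_integrable (fourier_free_ae t h)
    (hh.norm.mono' (hm t).aestronglyMeasurable (Eventually.of_forall (hle t))) (huF t), ?_⟩
  obtain ⟨a, ha⟩ := TopologicalSpace.exists_dense_seq ℝ
  have hn : ∀ n, ∫⁻ t, ‖u t (nearMax a u n t)‖ₑ ^ 4 ≤ (5 * ‖h‖ₑ) ^ 4 := fun n => by
    refine lintegral_four_le_of_linearised hh (measurable_nearMax a hu n)
      (measurable_apply hu (measurable_nearMax a hu n)) fun t => ?_
    rw [huF, fourierInv_apply_eq_integral]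
    refine integral_congr_ae (Eventually.of_forall fun ξ => ?_)
    have h0 : wave 0 0 ξ = 1 := by simp [wave, symbol]
    have := conj_wave_mul_wave_zero (nearMax a u n t) t ξ
    rw [h0, mul_one] at this
    simp only [this, mul_assoc]
  calc ∫⁻ t, ‖u t‖ₑ ^ 4 ≤ ∫⁻ t, ⨆ n, ‖u t (nearMax a u n t)‖ₑ ^ 4 := by
        refine lintegral_mono fun t => ?_
        have hsup : ‖u t‖ₑ ≤ ⨆ n, ‖u t (nearMax a u n t)‖ₑ := by
          refine enorm_le_of_forall_dense ha ?_
          rintro _ ⟨n, rfl⟩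
          exact (le_nearMax a u t n).trans (le_iSup (fun n => ‖u t (nearMax a u n t)‖ₑ) n)
        have hlim := tendsto_atTop_iSup (monotone_nearMax a u t)
        have hlim4 := ENNReal.Tendsto.pow (n := 4) hlim
        have hmono4 : Monotone fun n => ‖u t (nearMax a u n t)‖ₑ ^ 4 := fun m n hmn =>
          pow_le_pow_left₀ zero_le (monotone_nearMax a u t hmn) 4
        have e := tendsto_nhds_unique hlim4 (tendsto_atTop_iSup hmono4)
        simp only
        rw [← e]
        gcongr
    _ = ⨆ n, ∫⁻ t, ‖u t (nearMax a u n t)‖ₑ ^ 4 := by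
        refine lintegral_iSup (fun n => ?_) fun m n hmn t => ?_
        · exact (measurable_apply hu (measurable_nearMax a hu n)).enorm.pow_const 4
        · exact pow_le_pow_left₀ zero_le (monotone_nearMax a u t hmn) 4
    _ ≤ _ := iSup_le hn

/-! ### Closedness in `L⁴ C` -/

/-- `u` represents `v` in `L⁴_t C_x`. -/
def RepresentsL4C (u : ℝ → (ℝ →ᵇ ℂ)) (v : ℝ → L2) : Prop :=
  MemLp u 4 volume ∧ ∀ᵐ t, (v t : ℝ → ℂ) =ᵐ[volume] u t

theorem ae_eq_of_tendsto {f : ℕ → L2} {f₀ : L2} (hf : Tendsto f atTop (𝓝 f₀))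
    {u : ℕ → (ℝ →ᵇ ℂ)} {u₀ : ℝ →ᵇ ℂ} (hu : Tendsto u atTop (𝓝 u₀))
    (h : ∀ n, (f n : ℝ → ℂ) =ᵐ[volume] u n) : (f₀ : ℝ → ℂ) =ᵐ[volume] u₀ := by
  obtain ⟨ns, hns, hlim⟩ := (tendstoInMeasure_of_tendsto_Lp hf).exists_seq_tendsto_ae
  filter_upwards [hlim, ae_all_iff.2 h] with x h1 h2
  have h3 : Tendsto (fun i => u (ns i) x) atTop (𝓝 (u₀ x)) :=
    ((BoundedContinuousFunction.evalCLM ℂ x).continuous.tendsto u₀).comp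
      (hu.comp hns.tendsto_atTop)
  refine tendsto_nhds_unique h1 (h3.congr fun i => (h2 (ns i)).symm)

/-- The estimates make the representatives of the approximations Cauchy in the Banach space `L⁴_t
C_x`. Along a subsequence they converge at almost every time, where the limit must represent `V y₀
t`. This extends both Strichartz estimates from dense classes, with measurability included. -/
theorem exists_representsL4C_of_tendsto {Y : Type*} [NormedAddCommGroup Y] (V : Y → ℝ → L2)
    {C : ℝ≥0∞} (hC : C ≠ ∞) {y : ℕ → Y} {y₀ : Y} (hy : Tendsto y atTop (𝓝 y₀))
    (hrep : ∀ n, ∃ u, RepresentsL4C u (V (y n)))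
    (hsub : ∀ n m, ∫⁻ t, eLpNorm (V (y n) t - V (y m) t : L2) ∞ volume ^ 4
      ≤ (C * ‖y n - y m‖ₑ) ^ 4)
    (hbd : ∀ n, ∫⁻ t, eLpNorm (V (y n) t) ∞ volume ^ 4 ≤ (C * ‖y n‖ₑ) ^ 4)
    (hlim : ∀ t, Tendsto (fun n => V (y n) t) atTop (𝓝 (V y₀ t))) :
    ∃ u, RepresentsL4C u (V y₀) ∧ eLpNorm u 4 volume ≤ C * ‖y₀‖ₑ := by
  choose u hu using hrep
  have : Fact ((1 : ℝ≥0∞) ≤ 4) := ⟨by norm_num⟩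
  let U : ℕ → Lp (ℝ →ᵇ ℂ) 4 (volume : Measure ℝ) := fun n => (hu n).1.toLp (u n)
  have hUe : ∀ n m, edist (U n) (U m) ≤ C * ‖y n - y m‖ₑ := by
    intro n m
    rw [Lp.edist_toLp_toLp, ← ENNReal.pow_le_pow_left_iff four_ne_zero, eLpNorm_four]
    refine le_trans (lintegral_mono_ae ?_) (hsub n m)
    filter_upwards [(hu n).2, (hu m).2] with t h1 h2
    refine pow_le_pow_left₀ zero_le (enorm_le_eLpNorm_top ?_) 4
    filter_upwards [h1, h2, Lp.coeFn_sub (V (y n) t) (V (y m) t)] with x e1 e2 e3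
    rw [e3, Pi.sub_apply, e1, e2]
    rfl
  have hUn : ∀ n, ‖U n‖ₑ ≤ C * ‖y n‖ₑ := by
    intro n
    rw [← ofReal_norm, Lp.norm_toLp, ENNReal.ofReal_toReal (hu n).1.2.ne,
      ← ENNReal.pow_le_pow_left_iff four_ne_zero, eLpNorm_four]
    refine le_trans (lintegral_mono_ae ?_) (hbd n)
    filter_upwards [(hu n).2] with t h1
    exact pow_le_pow_left₀ zero_le (enorm_le_eLpNorm_top h1) 4
  have hCauchy : CauchySeq U := by
    rw [EMetric.cauchySeq_iff]
    intro ε hε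
    have hcy := hy.cauchySeq
    rw [EMetric.cauchySeq_iff] at hcy
    obtain ⟨N, hN⟩ := hcy (ε / (C + 1)) (ENNReal.div_pos hε.ne' (by simp [hC]))
    refine ⟨N, fun m hm n hn => (hUe m n).trans_lt ?_⟩
    have := hN m hm n hn
    rw [edist_eq_enorm_sub, ENNReal.lt_div_iff_mul_lt (by simp) (by simp [hC])] at this
    refine lt_of_le_of_lt ?_ this
    rw [mul_comm]
    gcongr
    exact le_self_add
  obtain ⟨U₀, hU₀⟩ := cauchySeq_tendsto_of_complete hCauchy
  refine ⟨U₀, ⟨Lp.memLp U₀, ?_⟩, ?_⟩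
  · obtain ⟨ns, hns, hae⟩ := (tendstoInMeasure_of_tendsto_Lp hU₀).exists_seq_tendsto_ae
    filter_upwards [hae, ae_all_iff.2 fun n => (hu n).2, ae_all_iff.2 fun n =>
      (hu n).1.coeFn_toLp] with t h1 h2 h3
    refine ae_eq_of_tendsto ((hlim t).comp hns.tendsto_atTop) h1 fun n => ?_
    have : U (ns n) t = u (ns n) t := h3 (ns n)
    rw [this]
    exact h2 (ns n)
  · have h1 : Tendsto (fun n => ‖U n‖ₑ) atTop (𝓝 ‖U₀‖ₑ) := hU₀.enorm
    have h2 : Tendsto (fun n => C * ‖y n‖ₑ) atTop (𝓝 (C * ‖y₀‖ₑ)) :=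
      ENNReal.Tendsto.const_mul hy.enorm (Or.inr hC)
    have h3 := le_of_tendsto_of_tendsto' h1 h2 hUn
    rwa [← ofReal_norm, Lp.norm_def, ENNReal.ofReal_toReal (Lp.eLpNorm_ne_top _)] at h3

theorem tendsto_free {ι : Type*} {l : Filter ι} (t : ℝ) {f : ι → L2} {f₀ : L2}
    (h : Tendsto f l (𝓝 f₀)) : Tendsto (fun i => free t (f i)) l (𝓝 (free t f₀)) := by
  rw [tendsto_iff_norm_sub_tendsto_zero] at h ⊢
  simpa only [← free_sub, norm_free] using h

/-- The homogeneous Strichartz estimate in `L⁴_t C_x`. -/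
theorem exists_strichartz (h : L2) : ∃ u : ℝ → (ℝ →ᵇ ℂ),
    RepresentsL4C u (fun t => free t h) ∧ eLpNorm u 4 volume ≤ 5 * ‖h‖ₑ := by
  -- Schwartz functions have integrable Fourier transform, so the estimate already proved applies on
  -- a dense class.
  have hdense := SchwartzMap.denseRange_toLpCLM (E := ℝ) (F := ℂ) (p := 2) (μ := volume) (by simp)
  obtain ⟨y, hy, hlim⟩ := mem_closure_iff_seq_limit.1 (hdense h)
  have hint : ∀ n, Integrable (𝓕 (y n) : L2) := fun n => by
    obtain ⟨φ, hφ⟩ := hy n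
    rw [SchwartzMap.toLpCLM_apply] at hφ
    rw [← hφ, SchwartzMap.toLp_fourier_eq]
    exact ((𝓕 φ : 𝓢(ℝ, ℂ)).integrable (μ := volume)).congr
      (SchwartzMap.coeFn_toLp (𝓕 φ) 2 volume).symm
  have hbd : ∀ g : L2, Integrable (𝓕 g : L2) → ∫⁻ t, eLpNorm (free t g) ∞ volume ^ 4
      ≤ (5 * ‖g‖ₑ) ^ 4 := fun g hg => by
    obtain ⟨u, hu, hrep, hle⟩ := exists_strichartz_of_integrable hg
    refine (lintegral_mono fun t => ?_).trans hle
    exact pow_le_pow_left₀ zero_le (eLpNorm_top_le_enorm (hrep t)) 4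
  refine exists_representsL4C_of_tendsto (fun h t => free t h) (C := 5) (by simp) hlim
    (fun n => ?_) (fun n m => ?_) (fun n => hbd _ (hint n)) fun t => ?_
  · obtain ⟨u, hu, hrep, hle⟩ := exists_strichartz_of_integrable (hint n)
    refine ⟨u, ⟨hu.aestronglyMeasurable, ?_⟩, Eventually.of_forall hrep⟩
    have hlt : eLpNorm u 4 volume ^ 4 < ∞ := by
      rw [eLpNorm_four]
      exact hle.trans_lt (ENNReal.pow_lt_top (ENNReal.mul_lt_top (by simp) (by simp)))
    by_contra hc
    rw [not_lt, top_le_iff] at hc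
    simp [hc] at hlt
  · simp_rw [← free_sub]
    refine hbd _ ?_
    have e : (𝓕 (y n - y m) : L2) = (𝓕 (y n) : L2) - (𝓕 (y m) : L2) :=
      (Lp.fourierTransformₗᵢ ℝ ℂ).map_sub _ _
    rw [e]
    exact ((hint n).sub (hint m)).congr (Lp.coeFn_sub _ _).symm
  · exact tendsto_free t hlim

/-! ### The inhomogeneous Strichartz estimate -/

theorem lintegral_free_forced_le (a : ℝ) {g : ℝ → ℂ} (hg : MemLp g (4 / 3) volume) :
    ∫⁻ t, eLpNorm (free t (forced a t g)) ∞ volume ^ 4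
      ≤ (20 * eLpNorm g (4 / 3) volume) ^ 4 := by
  refine le_trans (lintegral_mono_ae ?_) (lintegral_rieszPot_pow_le hg.1)
  filter_upwards [ae_rieszPot_lt_top hg] with t ht
  exact pow_le_pow_left₀ zero_le
    ((eLpNorm_free_forced_le a t hg ht).trans (rieszPot_cut_le a t t g)) 4

theorem memLp_four_of_lintegral {E : Type*} [NormedAddCommGroup E] {u : ℝ → E}
    {μ : Measure ℝ} (hu : AEStronglyMeasurable u μ) (h : ∫⁻ t, ‖u t‖ₑ ^ 4 ∂μ ≠ ∞) :
    MemLp u 4 μ := by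
  refine ⟨hu, ?_⟩
  rw [← eLpNorm_four] at h
  by_contra hc
  rw [not_lt, top_le_iff] at hc
  simp [hc] at h

theorem hasDerivAt_symbol_neg (ξ s : ℝ) : HasDerivAt (fun s => symbol (-s) ξ)
    (((4 * Real.pi ^ 2 * ξ ^ 2 : ℝ) : ℂ) * Complex.I * symbol (-s) ξ) s := by
  unfold symbol
  have h1 : HasDerivAt (fun s : ℝ => -(4 * Real.pi ^ 2 * -s * ξ ^ 2)) (4 * Real.pi ^ 2 * ξ ^ 2) s := by
    have := (hasDerivAt_id s).const_mul (4 * Real.pi ^ 2 * ξ ^ 2)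
    refine (this.congr_deriv (mul_one _)).congr_of_eventuallyEq (Eventually.of_forall fun x => ?_)
    simp only [id]
    ring
  have h2 := ((h1.ofReal_comp).const_mul Complex.I).cexp
  refine h2.congr_deriv ?_
  ring

theorem norm_forcedHat_le_integral (a t : ℝ) (φ : 𝓢(ℝ, ℂ)) (ξ : ℝ) :
    ‖forcedHat a t φ ξ‖ ≤ ∫ s, ‖φ s‖ := by
  refine intervalIntegral.norm_integral_le_integral_norm_uIoc.trans ?_
  simp only [norm_mul, norm_symbol, one_mul]
  exact setIntegral_le_integral (φ.integrable (μ := volume)).norm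
    (Eventually.of_forall fun s => norm_nonneg _)

/-- Integration by parts in time: differentiating the phase produces `4π²ξ²`, at the cost of two
boundary values and one derivative of the source. The resulting decay `ξ^{-2}` is integrable and
uniform in `a` and `t`. -/
theorem norm_mul_forcedHat_le (a t : ℝ) (φ : 𝓢(ℝ, ℂ)) (ξ : ℝ) :
    4 * Real.pi ^ 2 * ξ ^ 2 * ‖forcedHat a t φ ξ‖
      ≤ 2 * ‖φ.toBoundedContinuousFunction‖ + ∫ s, ‖SchwartzMap.derivCLM ℝ ℂ φ s‖ := by
  set c : ℂ := ((4 * Real.pi ^ 2 * ξ ^ 2 : ℝ) : ℂ) * Complex.I with hc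
  have hcn : ‖c‖ = 4 * Real.pi ^ 2 * ξ ^ 2 := by
    rw [hc, norm_mul, Complex.norm_I, mul_one, Complex.norm_real,
      Real.norm_of_nonneg (by positivity)]
  have hsc : Continuous fun s => symbol (-s) ξ := (continuous_symbol_left ξ).comp continuous_neg
  have hparts := intervalIntegral.integral_mul_deriv_eq_deriv_mul (a := a) (b := t)
    (u := φ) (u' := SchwartzMap.derivCLM ℝ ℂ φ) (v := fun s => symbol (-s) ξ)
    (v' := fun s => c * symbol (-s) ξ)
    (fun x _ => by
      rw [SchwartzMap.derivCLM_apply]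
      exact (φ.differentiable x).hasDerivAt)
    (fun x _ => hasDerivAt_symbol_neg ξ x)
    ((SchwartzMap.derivCLM ℝ ℂ φ).continuous.intervalIntegrable _ _)
    ((continuous_const.mul hsc).intervalIntegrable _ _)
  have e : ∫ s in a..t, φ s * (c * symbol (-s) ξ) = c * forcedHat a t φ ξ := by
    rw [forcedHat, ← intervalIntegral.integral_const_mul]
    refine intervalIntegral.integral_congr fun s _ => ?_
    ring
  rw [e] at hparts
  rw [← hcn, ← norm_mul, hparts]
  have hb : ∀ s, ‖φ s * symbol (-s) ξ‖ ≤ ‖φ.toBoundedContinuousFunction‖ := fun s => by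
    rw [norm_mul, norm_symbol, mul_one]
    exact φ.toBoundedContinuousFunction.norm_coe_le_norm s
  have hi : ‖∫ s in a..t, SchwartzMap.derivCLM ℝ ℂ φ s * symbol (-s) ξ‖
      ≤ ∫ s, ‖SchwartzMap.derivCLM ℝ ℂ φ s‖ := by
    refine intervalIntegral.norm_integral_le_integral_norm_uIoc.trans ?_
    simp only [norm_mul, norm_symbol, mul_one]
    exact setIntegral_le_integral ((SchwartzMap.derivCLM ℝ ℂ φ).integrable (μ := volume)).norm
      (Eventually.of_forall fun s => norm_nonneg _)
  calc _ ≤ ‖φ t * symbol (-t) ξ‖ + ‖φ a * symbol (-a) ξ‖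
        + ‖∫ s in a..t, SchwartzMap.derivCLM ℝ ℂ φ s * symbol (-s) ξ‖ :=
      (norm_sub_le _ _).trans (by gcongr; exact norm_sub_le _ _)
    _ ≤ _ := by linarith [hb t, hb a]

theorem exists_norm_forcedHat_le (φ : 𝓢(ℝ, ℂ)) :
    ∃ C : ℝ, ∀ a t ξ, ‖forcedHat a t φ ξ‖ ≤ C * (1 + ξ ^ 2)⁻¹ := by
  refine ⟨(∫ s, ‖φ s‖) + (2 * ‖φ.toBoundedContinuousFunction‖ +
    ∫ s, ‖SchwartzMap.derivCLM ℝ ℂ φ s‖), fun a t ξ => ?_⟩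
  rw [← div_eq_mul_inv, le_div_iff₀ (by positivity)]
  have h1 := norm_forcedHat_le_integral a t φ ξ
  have h2 := norm_mul_forcedHat_le a t φ ξ
  have h3 : 1 * (ξ ^ 2 * ‖forcedHat a t φ ξ‖) ≤ 4 * Real.pi ^ 2 * (ξ ^ 2 * ‖forcedHat a t φ ξ‖) := by
    gcongr
    nlinarith [Real.pi_gt_three]
  linarith

theorem representsL4C_schwartz (φ : 𝓢(ℝ, ℂ)) (hφ : MemLp φ (4 / 3) volume) :
    ∃ u, RepresentsL4C u (fun t => free t (forced 0 t φ)) := by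
  obtain ⟨C, hC⟩ := exists_norm_forcedHat_le φ
  have hm : ∀ t, Measurable fun ξ => symbol t ξ * forcedHat 0 t φ ξ := fun t =>
    ((continuous_symbol t).mul (continuous_forcedHat 0 t hφ)).measurable
  have hle : ∀ t ξ, ‖symbol t ξ * forcedHat 0 t φ ξ‖ ≤ C * (1 + ξ ^ 2)⁻¹ := fun t ξ => by
    rw [norm_mul, norm_symbol, one_mul]
    exact hC 0 t ξ
  have hB : Integrable fun ξ : ℝ => C * (1 + ξ ^ 2)⁻¹ := integrable_inv_one_add_sq.const_mul C
  obtain ⟨u, hu, huF⟩ := exists_continuous_fourierInv hm hB hle fun ξ =>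
    (continuous_symbol_left ξ).mul (intervalIntegral.continuous_primitive
      (fun a b => (((continuous_symbol_left ξ).comp continuous_neg).mul
        φ.continuous).intervalIntegrable a b) 0)
  have hrep : ∀ t, (free t (forced 0 t φ) : ℝ → ℂ) =ᵐ[volume] u t := fun t => by
    refine ae_eq_fourierInv_of_integrable ?_
      (hB.mono' (hm t).aestronglyMeasurable (Eventually.of_forall (hle t))) (huF t)
    filter_upwards [fourier_free_ae t (forced 0 t φ), fourier_forced_ae 0 t hφ] with ξ h1 h2
    rw [h1, h2]
  refine ⟨u, memLp_four_of_lintegral hu.aestronglyMeasurable (ne_of_lt ?_),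
    Eventually.of_forall hrep⟩
  calc ∫⁻ t, ‖u t‖ₑ ^ 4 ≤ ∫⁻ t, eLpNorm (free t (forced 0 t φ)) ∞ volume ^ 4 :=
        lintegral_mono fun t => pow_le_pow_left₀ zero_le (enorm_le_eLpNorm_top (hrep t)) 4
    _ ≤ _ := lintegral_free_forced_le 0 hφ
    _ < ∞ := ENNReal.pow_lt_top (ENNReal.mul_lt_top (by simp) hφ.2)

theorem enorm_Lp_eq {E : Type*} [NormedAddCommGroup E] {p : ℝ≥0∞} [Fact (1 ≤ p)] {μ : Measure ℝ}
    (y : Lp E p μ) : ‖y‖ₑ = eLpNorm y p μ := by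
  rw [← ofReal_norm, Lp.norm_def, ENNReal.ofReal_toReal (Lp.eLpNorm_ne_top _)]

/-- Schwartz sources are treated directly, since their transforms have an integrable majorant;
density in `L^{4/3}` and the inhomogeneous Strichartz bound give the rest. Working in `Lp` is
harmless because `forced` depends only on the class of its source. -/
theorem exists_representsL4C_forced {g : ℝ → ℂ} (hg : MemLp g (4 / 3) volume) :
    ∃ u, RepresentsL4C u (fun t => free t (forced 0 t g)) := by
  have hne : (4 / 3 : ℝ≥0∞) ≠ ∞ := ENNReal.div_ne_top (by simp) (by simp)
  let V : Lp ℂ (4 / 3) (volume : Measure ℝ) → ℝ → L2 := fun y t => free t (forced 0 t y)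
  have hcongr : ∀ {g₁ g₂ : ℝ → ℂ}, g₁ =ᵐ[volume] g₂ → ∀ t, forced 0 t g₁ = forced 0 t g₂ :=
    fun h t => forced_congr (h.mono fun s hs _ => hs)
  have hVsub : ∀ y z : Lp ℂ (4 / 3) (volume : Measure ℝ), ∀ t,
      forced 0 t y - forced 0 t z = forced 0 t (y - z : Lp ℂ (4 / 3) (volume : Measure ℝ)) :=
    fun y z t => by
      rw [← forced_sub 0 t (Lp.memLp y) (Lp.memLp z)]
      exact (hcongr (Lp.coeFn_sub y z) t).symm
  have hdense := SchwartzMap.denseRange_toLpCLM (E := ℝ) (F := ℂ) (p := 4 / 3) (μ := volume) hne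
  obtain ⟨y, hy, hlim⟩ := mem_closure_iff_seq_limit.1 (hdense (hg.toLp g))
  have hbd : ∀ z : Lp ℂ (4 / 3) (volume : Measure ℝ),
      ∫⁻ t, eLpNorm (V z t) ∞ volume ^ 4 ≤ (20 * ‖z‖ₑ) ^ 4 := fun z => by
    rw [enorm_Lp_eq]
    exact lintegral_free_forced_le 0 (Lp.memLp z)
  obtain ⟨u, hu, -⟩ := exists_representsL4C_of_tendsto V (C := 20) (by simp) hlim
    (fun n => by
      obtain ⟨φ, hφ⟩ := hy n
      rw [SchwartzMap.toLpCLM_apply] at hφ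
      have hae : (y n : ℝ → ℂ) =ᵐ[volume] φ := by
        rw [← hφ]
        exact φ.coeFn_toLp (4 / 3) volume
      obtain ⟨u, hu⟩ := representsL4C_schwartz φ (φ.memLp (4 / 3) volume)
      refine ⟨u, hu.1, hu.2.mono fun t ht => ?_⟩
      simp only [V]
      rw [hcongr hae t]
      exact ht)
    (fun n m => by
      refine le_trans (le_of_eq (lintegral_congr fun t => ?_)) (hbd (y n - y m))
      simp only [V]
      rw [← free_sub, hVsub])
    (fun n => hbd (y n))
    (fun t => by
      refine tendsto_free t ?_
      rw [tendsto_iff_edist_tendsto_0] at hlim ⊢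
      have h5 := ENNReal.Tendsto.const_mul (a := 5) hlim (Or.inr (by simp))
      rw [mul_zero] at h5
      refine tendsto_of_tendsto_of_tendsto_of_le_of_le tendsto_const_nhds h5 (fun _ => zero_le)
        fun n => ?_
      simp only
      rw [edist_eq_enorm_sub, hVsub, edist_eq_enorm_sub, enorm_Lp_eq (y n - hg.toLp g)]
      refine (enorm_forced_le 0 t (Lp.memLp _)).trans ?_
      gcongr
      exact Measure.restrict_le_self)
  refine ⟨u, hu.1, hu.2.mono fun t ht => ?_⟩
  simp only
  rw [← hcongr hg.coeFn_toLp t]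
  exact ht

/-! ### The Volterra operator -/

/-- The Volterra operator `g ↦ i ∫_a^t E₀(t - s, 0) g(s) ds`. -/
def volterra (a : ℝ) (g : ℝ → ℂ) (t : ℝ) : ℂ := Complex.I * forcedVal a t g 0

/-- The set of pairs `(t, s)` such that `s` lies between `a` and `t`. -/
def wedge (a : ℝ) : Set (ℝ × ℝ) := {p | p.2 ∈ Set.uIoc a p.1}

theorem measurableSet_wedge (a : ℝ) : MeasurableSet (wedge a) := by
  have h1 : MeasurableSet {p : ℝ × ℝ | min a p.1 < p.2} :=
    measurableSet_lt (by fun_prop) (by fun_prop)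
  have h2 : MeasurableSet {p : ℝ × ℝ | p.2 ≤ max a p.1} :=
    measurableSet_le (by fun_prop) (by fun_prop)
  exact h1.inter h2

/-- The phase relation absorbs the factor `i` into a reversal of time. For `t < a` it produces an
extra sign, which cancels the orientation sign of the integral, so one formula serves both
directions. -/
theorem volterra_eq_integral (a : ℝ) (g : ℝ → ℂ) (t : ℝ) :
    volterra a g t = ∫ s, (wedge a).indicator (fun p => kernel 0 (p.2 - p.1) 0 * g p.2) (t, s) := by
  rw [volterra, forcedVal_eq, ← integral_const_mul]
  refine integral_congr_ae (Eventually.of_forall fun s => ?_)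
  by_cases hs : s ∈ Set.uIoc a t
  · have hw : (t, s) ∈ wedge a := hs
    simp only [cut, Set.indicator_of_mem hs, Set.indicator_of_mem hw]
    rcases eq_or_ne s t with rfl | hne
    · simp [kernel_zero_zero]
    rcases le_or_gt a t with hat | hat
    · rw [Set.uIoc_of_le hat] at hs
      have := I_mul_kernel_of_pos (sub_pos.2 (lt_of_le_of_ne hs.2 hne))
      rw [neg_sub] at this
      rw [if_pos hat, one_mul, ← mul_assoc, this]
    · rw [Set.uIoc_of_ge hat.le] at hs
      have := I_mul_kernel_of_neg (sub_neg.2 hs.1)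
      rw [neg_sub] at this
      rw [if_neg (not_le.2 hat), ← mul_assoc, this]
      ring
  · have hw : (t, s) ∉ wedge a := hs
    simp [cut, Set.indicator_of_notMem hs, Set.indicator_of_notMem hw]

theorem aestronglyMeasurable_volterra (a : ℝ) {g : ℝ → ℂ} (hg : AEStronglyMeasurable g volume) :
    AEStronglyMeasurable (volterra a g) volume := by
  have h : AEStronglyMeasurable ((wedge a).indicator fun p : ℝ × ℝ =>
      kernel 0 (p.2 - p.1) 0 * g p.2) (volume.prod volume) := by
    refine AEStronglyMeasurable.indicator ?_ (measurableSet_wedge a)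
    refine AEStronglyMeasurable.mul ?_ hg.comp_snd
    exact ((measurable_kernel 0).comp (by fun_prop : Measurable
      fun p : ℝ × ℝ => (p.2 - p.1, (0 : ℝ)))).aestronglyMeasurable
  refine h.integral_prod_right'.congr (Eventually.of_forall fun t => ?_)
  exact (volterra_eq_integral a g t).symm

theorem enorm_volterra_le (a : ℝ) (g : ℝ → ℂ) (t : ℝ) : ‖volterra a g t‖ₑ ≤ rieszPot g t := by
  rw [volterra, enorm_mul, ← ofReal_norm, Complex.norm_I, ENNReal.ofReal_one, one_mul]
  exact (enorm_forcedVal_le a t g 0).trans (rieszPot_cut_le a t t g)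

theorem eLpNorm_volterra_le (a : ℝ) {g : ℝ → ℂ} (hg : AEStronglyMeasurable g volume) :
    eLpNorm (volterra a g) 4 volume ≤ 20 * eLpNorm g (4 / 3) volume := by
  rw [← ENNReal.pow_le_pow_left_iff four_ne_zero, eLpNorm_four]
  refine (lintegral_mono fun t => ?_).trans (lintegral_rieszPot_pow_le hg)
  exact pow_le_pow_left₀ zero_le (enorm_volterra_le a g t) 4

theorem memLp_volterra (a : ℝ) {g : ℝ → ℂ} (hg : MemLp g (4 / 3) volume) :
    MemLp (volterra a g) 4 volume :=
  ⟨aestronglyMeasurable_volterra a hg.1,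
    (eLpNorm_volterra_le a hg.1).trans_lt (ENNReal.mul_lt_top (by simp) hg.2)⟩

theorem volterra_congr {a t : ℝ} {g₁ g₂ : ℝ → ℂ}
    (h : ∀ᵐ s, s ∈ Set.uIoc a t → g₁ s = g₂ s) : volterra a g₁ t = volterra a g₂ t := by
  rw [volterra, volterra, forcedVal, forcedVal]
  congr 1
  refine intervalIntegral.integral_congr_ae (h.mono fun s hs hst => ?_)
  rw [hs hst]

theorem intervalIntegrable_kernel_mul (a t : ℝ) {g : ℝ → ℂ} (hg : AEStronglyMeasurable g volume)
    (ht : rieszPot g t < ∞) : IntervalIntegrable (fun s => kernel 0 (t - s) 0 * g s) volume a t :=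
  (integrable_kernel_mul t 0 hg ht).intervalIntegrable

theorem volterra_add (a t : ℝ) {g₁ g₂ : ℝ → ℂ} (h₁ : AEStronglyMeasurable g₁ volume)
    (h₂ : AEStronglyMeasurable g₂ volume) (ht₁ : rieszPot g₁ t < ∞) (ht₂ : rieszPot g₂ t < ∞) :
    volterra a (g₁ + g₂) t = volterra a g₁ t + volterra a g₂ t := by
  simp only [volterra, forcedVal, Pi.add_apply, mul_add]
  rw [intervalIntegral.integral_add (intervalIntegrable_kernel_mul a t h₁ ht₁)
    (intervalIntegrable_kernel_mul a t h₂ ht₂), mul_add]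

theorem volterra_sub (a t : ℝ) {g₁ g₂ : ℝ → ℂ} (h₁ : AEStronglyMeasurable g₁ volume)
    (h₂ : AEStronglyMeasurable g₂ volume) (ht₁ : rieszPot g₁ t < ∞) (ht₂ : rieszPot g₂ t < ∞) :
    volterra a (g₁ - g₂) t = volterra a g₁ t - volterra a g₂ t := by
  simp only [volterra, forcedVal, Pi.sub_apply, mul_sub]
  rw [intervalIntegral.integral_sub (intervalIntegrable_kernel_mul a t h₁ ht₁)
    (intervalIntegrable_kernel_mul a t h₂ ht₂), mul_sub]

theorem integrable_indicator_wedge (a : ℝ) {g : ℝ → ℂ} (hg : MemLp g (4 / 3) volume) :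
    Integrable ((wedge a).indicator fun p : ℝ × ℝ =>
      conj (g p.1) * g p.2 * kernel 0 (p.2 - p.1) 0) :=
  (integrable_prod_kernel hg).indicator (measurableSet_wedge a)

theorem conj_mul_volterra_eq (a : ℝ) (g : ℝ → ℂ) (t : ℝ) :
    conj (g t) * volterra a g t = ∫ s, (wedge a).indicator (fun p : ℝ × ℝ =>
      conj (g p.1) * g p.2 * kernel 0 (p.2 - p.1) 0) (t, s) := by
  rw [volterra_eq_integral, ← integral_const_mul]
  refine integral_congr_ae (Eventually.of_forall fun s => ?_)
  simp only [Set.indicator]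
  split_ifs
  · ring
  · simp

theorem integrable_conj_mul_volterra (a : ℝ) {g : ℝ → ℂ} (hg : MemLp g (4 / 3) volume) :
    Integrable fun t => conj (g t) * volterra a g t := by
  simp_rw [conj_mul_volterra_eq]
  have h := integrable_indicator_wedge a hg
  rw [Measure.volume_eq_prod] at h
  exact h.integral_prod_left

/-- The Volterra operator is accretive. -/
theorem re_integral_conj_mul_volterra_nonneg (a : ℝ) {g : ℝ → ℂ} (hg : MemLp g (4 / 3) volume)
    (hgi : Integrable g) : 0 ≤ (∫ t, conj (g t) * volterra a g t).re := by
  set H : ℝ × ℝ → ℂ := fun p => conj (g p.1) * g p.2 * kernel 0 (p.2 - p.1) 0 with hH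
  have hsymm : ∀ p, conj (H p) = H p.swap := fun p => by
    simp only [hH, map_mul, Complex.conj_conj, conj_kernel_zero, neg_sub, Prod.fst_swap,
      Prod.snd_swap]
    ring
  have hi := integrable_indicator_wedge a hg
  have e1 : ∫ t, conj (g t) * volterra a g t = ∫ p, (wedge a).indicator H p := by
    simp_rw [conj_mul_volterra_eq]
    rw [Measure.volume_eq_prod] at hi ⊢
    exact (integral_prod _ hi).symm
  let G : ℝ × ℝ → ℂ := fun p => (wedge a).indicator (fun z => H z.swap) p.swap
  have e2 : conj (∫ p, (wedge a).indicator H p) = ∫ p, G p := by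
    rw [← integral_conj, Measure.volume_eq_prod]
    simp only [G]
    rw [integral_prod_swap (f := (wedge a).indicator fun z => H z.swap)]
    refine integral_congr_ae (Eventually.of_forall fun p => ?_)
    simp only [Set.indicator]
    split_ifs
    · exact hsymm p
    · simp
  have hGi : Integrable G := by
    have h1 : Integrable (fun p => conj ((wedge a).indicator H p)) :=
      (Complex.conjLIE.toContinuousLinearEquiv.integrable_comp_iff).2 hi
    rw [Measure.volume_eq_prod] at h1 ⊢
    refine h1.swap.congr (Eventually.of_forall fun p => ?_)
    simp only [Function.comp_apply, G, Set.indicator]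
    split_ifs
    · exact hsymm _
    · simp
  have hg₁ : MemLp ((Set.Ioi a).indicator g) (4 / 3) volume := hg.indicator measurableSet_Ioi
  have hg₂ : MemLp ((Set.Iic a).indicator g) (4 / 3) volume := hg.indicator measurableSet_Iic
  -- Off the diagonal, the wedge and its reflection tile the two quadrants `{t, s > a}` and `{t, s ≤
  -- a}`. Since `H` is Hermitian, adding the conjugate completes the causal form to a full form in
  -- each quadrant; on the diagonal the kernel is `0` by convention.
  have hsum : ∀ p, (wedge a).indicator H p + G p
      = conj ((Set.Ioi a).indicator g p.1) * (Set.Ioi a).indicator g p.2 * kernel 0 (p.2 - p.1) 0 +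
        conj ((Set.Iic a).indicator g p.1) * (Set.Iic a).indicator g p.2 *
          kernel 0 (p.2 - p.1) 0 := by
    rintro ⟨t, s⟩
    rcases eq_or_ne t s with rfl | hts
    · simp [G, H, Set.indicator, kernel_zero_zero]
    · simp only [G, H, Set.indicator, wedge, Set.mem_ofPred_eq, Set.mem_uIoc, Prod.fst_swap,
        Prod.snd_swap, Set.mem_Ioi, Set.mem_Iic]
      split_ifs <;> first
        | (simp; done)
        | (exfalso; grind)
  have hre : 2 * (∫ p, (wedge a).indicator H p).re
      = (∫ p : ℝ × ℝ, conj ((Set.Ioi a).indicator g p.1) * (Set.Ioi a).indicator g p.2 *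
          kernel 0 (p.2 - p.1) 0).re +
        (∫ p : ℝ × ℝ, conj ((Set.Iic a).indicator g p.1) * (Set.Iic a).indicator g p.2 *
          kernel 0 (p.2 - p.1) 0).re := by
    rw [← Complex.add_re, ← integral_add (integrable_prod_kernel hg₁) (integrable_prod_kernel hg₂),
      ← integral_congr_ae (Eventually.of_forall hsum), integral_add hi hGi, ← e2, Complex.add_re,
      Complex.conj_re, two_mul]
  have h₁ := re_integral_prod_kernel_nonneg hg₁ (hgi.indicator measurableSet_Ioi)
  have h₂ := re_integral_prod_kernel_nonneg hg₂ (hgi.indicator measurableSet_Iic)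
  rw [e1]
  linarith

/-! ### The cubic nonlinearity -/

/-- The nonlinearity `|z|²z`. -/
def cubic (z : ℂ) : ℂ := (‖z‖ ^ 2 : ℝ) * z

theorem continuous_cubic : Continuous cubic := by
  unfold cubic
  fun_prop

theorem cubic_zero : cubic 0 = 0 := by simp [cubic]

/-- The right side exceeds the left by exactly `½(|z|²-|w|²)²`. -/
theorem half_mul_le_re_conj_cubic_sub_mul (z w : ℂ) :
    1 / 2 * (‖z - w‖ ^ 2 * (‖z‖ ^ 2 + ‖w‖ ^ 2)) ≤ (conj (cubic z - cubic w) * (z - w)).re := by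
  simp only [cubic, Complex.sq_norm, Complex.normSq_apply]
  simp only [map_sub, map_mul, Complex.conj_ofReal, Complex.mul_re, Complex.sub_re, Complex.sub_im,
    Complex.ofReal_re, Complex.ofReal_im, Complex.conj_re, Complex.conj_im, Complex.mul_im]
  nlinarith [sq_nonneg (z.re * z.re + z.im * z.im - (w.re * w.re + w.im * w.im))]

theorem norm_cubic_sub_le (z w : ℂ) :
    ‖cubic z - cubic w‖ ≤ 3 / 2 * (‖z - w‖ * (‖z‖ ^ 2 + ‖w‖ ^ 2)) := by
  have e : cubic z - cubic w = ((1 / 2 * (‖z‖ ^ 2 + ‖w‖ ^ 2) : ℝ) : ℂ) * (z - w) +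
      ((1 / 2 * (‖z‖ ^ 2 - ‖w‖ ^ 2) : ℝ) : ℂ) * (z + w) := by
    simp only [cubic]
    push_cast
    ring
  have h1 : ‖cubic z - cubic w‖ ≤ 1 / 2 * (‖z‖ ^ 2 + ‖w‖ ^ 2) * ‖z - w‖ +
      1 / 2 * |‖z‖ ^ 2 - ‖w‖ ^ 2| * ‖z + w‖ := by
    rw [e]
    refine (norm_add_le _ _).trans (le_of_eq ?_)
    rw [norm_mul, norm_mul, Complex.norm_real, Complex.norm_real, Real.norm_eq_abs,
      Real.norm_eq_abs, abs_mul, abs_mul, abs_of_nonneg (by norm_num : (0 : ℝ) ≤ 1 / 2),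
      abs_of_nonneg (by positivity : 0 ≤ ‖z‖ ^ 2 + ‖w‖ ^ 2)]
  have h2 : |‖z‖ ^ 2 - ‖w‖ ^ 2| ≤ ‖z - w‖ * (‖z‖ + ‖w‖) := by
    rw [sq_sub_sq, abs_mul, abs_of_nonneg (by positivity : 0 ≤ ‖z‖ + ‖w‖), mul_comm]
    gcongr
    exact abs_norm_sub_norm_le z w
  have h3 := norm_add_le z w
  have h4 : |‖z‖ ^ 2 - ‖w‖ ^ 2| * ‖z + w‖ ≤ ‖z - w‖ * (‖z‖ + ‖w‖) * (‖z‖ + ‖w‖) := by gcongr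
  nlinarith [mul_nonneg (norm_nonneg (z - w)) (sq_nonneg (‖z‖ - ‖w‖))]

/-! ### Hölder's inequality for the exponents `4`, `2` and `4/3`. -/

instance holderTriple_four_four_two : ENNReal.HolderTriple 4 4 2 := ⟨by
  rw [← ENNReal.toReal_eq_toReal_iff' (by simp) (by simp), ENNReal.toReal_add (by simp) (by simp)]
  simp only [ENNReal.toReal_inv, ENNReal.toReal_ofNat]
  norm_num⟩

instance holderTriple_two_four : ENNReal.HolderTriple 2 4 (4 / 3) := ⟨by
  rw [← ENNReal.toReal_eq_toReal_iff' (by simp) (by simp), ENNReal.toReal_add (by simp) (by simp)]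
  simp only [ENNReal.toReal_inv, ENNReal.toReal_ofNat, ENNReal.toReal_div]
  norm_num⟩

instance holderTriple_four_thirds_four : ENNReal.HolderTriple (4 / 3) 4 1 := ⟨by
  rw [← ENNReal.toReal_eq_toReal_iff' (by simp) (by simp), ENNReal.toReal_add (by simp) (by simp)]
  simp only [ENNReal.toReal_inv, ENNReal.toReal_ofNat, ENNReal.toReal_div, ENNReal.toReal_one]
  norm_num⟩

/-- Hölder's inequality for a product of three functions in `L⁴`. -/
theorem eLpNorm_mul_mul_le {μ : Measure ℝ} {u v w : ℝ → ℝ} (hu : AEStronglyMeasurable u μ)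
    (hv : AEStronglyMeasurable v μ) (hw : AEStronglyMeasurable w μ) :
    eLpNorm (fun t => u t * v t * w t) (4 / 3) μ
      ≤ eLpNorm u 4 μ * eLpNorm v 4 μ * eLpNorm w 4 μ := by
  have h1 := eLpNorm_smul_le_mul_eLpNorm (p := 2) (q := 4) (r := 4 / 3) hw (hu.mul hv)
  have h2 := eLpNorm_smul_le_mul_eLpNorm (p := 4) (q := 4) (r := 2) hv hu
  exact h1.trans (by gcongr; exact h2)

theorem eLpNorm_cubic_sub_le {μ : Measure ℝ} {q₁ q₂ : ℝ → ℂ} (h₁ : AEStronglyMeasurable q₁ μ)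
    (h₂ : AEStronglyMeasurable q₂ μ) :
    eLpNorm (fun t => cubic (q₁ t) - cubic (q₂ t)) (4 / 3) μ
      ≤ 3 / 2 * eLpNorm (q₁ - q₂) 4 μ * (eLpNorm q₁ 4 μ + eLpNorm q₂ 4 μ) ^ 2 := by
  have hS : eLpNorm (fun t => ‖q₁ t‖ + ‖q₂ t‖) 4 μ ≤ eLpNorm q₁ 4 μ + eLpNorm q₂ 4 μ := by
    have := eLpNorm_add_le h₁.norm h₂.norm (p := 4) (by norm_num)
    rwa [eLpNorm_norm, eLpNorm_norm] at this
  have h3 := eLpNorm_mul_mul_le (h₁.sub h₂).norm (h₁.norm.add h₂.norm) (h₁.norm.add h₂.norm)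
  calc _ ≤ ENNReal.ofReal (3 / 2) * eLpNorm (fun t => ‖(q₁ - q₂) t‖ * (‖q₁ t‖ + ‖q₂ t‖) *
        (‖q₁ t‖ + ‖q₂ t‖)) (4 / 3) μ := by
        refine eLpNorm_le_mul_eLpNorm_of_ae_le_mul (Eventually.of_forall fun t => ?_) _
        refine (norm_cubic_sub_le _ _).trans ?_
        rw [Real.norm_of_nonneg (by positivity), Pi.sub_apply]
        nlinarith [mul_nonneg (norm_nonneg (q₁ t - q₂ t))
          (mul_nonneg (norm_nonneg (q₁ t)) (norm_nonneg (q₂ t)))]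
    _ ≤ ENNReal.ofReal (3 / 2) * (eLpNorm (q₁ - q₂) 4 μ * (eLpNorm q₁ 4 μ + eLpNorm q₂ 4 μ) *
        (eLpNorm q₁ 4 μ + eLpNorm q₂ 4 μ)) := by
        gcongr
        refine h3.trans ?_
        rw [eLpNorm_norm]
        gcongr <;> exact hS
    _ = _ := by
        rw [ENNReal.ofReal_div_of_pos (by norm_num)]
        simp only [ENNReal.ofReal_ofNat]
        ring

theorem memLp_cubic {μ : Measure ℝ} {q : ℝ → ℂ} (h : MemLp q 4 μ) :
    MemLp (fun t => cubic (q t)) (4 / 3) μ := by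
  refine ⟨continuous_cubic.comp_aestronglyMeasurable h.1, ?_⟩
  have := eLpNorm_cubic_sub_le h.1 (aestronglyMeasurable_const (b := (0 : ℂ)))
  simp only [cubic_zero, sub_zero] at this
  refine this.trans_lt ?_
  have h0 : eLpNorm (q - fun _ => (0 : ℂ)) 4 μ < ∞ := (h.sub (MemLp.zero (p := 4))).2
  have h1 : eLpNorm (fun _ : ℝ => (0 : ℂ)) 4 μ < ∞ := (MemLp.zero (p := 4)).2
  exact ENNReal.mul_lt_top (ENNReal.mul_lt_top (ENNReal.div_lt_top (by simp) (by simp)) h0)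
    (ENNReal.pow_lt_top (ENNReal.add_lt_top.2 ⟨h.2, h1⟩))

/-! ### The monotone estimate -/

/-- `q` vanishes outside `A` and solves `q = f - i ∫_a^t E₀(t - s, 0) |q|²q ds` in `A`. -/
structure VolterraSol (a : ℝ) (A : Set ℝ) (f q : ℝ → ℂ) : Prop where
  memLp : MemLp q 4 volume
  eq_zero : ∀ t ∉ A, q t = 0
  ae_eq : ∀ᵐ t, t ∈ A → q t = f t - volterra a (fun s => cubic (q s)) t

theorem volterra_zero (a : ℝ) (t : ℝ) : volterra a (fun _ => 0) t = 0 := by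
  simp [volterra, forcedVal]

theorem volterraSol_zero (a : ℝ) (A : Set ℝ) : VolterraSol a A (fun _ => 0) (fun _ => 0) :=
  ⟨MemLp.zero, fun _ _ => rfl, Eventually.of_forall fun t _ => by
    simp [cubic_zero, volterra_zero]⟩

theorem eLpNorm_two_sq {μ : Measure ℝ} {f : ℝ → ℝ} (hf : MemLp f 2 μ) :
    eLpNorm f 2 μ ^ 2 = ENNReal.ofReal (∫ t, f t ^ 2 ∂μ) := by
  rw [ofReal_integral_eq_lintegral_ofReal hf.integrable_sq
    (Eventually.of_forall fun t => sq_nonneg _),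
    eLpNorm_eq_lintegral_rpow_enorm_toReal (by simp) (by simp), ← ENNReal.rpow_natCast,
    ← ENNReal.rpow_mul]
  simp only [ENNReal.toReal_ofNat, Nat.cast_ofNat]
  norm_num
  refine lintegral_congr fun t => ?_
  rw [← ofReal_norm, ← ENNReal.ofReal_pow (norm_nonneg _), Real.norm_eq_abs, sq_abs]

/-- The weight `(|z|² + |w|²)^{1/2}`. -/
def weight (z w : ℂ) : ℝ := √(‖z‖ ^ 2 + ‖w‖ ^ 2)

theorem weight_sq (z w : ℂ) : weight z w ^ 2 = ‖z‖ ^ 2 + ‖w‖ ^ 2 := Real.sq_sqrt (by positivity)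

theorem weight_nonneg (z w : ℂ) : 0 ≤ weight z w := Real.sqrt_nonneg _

theorem weight_le (z w : ℂ) : weight z w ≤ ‖z‖ + ‖w‖ := by
  refine Real.sqrt_le_iff.2 ⟨by positivity, ?_⟩
  nlinarith [mul_nonneg (norm_nonneg z) (norm_nonneg w)]

theorem aestronglyMeasurable_weight {μ : Measure ℝ} {q₁ q₂ : ℝ → ℂ}
    (h₁ : AEStronglyMeasurable q₁ μ) (h₂ : AEStronglyMeasurable q₂ μ) :
    AEStronglyMeasurable (fun t => weight (q₁ t) (q₂ t)) μ :=
  Real.continuous_sqrt.comp_aestronglyMeasurable ((h₁.norm.pow 2).add (h₂.norm.pow 2))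

theorem eLpNorm_weight_le {μ : Measure ℝ} {q₁ q₂ : ℝ → ℂ}
    (h₁ : AEStronglyMeasurable q₁ μ) (h₂ : AEStronglyMeasurable q₂ μ) :
    eLpNorm (fun t => weight (q₁ t) (q₂ t)) 4 μ ≤ eLpNorm q₁ 4 μ + eLpNorm q₂ 4 μ := by
  have h := eLpNorm_add_le h₁.norm h₂.norm (p := 4) (by norm_num)
  rw [eLpNorm_norm, eLpNorm_norm] at h
  refine le_trans (eLpNorm_mono fun t => ?_) h
  rw [Real.norm_of_nonneg (weight_nonneg _ _)]
  exact (weight_le _ _).trans (Real.le_norm_self _)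

theorem memLp_weight {μ : Measure ℝ} {q₁ q₂ : ℝ → ℂ} (h₁ : MemLp q₁ 4 μ) (h₂ : MemLp q₂ 4 μ) :
    MemLp (fun t => weight (q₁ t) (q₂ t)) 4 μ :=
  ⟨aestronglyMeasurable_weight h₁.1 h₂.1,
    (eLpNorm_weight_le h₁.1 h₂.1).trans_lt (ENNReal.add_lt_top.2 ⟨h₁.2, h₂.2⟩)⟩

theorem integrable_of_eq_zero {A : Set ℝ} (hA : volume A ≠ ∞) {g : ℝ → ℂ}
    (hg : MemLp g (4 / 3) volume) (h0 : ∀ t ∉ A, g t = 0) : Integrable g := by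
  have : IsFiniteMeasure (volume.restrict A) := ⟨by simpa using hA.lt_top⟩
  have h1 : IntegrableOn g A := (hg.restrict A).integrable one_le_four_thirds
  exact (integrableOn_iff_integrable_of_support_subset fun t ht => by
    by_contra hc
    exact ht (h0 t hc)).1 h1

/-- The difference of the two equations is paired with `g = |q₁|²q₁ - |q₂|²q₂`. The Volterra term
has a favourable sign and is dropped, monotonicity of the cubic bounds the left side below by half
the weighted square, and the data term is split by Young's inequality. Finite measure of `A` puts
`g` in `L¹`, as the positivity lemma demands. -/
theorem integral_mul_weight_le {a : ℝ} {A : Set ℝ} (hA : volume A ≠ ∞) {f₁ f₂ q₁ q₂ : ℝ → ℂ}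
    (hf₁ : MemLp f₁ 4 volume) (hf₂ : MemLp f₂ 4 volume) (h₁ : VolterraSol a A f₁ q₁)
    (h₂ : VolterraSol a A f₂ q₂) :
    ∫ t, (‖q₁ t - q₂ t‖ * weight (q₁ t) (q₂ t)) ^ 2
      ≤ 9 * ∫ t, (‖f₁ t - f₂ t‖ * weight (q₁ t) (q₂ t)) ^ 2 := by
  have hc₁ := memLp_cubic h₁.memLp
  have hc₂ := memLp_cubic h₂.memLp
  set g : ℝ → ℂ := (fun t => cubic (q₁ t)) - fun t => cubic (q₂ t) with hg
  have hgm : MemLp g (4 / 3) volume := hc₁.sub hc₂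
  have hg0 : ∀ t ∉ A, g t = 0 := fun t ht => by
    simp [hg, h₁.eq_zero t ht, h₂.eq_zero t ht]
  have hW := memLp_weight h₁.memLp h₂.memLp
  have hw : MemLp (fun t => ‖q₁ t - q₂ t‖ * weight (q₁ t) (q₂ t)) 2 volume :=
    hW.mul (h₁.memLp.sub h₂.memLp).norm
  have hF : MemLp (fun t => ‖f₁ t - f₂ t‖ * weight (q₁ t) (q₂ t)) 2 volume :=
    hW.mul (hf₁.sub hf₂).norm
  have hgc : MemLp (fun t => conj (g t)) (4 / 3) volume := hgm.star
  have hi1 : Integrable fun t => conj (g t) * (q₁ t - q₂ t) :=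
    memLp_one_iff_integrable.1 ((h₁.memLp.sub h₂.memLp).mul hgc)
  have hi2 : Integrable fun t => conj (g t) * (f₁ t - f₂ t) :=
    memLp_one_iff_integrable.1 ((hf₁.sub hf₂).mul hgc)
  have hi3 := integrable_conj_mul_volterra a hgm
  have heq : ∀ᵐ t, conj (g t) * (q₁ t - q₂ t)
      = conj (g t) * (f₁ t - f₂ t) - conj (g t) * volterra a g t := by
    filter_upwards [h₁.ae_eq, h₂.ae_eq, ae_rieszPot_lt_top hc₁, ae_rieszPot_lt_top hc₂]
      with t e1 e2 r1 r2
    by_cases ht : t ∈ A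
    · rw [volterra_sub a t hc₁.1 hc₂.1 r1 r2, ← mul_sub]
      congr 1
      linear_combination e1 ht - e2 ht
    · simp [hg0 t ht]
  have hpos := re_integral_conj_mul_volterra_nonneg a hgm (integrable_of_eq_zero hA hgm hg0)
  have hre : (∫ t, conj (g t) * (q₁ t - q₂ t)).re ≤ ∫ t, (conj (g t) * (f₁ t - f₂ t)).re := by
    rw [integral_congr_ae heq, integral_sub hi2 hi3, Complex.sub_re]
    have := integral_re hi2
    simp only [RCLike.re_eq_complex_re] at this
    rw [this]
    linarith
  have hlow : 1 / 2 * ∫ t, (‖q₁ t - q₂ t‖ * weight (q₁ t) (q₂ t)) ^ 2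
      ≤ (∫ t, conj (g t) * (q₁ t - q₂ t)).re := by
    have := integral_re hi1
    simp only [RCLike.re_eq_complex_re] at this
    rw [← this, ← integral_const_mul]
    refine integral_mono (hw.integrable_sq.const_mul _) hi1.re fun t => ?_
    simp only [mul_pow, weight_sq]
    exact half_mul_le_re_conj_cubic_sub_mul _ _
  have hup : ∫ t, (conj (g t) * (f₁ t - f₂ t)).re
      ≤ ∫ t, (1 / 4 * (‖q₁ t - q₂ t‖ * weight (q₁ t) (q₂ t)) ^ 2 +
        9 / 4 * (‖f₁ t - f₂ t‖ * weight (q₁ t) (q₂ t)) ^ 2) := by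
    refine integral_mono hi2.re ((hw.integrable_sq.const_mul _).add (hF.integrable_sq.const_mul _))
      fun t => ?_
    have h1 : (conj (g t) * (f₁ t - f₂ t)).re ≤ ‖g t‖ * ‖f₁ t - f₂ t‖ := by
      refine (Complex.re_le_norm _).trans (le_of_eq ?_)
      rw [norm_mul, RCLike.norm_conj]
    have h2 : ‖g t‖ ≤ 3 / 2 * (‖q₁ t - q₂ t‖ * weight (q₁ t) (q₂ t) ^ 2) := by
      rw [weight_sq]
      exact norm_cubic_sub_le _ _
    have h3 := mul_le_mul_of_nonneg_right h2 (norm_nonneg (f₁ t - f₂ t))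
    refine (h1.trans h3).trans ?_
    -- Young's inequality `(3/2)xy ≤ x²/4 + (9/4)y²`: half of the lower bound is absorbed, leaving
    -- the constant `9`.
    nlinarith [sq_nonneg (‖q₁ t - q₂ t‖ * weight (q₁ t) (q₂ t)
      - 3 * (‖f₁ t - f₂ t‖ * weight (q₁ t) (q₂ t)))]
  rw [integral_add (hw.integrable_sq.const_mul _) (hF.integrable_sq.const_mul _),
    integral_const_mul, integral_const_mul] at hup
  linarith

theorem eLpNorm_mul_weight_le {a : ℝ} {A : Set ℝ} (hA : volume A ≠ ∞) {f₁ f₂ q₁ q₂ : ℝ → ℂ}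
    (hf₁ : MemLp f₁ 4 volume) (hf₂ : MemLp f₂ 4 volume) (h₁ : VolterraSol a A f₁ q₁)
    (h₂ : VolterraSol a A f₂ q₂) :
    eLpNorm (fun t => ‖q₁ t - q₂ t‖ * weight (q₁ t) (q₂ t)) 2 volume
      ≤ 3 * eLpNorm (f₁ - f₂) 4 volume * eLpNorm (fun t => weight (q₁ t) (q₂ t)) 4 volume := by
  have hW := memLp_weight h₁.memLp h₂.memLp
  have hw : MemLp (fun t => ‖q₁ t - q₂ t‖ * weight (q₁ t) (q₂ t)) 2 volume :=
    hW.mul (h₁.memLp.sub h₂.memLp).norm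
  have hF : MemLp (fun t => ‖f₁ t - f₂ t‖ * weight (q₁ t) (q₂ t)) 2 volume :=
    hW.mul (hf₁.sub hf₂).norm
  have h : eLpNorm (fun t => ‖q₁ t - q₂ t‖ * weight (q₁ t) (q₂ t)) 2 volume
      ≤ 3 * eLpNorm (fun t => ‖f₁ t - f₂ t‖ * weight (q₁ t) (q₂ t)) 2 volume := by
    rw [← ENNReal.pow_le_pow_left_iff two_ne_zero, mul_pow, eLpNorm_two_sq hw, eLpNorm_two_sq hF]
    have e : (3 : ℝ≥0∞) ^ 2 = ENNReal.ofReal 9 := by norm_num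
    rw [e, ← ENNReal.ofReal_mul (by norm_num)]
    exact ENNReal.ofReal_le_ofReal (integral_mul_weight_le hA hf₁ hf₂ h₁ h₂)
  refine h.trans ?_
  rw [mul_assoc]
  gcongr
  have := eLpNorm_smul_le_mul_eLpNorm (p := 4) (q := 4) (r := 2) hW.1 (hf₁.sub hf₂).1.norm
  rw [eLpNorm_norm] at this
  exact this

/-- Comparison with the zero solution: the weight becomes `|q|`, so `‖q‖² ≤ 3‖f‖‖q‖` in `L⁴`, and
one factor cancels because it is finite. The constant does not see the length of `A`, which makes
the bound global. -/
theorem VolterraSol.eLpNorm_le {a : ℝ} {A : Set ℝ} (hA : volume A ≠ ∞) {f q : ℝ → ℂ}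
    (hf : MemLp f 4 volume) (h : VolterraSol a A f q) :
    eLpNorm q 4 volume ≤ 3 * eLpNorm f 4 volume := by
  have h1 := eLpNorm_mul_weight_le hA hf MemLp.zero h (volterraSol_zero a A)
  have hw : ∀ t, weight (q t) 0 = ‖q t‖ := fun t => by simp [weight]
  simp only [hw, sub_zero] at h1
  have e1 : eLpNorm (fun t => ‖q t‖ * ‖q t‖) 2 volume = eLpNorm q 4 volume ^ 2 := by
    have hi : Function.Injective fun x : ℝ≥0∞ => x ^ 2 :=
      (ENNReal.pow_right_strictMono two_ne_zero).injective
    refine hi ?_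
    simp only
    rw [← pow_mul, eLpNorm_four,
      eLpNorm_eq_lintegral_rpow_enorm_toReal (by simp) (by simp), ← ENNReal.rpow_natCast,
      ← ENNReal.rpow_mul]
    simp only [ENNReal.toReal_ofNat, Nat.cast_ofNat]
    norm_num
    refine lintegral_congr fun t => ?_
    ring
  rw [e1, eLpNorm_norm, sq] at h1
  rcases eq_or_ne (eLpNorm q 4 volume) 0 with h0 | h0
  · rw [h0]; exact zero_le
  · exact (ENNReal.mul_le_mul_iff_left h0 h.memLp.2.ne).1 h1

/-- The nonlinearity depends on the data in a Lipschitz way. -/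
theorem VolterraSol.eLpNorm_cubic_sub_le {a : ℝ} {A : Set ℝ} (hA : volume A ≠ ∞)
    {f₁ f₂ q₁ q₂ : ℝ → ℂ} (hf₁ : MemLp f₁ 4 volume) (hf₂ : MemLp f₂ 4 volume)
    (h₁ : VolterraSol a A f₁ q₁) (h₂ : VolterraSol a A f₂ q₂) :
    eLpNorm (fun t => cubic (q₁ t) - cubic (q₂ t)) (4 / 3) volume
      ≤ 45 * eLpNorm (f₁ - f₂) 4 volume * (eLpNorm f₁ 4 volume + eLpNorm f₂ 4 volume) ^ 2 := by
  have hW := memLp_weight h₁.memLp h₂.memLp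
  have hw : MemLp (fun t => ‖q₁ t - q₂ t‖ * weight (q₁ t) (q₂ t)) 2 volume :=
    hW.mul (h₁.memLp.sub h₂.memLp).norm
  have hWle : eLpNorm (fun t => weight (q₁ t) (q₂ t)) 4 volume
      ≤ 3 * (eLpNorm f₁ 4 volume + eLpNorm f₂ 4 volume) := by
    rw [mul_add]
    exact (eLpNorm_weight_le h₁.memLp.1 h₂.memLp.1).trans
      (add_le_add (h₁.eLpNorm_le hA hf₁) (h₂.eLpNorm_le hA hf₂))
  have hX := (eLpNorm_mul_weight_le hA hf₁ hf₂ h₁ h₂).trans (mul_le_mul_right hWle _)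
  have hH := eLpNorm_smul_le_mul_eLpNorm (p := 2) (q := 4) (r := 4 / 3) hW.1 hw.1
  have hle : eLpNorm (fun t => cubic (q₁ t) - cubic (q₂ t)) (4 / 3) volume
      ≤ ENNReal.ofReal (3 / 2) * eLpNorm ((fun t => ‖q₁ t - q₂ t‖ * weight (q₁ t) (q₂ t)) •
        fun t => weight (q₁ t) (q₂ t)) (4 / 3) volume := by
    refine eLpNorm_le_mul_eLpNorm_of_ae_le_mul (Eventually.of_forall fun t => ?_) _
    refine (norm_cubic_sub_le _ _).trans (le_of_eq ?_)
    have := weight_nonneg (q₁ t) (q₂ t)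
    rw [Pi.smul_apply', smul_eq_mul, Real.norm_of_nonneg (by positivity), ← weight_sq]
    ring
  refine hle.trans ((mul_le_mul_right (hH.trans (mul_le_mul' hX hWle)) _).trans ?_)
  generalize eLpNorm (f₁ - f₂) 4 volume = x
  generalize eLpNorm f₁ 4 volume + eLpNorm f₂ 4 volume = y
  -- One factor `3` comes from the weighted estimate and one from each of the two `L⁴` norms of the
  -- weight; `(3/2)·27 = 40.5` is rounded up to `45`.
  calc _ = (ENNReal.ofReal (3 / 2) * 27) * x * y ^ 2 := by ring
    _ ≤ _ := by
        gcongr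
        have e : (27 : ℝ≥0∞) = ENNReal.ofReal 27 := by simp
        rw [e, ← ENNReal.ofReal_mul (by norm_num)]
        exact ENNReal.ofReal_le_of_le_toReal (by norm_num)

/-- Equal data force equal cubic terms almost everywhere; the Volterra equation then forces the
solutions themselves to agree. -/
theorem VolterraSol.ae_eq_of_eq {a : ℝ} {A : Set ℝ} (hA : volume A ≠ ∞) {f q₁ q₂ : ℝ → ℂ}
    (hf : MemLp f 4 volume) (h₁ : VolterraSol a A f q₁) (h₂ : VolterraSol a A f q₂) :
    q₁ =ᵐ[volume] q₂ := by
  have h := VolterraSol.eLpNorm_cubic_sub_le hA hf hf h₁ h₂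
  have hm : AEStronglyMeasurable (fun t => cubic (q₁ t) - cubic (q₂ t)) volume :=
    ((memLp_cubic h₁.memLp).sub (memLp_cubic h₂.memLp)).1
  rw [sub_self, eLpNorm_zero, mul_zero, zero_mul, nonpos_iff_eq_zero, eLpNorm_eq_zero_iff
    hm (by simp)] at h
  filter_upwards [h₁.ae_eq, h₂.ae_eq] with t e1 e2
  by_cases ht : t ∈ A
  · rw [e1 ht, e2 ht]
    congr 1
    refine volterra_congr (h.mono fun s hs _ => ?_)
    exact sub_eq_zero.1 hs
  · rw [h₁.eq_zero t ht, h₂.eq_zero t ht]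

/-! ### Solving the Volterra equation -/

theorem volterra_eq_zero {a t : ℝ} {g : ℝ → ℂ} (h : ∀ᵐ s, s ∈ Set.uIoc a t → g s = 0) :
    volterra a g t = 0 := by
  rw [← volterra_zero a t]
  exact volterra_congr h

/-- Contraction in the `L⁴` ball of radius `1/16`. The Lipschitz constant is at most `30·(1/8)² <
1/2`, with `30 = 20·(3/2)` from the Volterra and cubic bounds, and `(1/2)(1/16) + 1/32 = 1/16` keeps
the ball invariant. Smallness is required on `B` only, so a restart can be made on a short shell. -/
theorem exists_volterraSol_of_small (a : ℝ) {B : Set ℝ} (hB : MeasurableSet B) {F : ℝ → ℂ}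
    (hF : MemLp F 4 volume)
    (hsmall : eLpNorm F 4 (volume.restrict B) ≤ ((1 / 32 : NNReal) : ℝ≥0∞)) :
    ∃ r, VolterraSol a B F r := by
  have : Fact ((1 : ℝ≥0∞) ≤ 4) := ⟨by norm_num⟩
  let G : Lp ℂ 4 (volume : Measure ℝ) → ℝ → ℂ := fun r t =>
    F t - volterra a (fun s => cubic (r s)) t
  have hG : ∀ r, MemLp (B.indicator (G r)) 4 volume := fun r =>
    (hF.sub (memLp_volterra a (memLp_cubic (Lp.memLp r)))).indicator hB
  let Ψ : Lp ℂ 4 (volume : Measure ℝ) → Lp ℂ 4 (volume : Measure ℝ) := fun r =>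
    (hG r).toLp _
  have hΨ : ∀ r₁ r₂, edist (Ψ r₁) (Ψ r₂) ≤ 30 * edist r₁ r₂ * (‖r₁‖ₑ + ‖r₂‖ₑ) ^ 2 := by
    intro r₁ r₂
    have hc₁ := memLp_cubic (Lp.memLp r₁)
    have hc₂ := memLp_cubic (Lp.memLp r₂)
    have h1 : edist (Ψ r₁) (Ψ r₂)
        ≤ eLpNorm (volterra a ((fun s => cubic (r₁ s)) - fun s => cubic (r₂ s))) 4 volume := by
      rw [Lp.edist_toLp_toLp, ← Set.indicator_sub']
      refine (eLpNorm_indicator_le _).trans (le_of_eq (eLpNorm_congr_norm_ae ?_))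
      filter_upwards [ae_rieszPot_lt_top hc₁, ae_rieszPot_lt_top hc₂] with t t1 t2
      rw [volterra_sub a t hc₁.1 hc₂.1 t1 t2, Pi.sub_apply, sub_sub_sub_cancel_left, norm_sub_rev]
    have h2 := eLpNorm_volterra_le a (hc₁.sub hc₂).1
    have h3 := eLpNorm_cubic_sub_le (μ := volume) (Lp.memLp r₁).1 (Lp.memLp r₂).1
    rw [Lp.edist_def r₁ r₂, enorm_Lp_eq, enorm_Lp_eq]
    refine (h1.trans h2).trans ((mul_le_mul_right h3 _).trans (le_of_eq ?_))
    have e : (20 : ℝ≥0∞) * (3 / 2) = 30 := by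
      symm
      rw [← mul_div_assoc, ENNReal.eq_div_iff (by simp) (by simp)]
      norm_num
    rw [← e]
    ring
  have hΨ0 : edist (Ψ 0) 0 ≤ ((1 / 32 : NNReal) : ℝ≥0∞) := by
    refine le_trans (le_of_eq ?_) hsmall
    rw [edist_zero_right, ← ofReal_norm, Lp.norm_toLp, ENNReal.ofReal_toReal (hG 0).2.ne,
      eLpNorm_indicator_eq_eLpNorm_restrict hB]
    congr 1
    ext t
    simp only [G]
    rw [volterra_eq_zero, sub_zero]
    filter_upwards [Lp.coeFn_zero ℂ 4 (volume : Measure ℝ)] with s hs _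
    rw [hs, Pi.zero_apply, cubic_zero]
  let S : Set (Lp ℂ 4 (volume : Measure ℝ)) := {r | ‖r‖ₑ ≤ ((1 / 16 : NNReal) : ℝ≥0∞)}
  have hS : IsComplete S := (isClosed_le continuous_enorm continuous_const).isComplete
  have hnum : 30 * (((1 / 16 : NNReal) : ℝ≥0∞) + ((1 / 16 : NNReal) : ℝ≥0∞)) ^ 2
      ≤ ((1 / 2 : NNReal) : ℝ≥0∞) := by
    have : 30 * ((1 / 16 : NNReal) + (1 / 16 : NNReal)) ^ 2 ≤ (1 / 2 : NNReal) := by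
      rw [← NNReal.coe_le_coe]
      push_cast
      norm_num
    exact_mod_cast this
  have hhalf : ∀ r₁ ∈ S, ∀ r₂ ∈ S, edist (Ψ r₁) (Ψ r₂) ≤ ((1 / 2 : NNReal) : ℝ≥0∞) * edist r₁ r₂ := by
    intro r₁ h₁ r₂ h₂
    calc _ ≤ _ := hΨ r₁ r₂
      _ ≤ 30 * edist r₁ r₂ * (((1 / 16 : NNReal) : ℝ≥0∞) + ((1 / 16 : NNReal) : ℝ≥0∞)) ^ 2 := by
        gcongr
        · exact h₁
        · exact h₂
      _ = (30 * (((1 / 16 : NNReal) : ℝ≥0∞) + ((1 / 16 : NNReal) : ℝ≥0∞)) ^ 2) * edist r₁ r₂ := by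
        ring
      _ ≤ _ := by gcongr
  have h0S : (0 : Lp ℂ 4 (volume : Measure ℝ)) ∈ S := by simp [S]
  have hmaps : Set.MapsTo Ψ S S := by
    intro r hr
    have hr' : ‖r‖ₑ ≤ ((1 / 16 : NNReal) : ℝ≥0∞) := hr
    change ‖Ψ r‖ₑ ≤ _
    rw [← edist_zero_right]
    calc edist (Ψ r) 0 ≤ edist (Ψ r) (Ψ 0) + edist (Ψ 0) 0 := edist_triangle _ _ _
      _ ≤ ((1 / 2 : NNReal) : ℝ≥0∞) * ((1 / 16 : NNReal) : ℝ≥0∞) + ((1 / 32 : NNReal) : ℝ≥0∞) := by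
        refine add_le_add ((hhalf r hr 0 h0S).trans ?_) hΨ0
        rw [edist_zero_right]
        gcongr
      _ ≤ _ := by
        have : (1 / 2 : NNReal) * (1 / 16 : NNReal) + (1 / 32 : NNReal) ≤ (1 / 16 : NNReal) := by
          rw [← NNReal.coe_le_coe]
          push_cast
          norm_num
        exact_mod_cast this
  have hcontr : ContractingWith (1 / 2) (hmaps.restrict Ψ S S) :=
    ⟨by rw [← NNReal.coe_lt_coe]; push_cast; norm_num, fun x y => hhalf x x.2 y y.2⟩
  obtain ⟨r, -, hfix, -⟩ := hcontr.exists_fixedPoint' hS hmaps h0S (edist_ne_top _ _)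
  have hr : (r : ℝ → ℂ) =ᵐ[volume] B.indicator (G r) := by
    have h1 := (hG r).coeFn_toLp
    have h2 : (hG r).toLp _ = r := hfix
    rwa [h2] at h1
  -- The fixed point is only a class; this representative vanishes exactly outside `B` and satisfies
  -- the equation pointwise on `B`.
  refine ⟨B.indicator (G r), hG r, fun t ht => Set.indicator_of_notMem ht _,
    Eventually.of_forall fun t ht => ?_⟩
  rw [Set.indicator_of_mem ht]
  simp only [G]
  congr 1
  refine volterra_congr (hr.mono fun s hs _ => ?_)
  rw [hs]

/-! ### Continuation of Volterra solutions in time. -/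

theorem mem_Ioo_of_mem_uIoc_zero {s t T : ℝ} (ht : t ∈ Set.Ioo (-T) T) (hs : s ∈ Set.uIoc 0 t) :
    s ∈ Set.Ioo (-T) T := by
  rw [Set.mem_uIoc] at hs
  constructor <;> rcases hs with hs | hs <;> linarith [ht.1, ht.2, hs.1, hs.2]

/-- Causality: for `t` in a symmetric interval, the integral from `0` to `t` never leaves that
interval. -/
theorem VolterraSol.restrict {f q : ℝ → ℂ} {A : Set ℝ} {T : ℝ} (h : VolterraSol 0 A f q)
    (hT : Set.Ioo (-T) T ⊆ A) :
    VolterraSol 0 (Set.Ioo (-T) T) f ((Set.Ioo (-T) T).indicator q) where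
  memLp := h.memLp.indicator measurableSet_Ioo
  eq_zero t ht := Set.indicator_of_notMem ht _
  ae_eq := by
    filter_upwards [h.ae_eq] with t e ht
    rw [Set.indicator_of_mem ht, e (hT ht)]
    congr 1
    refine volterra_congr (Eventually.of_forall fun s hs => ?_)
    rw [Set.indicator_of_mem (mem_Ioo_of_mem_uIoc_zero ht hs)]

theorem volume_Ioo_sdiff_Ioo_le {T δ : ℝ} :
    volume (Set.Ioo (-(T + δ)) (T + δ) \ Set.Ioo (-T) T) ≤ 2 * ENNReal.ofReal δ := by
  have hsub : Set.Ioo (-(T + δ)) (T + δ) \ Set.Ioo (-T) T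
      ⊆ Set.Icc (-(T + δ)) (-T) ∪ Set.Icc T (T + δ) := by
    rintro t ⟨⟨h1, h2⟩, h3⟩
    rw [Set.mem_Ioo, not_and_or, not_lt, not_lt] at h3
    rcases h3 with h3 | h3
    · exact Or.inl ⟨h1.le, h3⟩
    · exact Or.inr ⟨h3, h2.le⟩
  refine (measure_mono hsub).trans ((measure_union_le _ _).trans (le_of_eq ?_))
  rw [Real.volume_Icc, Real.volume_Icc, two_mul]
  congr 2 <;> ring

theorem exists_eLpNorm_shell_le {F : ℝ → ℂ} (hF : MemLp F 4 volume) (T : ℝ) {ε : NNReal}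
    (hε : 0 < ε) : ∃ δ > 0,
      eLpNorm F 4 (volume.restrict (Set.Ioo (-(T + δ)) (T + δ) \ Set.Ioo (-T) T)) ≤ ε := by
  have hfin : ∫⁻ t, ‖F t‖ₑ ^ 4 ≠ ∞ := by
    rw [← eLpNorm_four]
    exact ENNReal.pow_ne_top hF.2.ne
  have hvol : Tendsto (fun δ : ℝ => volume (Set.Ioo (-(T + δ)) (T + δ) \ Set.Ioo (-T) T))
      (𝓝[>] 0) (𝓝 0) := by
    have h1 : Tendsto (fun δ : ℝ => 2 * ENNReal.ofReal δ) (𝓝[>] 0) (𝓝 0) := by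
      have := ENNReal.Tendsto.const_mul (a := 2)
        ((ENNReal.continuous_ofReal.tendsto 0).mono_left (nhdsWithin_le_nhds (s := Set.Ioi 0)))
        (Or.inr (by simp))
      simpa using this
    exact tendsto_of_tendsto_of_tendsto_of_le_of_le tendsto_const_nhds h1 (fun _ => zero_le)
      fun δ => volume_Ioo_sdiff_Ioo_le
  have hlim := tendsto_setLIntegral_zero hfin hvol
  have hε4 : (0 : ℝ≥0∞) < (ε : ℝ≥0∞) ^ 4 := by positivity
  obtain ⟨δ, h1, h2⟩ := ((hlim.eventually (Iio_mem_nhds hε4)).and self_mem_nhdsWithin).exists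
  refine ⟨δ, h2, ?_⟩
  rw [← ENNReal.pow_le_pow_left_iff four_ne_zero, eLpNorm_four]
  exact h1.le

/-- The contribution of the known solution is moved into the forcing term, which has small `L⁴` norm
on a thin enough shell around the interval; the contraction solves for `r` there. The supports of
`q` and `r` are disjoint, so the cubic term of `q + r` is the sum of the two cubic terms. -/
theorem VolterraSol.exists_extension {f q : ℝ → ℂ} (hf : MemLp f 4 volume) {T : ℝ}
    (h : VolterraSol 0 (Set.Ioo (-T) T) f q) :
    ∃ T' > T, ∃ q', VolterraSol 0 (Set.Ioo (-T') T') f q' := by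
  have hc := memLp_cubic h.memLp
  have hF : MemLp (fun t => f t - volterra 0 (fun s => cubic (q s)) t) 4 volume :=
    hf.sub (memLp_volterra 0 hc)
  obtain ⟨δ, hδ, hsmall⟩ := exists_eLpNorm_shell_le hF T (ε := 1 / 32) (by positivity)
  obtain ⟨r, hr⟩ := exists_volterraSol_of_small 0
    (measurableSet_Ioo.diff measurableSet_Ioo) hF hsmall
  have hcr := memLp_cubic hr.memLp
  have hqr : ∀ t, q t = 0 ∨ r t = 0 := fun t => by
    by_cases ht : t ∈ Set.Ioo (-T) T
    · exact Or.inr (hr.eq_zero t fun hc => hc.2 ht)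
    · exact Or.inl (h.eq_zero t ht)
  have hcubic : (fun t => cubic (q t + r t)) = (fun t => cubic (q t)) + fun t => cubic (r t) := by
    ext t
    rcases hqr t with h0 | h0 <;> simp [h0, cubic_zero]
  refine ⟨T + δ, by linarith, fun t => q t + r t, h.memLp.add hr.memLp, fun t ht => ?_, ?_⟩
  · rw [h.eq_zero t fun hc => ht ⟨by linarith [hc.1], by linarith [hc.2]⟩,
      hr.eq_zero t fun hc => ht hc.1, add_zero]
  · filter_upwards [h.ae_eq, hr.ae_eq, ae_rieszPot_lt_top hc, ae_rieszPot_lt_top hcr]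
      with t e1 e2 r1 r2 ht
    rw [hcubic, volterra_add 0 t hc.1 hcr.1 r1 r2]
    by_cases htT : t ∈ Set.Ioo (-T) T
    · have hrt : ∀ s ∈ Set.Ioo (-T) T, r s = 0 := fun s hs => hr.eq_zero s fun hc => hc.2 hs
      have hv : volterra 0 (fun t => cubic (r t)) t = 0 :=
        volterra_eq_zero (Eventually.of_forall fun s hs => by
          rw [hrt s (mem_Ioo_of_mem_uIoc_zero htT hs), cubic_zero])
      rw [hrt t htT, hv, e1 htT]
      ring
    · rw [h.eq_zero t htT, e2 ⟨ht, htT⟩]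
      ring

-- Uniqueness makes the local solutions agree almost everywhere, so they can be glued. The uniform
-- bound `3‖f‖` and Fatou's lemma keep the glued function in `L⁴`, even when the union is all of
-- `ℝ`.
open Classical in
theorem exists_volterraSol_iUnion {f : ℝ → ℂ} (hf : MemLp f 4 volume) {T : ℕ → ℝ}
    (hT : Monotone T) (h : ∀ n, ∃ q, VolterraSol 0 (Set.Ioo (-T n) (T n)) f q) :
    ∃ q, VolterraSol 0 (⋃ n, Set.Ioo (-T n) (T n)) f q := by
  choose q hq using h
  have hvol : ∀ n, volume (Set.Ioo (-T n) (T n)) ≠ ∞ := fun n => by simp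
  have hmono : ∀ {m n}, m ≤ n → Set.Ioo (-T m) (T m) ⊆ Set.Ioo (-T n) (T n) := fun hmn =>
    Set.Ioo_subset_Ioo (neg_le_neg (hT hmn)) (hT hmn)
  have hcompat : ∀ᵐ t, ∀ m n, m ≤ n → t ∈ Set.Ioo (-T m) (T m) → q n t = q m t := by
    refine ae_all_iff.2 fun m => ae_all_iff.2 fun n => ?_
    by_cases hmn : m ≤ n
    · filter_upwards [((hq n).restrict (hmono hmn)).ae_eq_of_eq (hvol m) hf (hq m)] with t e _ ht
      rw [← e, Set.indicator_of_mem ht]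
    · exact Eventually.of_forall fun t h => absurd h hmn
  let Q : ℝ → ℂ := fun t => if h : ∃ n, t ∈ Set.Ioo (-T n) (T n) then q (Nat.find h) t else 0
  have hQ : ∀ᵐ t, ∀ n, t ∈ Set.Ioo (-T n) (T n) → Q t = q n t := by
    filter_upwards [hcompat] with t ht n hn
    have hex : ∃ n, t ∈ Set.Ioo (-T n) (T n) := ⟨n, hn⟩
    simp only [Q, dif_pos hex]
    exact (ht _ n (Nat.find_min' hex hn) (Nat.find_spec hex)).symm
  have hQ0 : ∀ t ∉ ⋃ n, Set.Ioo (-T n) (T n), Q t = 0 := fun t ht => by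
    rw [Set.mem_iUnion] at ht
    simp only [Q, dif_neg ht]
  have hlim : ∀ᵐ t, Tendsto (fun n => q n t) atTop (𝓝 (Q t)) := by
    filter_upwards [hQ] with t ht
    refine tendsto_const_nhds.congr' ?_
    by_cases hex : ∃ n, t ∈ Set.Ioo (-T n) (T n)
    · obtain ⟨n, hn⟩ := hex
      filter_upwards [eventually_ge_atTop n] with m hm
      exact ht m (hmono hm hn)
    · refine Eventually.of_forall fun n => ?_
      simp only
      rw [hQ0 t (by rwa [Set.mem_iUnion]), (hq n).eq_zero t fun hc => hex ⟨n, hc⟩]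
  refine ⟨Q, ⟨aestronglyMeasurable_of_tendsto_ae atTop (fun n => (hq n).memLp.1) hlim, ?_⟩,
    hQ0, ?_⟩
  · refine lt_of_le_of_lt (Lp.eLpNorm_lim_le_liminf_eLpNorm (fun n => (hq n).memLp.1) Q hlim) ?_
    refine lt_of_le_of_lt (liminf_le_liminf (v := fun _ => 3 * eLpNorm f 4 volume)
      (Eventually.of_forall fun n => (hq n).eLpNorm_le (hvol n) hf)) ?_
    rw [liminf_const]
    exact ENNReal.mul_lt_top (by simp) hf.2
  · have hall : ∀ᵐ t, ∀ n, t ∈ Set.Ioo (-T n) (T n) →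
        q n t = f t - volterra 0 (fun s => cubic (q n s)) t := ae_all_iff.2 fun n => (hq n).ae_eq
    filter_upwards [hQ, hall] with t h1 h2 ht
    obtain ⟨n, hn⟩ := Set.mem_iUnion.1 ht
    rw [h1 n hn, h2 n hn]
    congr 1
    refine volterra_congr (hQ.mono fun s hs hst => ?_)
    rw [hs n (mem_Ioo_of_mem_uIoc_zero hn hst)]

/-- If the admissible half-lengths were bounded, gluing would reach their supremum and the extension
lemma would pass it. Hence they are unbounded, and the integer intervals are glued. -/
theorem exists_volterraSol {f : ℝ → ℂ} (hf : MemLp f 4 volume) :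
    ∃ q, VolterraSol 0 Set.univ f q := by
  let E : Set ℝ := {T | ∃ q, VolterraSol 0 (Set.Ioo (-T) T) f q}
  have h0 : (0 : ℝ) ∈ E := ⟨fun _ => 0, MemLp.zero, fun _ _ => rfl,
    Eventually.of_forall fun t ht => absurd ht (by simp)⟩
  have hdown : ∀ {S T}, S ≤ T → T ∈ E → S ∈ E := fun hST ⟨q, hq⟩ =>
    ⟨_, hq.restrict (Set.Ioo_subset_Ioo (neg_le_neg hST) hST)⟩
  by_cases hbdd : BddAbove E
  · obtain ⟨T, hTm, hTlim, hTE⟩ := exists_seq_tendsto_sSup ⟨0, h0⟩ hbdd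
    obtain ⟨q, hq⟩ := exists_volterraSol_iUnion hf hTm hTE
    have hsub : Set.Ioo (-sSup E) (sSup E) ⊆ ⋃ n, Set.Ioo (-T n) (T n) := by
      intro t ht
      obtain ⟨n, hn⟩ := (hTlim.eventually (Ioi_mem_nhds (abs_lt.2 ht))).exists
      exact Set.mem_iUnion.2 ⟨n, abs_lt.1 hn⟩
    obtain ⟨T', hT', hE⟩ := (hq.restrict hsub).exists_extension hf
    exact absurd (le_csSup hbdd hE) (not_le.2 hT')
  · have hE : ∀ n : ℕ, (n : ℝ) ∈ E := fun n => by
      obtain ⟨T, hT, hnT⟩ := not_bddAbove_iff.1 hbdd n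
      exact hdown hnT.le hT
    obtain ⟨q, hq⟩ := exists_volterraSol_iUnion hf (T := fun n : ℕ => (n : ℝ)) Nat.mono_cast hE
    have huniv : ⋃ n : ℕ, Set.Ioo (-(n : ℝ)) n = Set.univ := by
      refine Set.eq_univ_of_forall fun t => ?_
      obtain ⟨n, hn⟩ := exists_nat_gt |t|
      exact Set.mem_iUnion.2 ⟨n, abs_lt.1 hn⟩
    exact ⟨q, huniv ▸ hq⟩

/-! ### From solutions to the Volterra equation -/

theorem pairing_sub_smul (f h : L2) (c : ℂ) (φ : 𝓢(ℝ, ℂ)) :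
    Lp.toTemperedDistribution (f - c • h) φ
      = Lp.toTemperedDistribution f φ - c * Lp.toTemperedDistribution h φ := by
  have e : Lp.toTemperedDistributionCLM ℂ (volume : Measure ℝ) 2 (f - c • h)
      = Lp.toTemperedDistributionCLM ℂ (volume : Measure ℝ) 2 f
        - c • Lp.toTemperedDistributionCLM ℂ (volume : Measure ℝ) 2 h := by
    rw [map_sub, map_smul]
  exact congrArg (fun T : 𝓢'(ℝ, ℂ) => T φ) e

theorem nonlinearity_eq (f : L2) :
    nonlinearity f = cubic (pointValue f 0) • TemperedDistribution.delta (0 : ℝ) := rfl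

/-- Turns the distributional identity into an equation in `L²`. The source `g` need match the cubic
trace only almost everywhere between `a` and `t`, which leaves freedom to use restricted or limiting
traces. -/
theorem duhamel_iff {ψ : ℝ → L2} {a t : ℝ} {g : ℝ → ℂ} (hg : MemLp g (4 / 3) volume)
    (h : ∀ᵐ s, s ∈ Set.uIoc a t → g s = cubic (pointValue (ψ s) 0)) :
    Duhamel ψ a t ↔ ψ t = free (t - a) (ψ a) - Complex.I • free t (forced a t g) := by
  have key : ∀ φ : 𝓢(ℝ, ℂ), Lp.toTemperedDistribution (free (t - a) (ψ a)) φ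
      - Complex.I * ∫ s in a..t, freeDist (t - s) (nonlinearity (ψ s)) φ
      = Lp.toTemperedDistribution (free (t - a) (ψ a) - Complex.I • free t (forced a t g)) φ := by
    intro φ
    rw [pairing_sub_smul, pairing_free_forced a t hg]
    congr 2
    refine intervalIntegral.integral_congr_ae (h.mono fun s hs hst => ?_)
    rw [nonlinearity_eq, freeDist_smul_delta, hs hst, mul_comm]
  refine ⟨fun H => L2_ext_of_pairing fun φ => ?_, fun H φ => ?_⟩
  · rw [H φ, key φ]
  · rw [key φ, ← H]

/-- The boundary values `ψ(·, 0)`, restricted to a compact interval. -/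
def trace (a b : ℝ) (ψ : ℝ → L2) : ℝ → ℂ :=
  (Set.Icc a b).indicator fun s => pointValue (ψ s) 0

theorem trace_of_mem {a b t : ℝ} (ψ : ℝ → L2) (ht : t ∈ Set.Icc a b) :
    trace a b ψ t = pointValue (ψ t) 0 := Set.indicator_of_mem ht _

theorem memLp_apply_zero {μ : Measure ℝ} {u : ℝ → (ℝ →ᵇ ℂ)} (hu : MemLp u 4 μ) :
    MemLp (fun t => u t 0) 4 μ :=
  hu.of_le ((BoundedContinuousFunction.evalCLM ℂ (0 : ℝ)).continuous.comp_aestronglyMeasurable hu.1)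
    (Eventually.of_forall fun t => (u t).norm_coe_le_norm 0)

theorem IsSolution.memLp_trace {I : Set ℝ} (hI : I.OrdConnected) {ψ : ℝ → L2}
    (h : IsSolution I ψ) {a b : ℝ} (ha : a ∈ I) (hb : b ∈ I) : MemLp (trace a b ψ) 4 volume := by
  obtain ⟨u, hu, hmem⟩ := h.memL4locC
  refine (memLp_indicator_iff_restrict measurableSet_Icc).2 ?_
  have h1 : MemLp (fun t => u t 0) 4 (volume.restrict (Set.Icc a b)) :=
    memLp_apply_zero (hmem a ha b hb)
  refine h1.ae_eq ?_
  filter_upwards [ae_restrict_of_ae_restrict_of_subset (hI.out ha hb) hu] with t ht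
  exact (pointValue_eq (u t).continuous ht 0).symm

/-- Moves the base time of the Duhamel formula: the formulas from `t₀` to `t₁` and to `t₂` are
subtracted and the forced integrals combined. The window is enlarged to contain `t₀`, so that one
`L^{4/3}` source serves for both. -/
theorem IsSolution.profile_eq {I : Set ℝ} (hI : I.OrdConnected) {ψ : ℝ → L2}
    (h : IsSolution I ψ) {a b : ℝ} (ha : a ∈ I) (hb : b ∈ I) {t₁ t₂ : ℝ}
    (h₁ : t₁ ∈ Set.Icc a b) (h₂ : t₂ ∈ Set.Icc a b) :
    free (-t₂) (ψ t₂) = free (-t₁) (ψ t₁)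
      - Complex.I • forced t₁ t₂ (fun s => cubic (trace a b ψ s)) := by
  obtain ⟨t₀, ht₀, hD⟩ := h.duhamel
  have ha' : min a t₀ ∈ I := by rcases min_choice a t₀ with e | e <;> rw [e] <;> assumption
  have hb' : max b t₀ ∈ I := by rcases max_choice b t₀ with e | e <;> rw [e] <;> assumption
  set g : ℝ → ℂ := fun s => cubic (trace (min a t₀) (max b t₀) ψ s) with hgdef
  have hg : MemLp g (4 / 3) volume := memLp_cubic (h.memLp_trace hI ha' hb')
  have ht₀m : t₀ ∈ Set.Icc (min a t₀) (max b t₀) := ⟨min_le_right _ _, le_max_right _ _⟩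
  have hsub : Set.Icc a b ⊆ Set.Icc (min a t₀) (max b t₀) :=
    Set.Icc_subset_Icc (min_le_left _ _) (le_max_left _ _)
  have key : ∀ t ∈ Set.Icc a b, free (-t) (ψ t) = free (-t₀) (ψ t₀) - Complex.I • forced t₀ t g := by
    intro t ht
    have huI : Set.uIoc t₀ t ⊆ Set.Icc (min a t₀) (max b t₀) :=
      Set.uIoc_subset_uIcc.trans (Set.uIcc_subset_Icc ht₀m (hsub ht))
    have hψ := (duhamel_iff hg (Eventually.of_forall fun s hs => by
      simp only [hgdef]
      rw [trace_of_mem ψ (huI hs)])).1 (hD t (hI.out ha hb ht))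
    rw [hψ, free_sub, free_smul, free_free, free_free, neg_add_cancel, free_zero]
    congr 2
    ring
  have hcongr : forced t₁ t₂ (fun s => cubic (trace a b ψ s)) = forced t₁ t₂ g := by
    refine forced_congr (Eventually.of_forall fun s hs => ?_)
    have hs' : s ∈ Set.Icc a b := (Set.uIoc_subset_uIcc.trans (Set.uIcc_subset_Icc h₁ h₂)) hs
    simp only [hgdef]
    rw [trace_of_mem ψ hs', trace_of_mem ψ (hsub hs')]
  rw [key t₂ h₂, key t₁ h₁, hcongr, ← forced_add_adjacent t₀ t₁ t₂ hg, smul_add]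
  abel

/-- The representative in `L⁴_t C_x` of a free wave. -/
def freeRep (h : L2) : ℝ → (ℝ →ᵇ ℂ) := (exists_strichartz h).choose

theorem representsL4C_freeRep (h : L2) : RepresentsL4C (freeRep h) (fun t => free t h) :=
  (exists_strichartz h).choose_spec.1

theorem eLpNorm_freeRep_le (h : L2) : eLpNorm (freeRep h) 4 volume ≤ 5 * ‖h‖ₑ :=
  (exists_strichartz h).choose_spec.2

theorem memLp_freeRep_zero (h : L2) : MemLp (fun t => freeRep h t 0) 4 volume :=
  memLp_apply_zero (representsL4C_freeRep h).1

theorem eLpNorm_freeRep_zero_le (h : L2) :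
    eLpNorm (fun t => freeRep h t 0) 4 volume ≤ 5 * ‖h‖ₑ :=
  (eLpNorm_mono_enorm fun t => enorm_apply_le (freeRep h t) 0).trans (eLpNorm_freeRep_le h)

/-- The representatives are chosen separately for each datum, so linearity holds only at almost
every time; there, continuous functions that agree almost everywhere in `x` agree at `0`. -/
theorem eLpNorm_freeRep_zero_sub_le (h₁ h₂ : L2) :
    eLpNorm ((fun t => freeRep h₁ t 0) - fun t => freeRep h₂ t 0) 4 volume ≤ 5 * ‖h₁ - h₂‖ₑ := by
  refine le_trans (le_of_eq (eLpNorm_congr_ae ?_)) (eLpNorm_freeRep_zero_le (h₁ - h₂))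
  filter_upwards [(representsL4C_freeRep h₁).2, (representsL4C_freeRep h₂).2,
    (representsL4C_freeRep (h₁ - h₂)).2] with t e₁ e₂ e₃
  have hae : (freeRep h₁ t - freeRep h₂ t : ℝ →ᵇ ℂ) =ᵐ[volume] freeRep (h₁ - h₂) t := by
    have e₄ := Lp.coeFn_sub (free t h₁) (free t h₂)
    rw [← free_sub] at e₄
    filter_upwards [e₁, e₂, e₃, e₄] with x x₁ x₂ x₃ x₄
    rw [← x₃, x₄, Pi.sub_apply, x₁, x₂]
    rfl
  exact congrFun ((Continuous.ae_eq_iff_eq volume (map_continuous _) (map_continuous _)).1 hae) 0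

theorem pointValue_free_sub_forced {h : L2} {u : ℝ →ᵇ ℂ} {a t : ℝ}
    (hu : (free t h : ℝ → ℂ) =ᵐ[volume] u) {g : ℝ → ℂ} (hg : MemLp g (4 / 3) volume)
    (ht : rieszPot g t < ∞) :
    pointValue (free t h - Complex.I • free t (forced a t g)) 0 = u 0 - volterra a g t := by
  rw [pointValue_eq (u := fun x => u x - Complex.I * forcedVal a t g x)
    (u.continuous.sub (continuous_const.mul (continuous_forcedVal a t hg ht))) ?_ 0]
  · rfl
  filter_upwards [hu, free_forced_ae_eq a t hg ht, Lp.coeFn_sub (free t h)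
    (Complex.I • free t (forced a t g)), Lp.coeFn_smul Complex.I (free t (forced a t g))]
    with x e₁ e₂ e₃ e₄
  rw [e₃, Pi.sub_apply, e₄, Pi.smul_apply, e₁, e₂, smul_eq_mul]

theorem IsSolution.volterraSol {I : Set ℝ} (hI : I.OrdConnected) {ψ : ℝ → L2}
    (h : IsSolution I ψ) {a b : ℝ} (ha : a ∈ I) (hb : b ∈ I) {t₁ : ℝ} (h₁ : t₁ ∈ Set.Icc a b) :
    VolterraSol t₁ (Set.Icc a b) (fun t => freeRep (free (-t₁) (ψ t₁)) t 0) (trace a b ψ) where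
  memLp := h.memLp_trace hI ha hb
  eq_zero t ht := Set.indicator_of_notMem ht _
  ae_eq := by
    have hg := memLp_cubic (h.memLp_trace hI ha hb)
    filter_upwards [(representsL4C_freeRep (free (-t₁) (ψ t₁))).2, ae_rieszPot_lt_top hg]
      with t e₁ e₂ ht
    rw [← pointValue_free_sub_forced e₁ hg e₂, trace_of_mem ψ ht, ← free_smul, ← free_sub,
      ← h.profile_eq hI ha hb h₁ ht, free_free, add_neg_cancel, free_zero]

/-- On the compact interval between the two times both traces solve one Volterra equation with base
`t₀` and the same free wave. They coincide almost everywhere, hence so do the Duhamel terms; no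
short-time iteration is needed. -/
theorem uniqueness : Uniqueness := by
  intro I J hI hJ φ ψ hφ hψ t₀ ht₀ heq t ht
  have ha : min t₀ t ∈ I ∩ J := by rcases min_choice t₀ t with e | e <;> rw [e] <;> assumption
  have hb : max t₀ t ∈ I ∩ J := by rcases max_choice t₀ t with e | e <;> rw [e] <;> assumption
  have hm₀ : t₀ ∈ Set.Icc (min t₀ t) (max t₀ t) := ⟨min_le_left _ _, le_max_left _ _⟩
  have hm : t ∈ Set.Icc (min t₀ t) (max t₀ t) := ⟨min_le_right _ _, le_max_right _ _⟩
  have s₁ := hφ.volterraSol hI ha.1 hb.1 hm₀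
  have s₂ := hψ.volterraSol hJ ha.2 hb.2 hm₀
  rw [heq] at s₁
  have hae := s₁.ae_eq_of_eq (by simp) (memLp_freeRep_zero _) s₂
  have h₁ := hφ.profile_eq hI ha.1 hb.1 hm₀ hm
  have h₂ := hψ.profile_eq hJ ha.2 hb.2 hm₀ hm
  have hforced : forced t₀ t (fun s => cubic (trace (min t₀ t) (max t₀ t) φ s))
      = forced t₀ t (fun s => cubic (trace (min t₀ t) (max t₀ t) ψ s)) :=
    forced_congr (hae.mono fun s hs _ => by rw [hs])
  rw [heq, hforced, ← h₂] at h₁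
  have h₃ := congrArg (free t) h₁
  rwa [free_free, free_free, add_neg_cancel, free_zero, free_zero] at h₃

/-! ### Global bounds and scattering -/

theorem IsSolution.eLpNorm_trace_le {ψ : ℝ → L2} (h : IsSolution Set.univ ψ) {R : ℝ}
    (hR : 0 ≤ R) : eLpNorm (trace (-R) R ψ) 4 volume ≤ 15 * ‖ψ 0‖ₑ := by
  have s := h.volterraSol Set.ordConnected_univ (Set.mem_univ (-R)) (Set.mem_univ R) (t₁ := 0)
    ⟨by linarith, hR⟩
  refine (s.eLpNorm_le (by simp) (memLp_freeRep_zero _)).trans ?_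
  rw [neg_zero, free_zero]
  refine (mul_le_mul_right (eLpNorm_freeRep_zero_le _) _).trans (le_of_eq ?_)
  rw [← mul_assoc]
  norm_num

/-- The trace bound on `[-n, n]` has a constant independent of `n`, so Fatou's lemma extends it to
`ℝ`. The factor `15` is `3` from monotonicity times `5` from Strichartz. -/
theorem IsSolution.memLp_pointValue {ψ : ℝ → L2} (h : IsSolution Set.univ ψ) :
    MemLp (fun t => pointValue (ψ t) 0) 4 volume ∧
      eLpNorm (fun t => pointValue (ψ t) 0) 4 volume ≤ 15 * ‖ψ 0‖ₑ := by
  have hm : ∀ n : ℕ, AEStronglyMeasurable (trace (-n) n ψ) volume := fun n =>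
    (h.memLp_trace Set.ordConnected_univ (Set.mem_univ _) (Set.mem_univ _)).1
  have hlim : ∀ᵐ t, Tendsto (fun n : ℕ => trace (-n) n ψ t) atTop (𝓝 (pointValue (ψ t) 0)) := by
    refine Eventually.of_forall fun t => tendsto_const_nhds.congr' ?_
    obtain ⟨n, hn⟩ := exists_nat_ge |t|
    filter_upwards [eventually_ge_atTop n] with m hm
    exact (trace_of_mem ψ (abs_le.1 (hn.trans (Nat.cast_le.2 hm)))).symm
  have hle : eLpNorm (fun t => pointValue (ψ t) 0) 4 volume ≤ 15 * ‖ψ 0‖ₑ := by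
    refine (Lp.eLpNorm_lim_le_liminf_eLpNorm hm _ hlim).trans ?_
    refine (liminf_le_liminf (v := fun _ => 15 * ‖ψ 0‖ₑ) (Eventually.of_forall fun n =>
      h.eLpNorm_trace_le n.cast_nonneg)).trans ?_
    rw [liminf_const]
  exact ⟨⟨aestronglyMeasurable_of_tendsto_ae atTop hm hlim,
    hle.trans_lt (ENNReal.mul_lt_top (by simp) (by simp))⟩, hle⟩

theorem IsSolution.profile_eq_univ {ψ : ℝ → L2} (h : IsSolution Set.univ ψ) (t₁ t₂ : ℝ) :
    free (-t₂) (ψ t₂) = free (-t₁) (ψ t₁)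
      - Complex.I • forced t₁ t₂ (fun s => cubic (pointValue (ψ s) 0)) := by
  rw [h.profile_eq Set.ordConnected_univ (Set.mem_univ (min t₁ t₂)) (Set.mem_univ (max t₁ t₂))
    ⟨min_le_left _ _, le_max_left _ _⟩ ⟨min_le_right _ _, le_max_right _ _⟩]
  congr 2
  exact forced_congr (Eventually.of_forall fun s hs => by
    rw [trace_of_mem ψ (Set.uIoc_subset_uIcc hs)])

theorem tendsto_lintegral_tail {f : ℝ → ℝ≥0∞} (hf : AEMeasurable f) (h : ∫⁻ s, f s ≠ ∞) :
    Tendsto (fun r : ℝ => ∫⁻ s in {s | r ≤ |s|}, f s) atTop (𝓝 0) := by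
  have hms : ∀ r : ℝ, MeasurableSet {s : ℝ | r ≤ |s|} := fun r =>
    measurableSet_le measurable_const (by fun_prop)
  have := tendsto_lintegral_filter_of_dominated_convergence' (l := (atTop : Filter ℝ))
    (F := fun r => ({s : ℝ | r ≤ |s|}).indicator f) (f := fun _ => 0) f
    (Eventually.of_forall fun r => hf.indicator (hms r))
    (Eventually.of_forall fun r => Eventually.of_forall fun s => Set.indicator_le_self _ _ s) h
    (Eventually.of_forall fun s => by
      refine tendsto_const_nhds.congr' ?_
      filter_upwards [eventually_gt_atTop |s|] with r hr
      rw [Set.indicator_of_notMem]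
      exact not_le.2 hr)
  rw [lintegral_zero] at this
  refine this.congr fun r => ?_
  rw [lintegral_indicator (hms r)]

theorem tendsto_eLpNorm_tail {g : ℝ → ℂ} (hg : MemLp g (4 / 3) volume) :
    Tendsto (fun r : ℝ => eLpNorm g (4 / 3) (volume.restrict {s | r ≤ |s|})) atTop (𝓝 0) := by
  have hne : (4 / 3 : ℝ≥0∞) ≠ ∞ := ENNReal.div_ne_top (by simp) (by simp)
  have h43 : ((4 / 3 : ℝ≥0∞)).toReal = 4 / 3 := by simp [ENNReal.toReal_div]
  have hfin := (lintegral_rpow_enorm_lt_top_of_eLpNorm_lt_top (by simp) hne hg.2).ne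
  have h := (tendsto_lintegral_tail (hg.1.enorm.pow_const _) hfin).ennrpow_const
    (1 / (4 / 3 : ℝ≥0∞).toReal)
  rw [ENNReal.zero_rpow_of_pos (by rw [h43]; norm_num)] at h
  refine h.congr fun r => ?_
  rw [eLpNorm_eq_lintegral_rpow_enorm_toReal (by simp) hne]

/-- Increments of the forced part are controlled by the `L^{4/3}` norm of `g` on a tail, so the
Cauchy criterion holds. The reparametrisation `e` covers both `t → ∞` and `t → -∞`. -/
theorem exists_tendsto_forced {g : ℝ → ℂ} (hg : MemLp g (4 / 3) volume) {e : ℝ → ℝ}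
    (he : ∀ r t₁ t₂, r ≤ t₁ → r ≤ t₂ → Set.uIoc (e t₁) (e t₂) ⊆ {s | r ≤ |s|}) :
    ∃ y, Tendsto (fun t => forced 0 (e t) g) atTop (𝓝 y) := by
  refine cauchySeq_tendsto_of_complete (EMetric.cauchySeq_iff.2 fun ε hε => ?_)
  have h5 := ENNReal.Tendsto.const_mul (a := 5) (tendsto_eLpNorm_tail hg) (Or.inr (by simp))
  rw [mul_zero] at h5
  obtain ⟨r, hr⟩ := (h5.eventually (Iio_mem_nhds hε)).exists
  refine ⟨r, fun t₁ h₁ t₂ h₂ => lt_of_le_of_lt ?_ hr⟩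
  rw [edist_comm, edist_eq_enorm_sub, ← forced_add_adjacent 0 (e t₁) (e t₂) hg,
    add_sub_cancel_left]
  refine (enorm_forced_le _ _ hg).trans ?_
  gcongr
  exact he r t₁ t₂ h₁ h₂

theorem IsSolution.norm_sub_free_eq {ψ : ℝ → L2} (h : IsSolution Set.univ ψ) (t : ℝ) (y : L2) :
    ‖ψ t - free t (ψ 0 - Complex.I • y)‖
      = ‖forced 0 t (fun s => cubic (pointValue (ψ s) 0)) - y‖ := by
  have h1 : ψ t = free t (free (-t) (ψ t)) := by rw [free_free, add_neg_cancel, free_zero]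
  rw [h1, ← free_sub, norm_free, h.profile_eq_univ 0 t, neg_zero, free_zero, sub_sub_sub_cancel_left,
    ← smul_sub, norm_smul, Complex.norm_I, one_mul, norm_sub_rev]

theorem IsSolution.exists_scattering {ψ : ℝ → L2} (h : IsSolution Set.univ ψ) :
    ∃ ψp ψm : L2, Tendsto (fun t : ℝ => ‖ψ t - free t ψp‖) atTop (𝓝 0) ∧
      Tendsto (fun t : ℝ => ‖ψ t - free t ψm‖) atBot (𝓝 0) := by
  have hg := memLp_cubic h.memLp_pointValue.1
  obtain ⟨y, hy⟩ := exists_tendsto_forced hg (e := fun t => t) fun r t₁ t₂ h₁ h₂ s hs =>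
    (le_min h₁ h₂).trans (hs.1.le.trans (le_abs_self s))
  obtain ⟨z, hz⟩ := exists_tendsto_forced hg (e := fun t => -t) fun r t₁ t₂ h₁ h₂ s hs => by
    have : s ≤ -r := hs.2.trans (max_le (neg_le_neg h₁) (neg_le_neg h₂))
    exact le_trans (by linarith) (neg_le_abs s)
  refine ⟨ψ 0 - Complex.I • y, ψ 0 - Complex.I • z, ?_, ?_⟩
  · simp_rw [h.norm_sub_free_eq]
    exact tendsto_iff_norm_sub_tendsto_zero.1 hy
  · simp_rw [h.norm_sub_free_eq]
    have := (tendsto_iff_norm_sub_tendsto_zero.1 hz).comp tendsto_neg_atBot_atTop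
    refine this.congr fun t => ?_
    simp only [Function.comp_apply, neg_neg]

/-! ### Existence -/

theorem globalExistence : GlobalExistence := by
  intro ψ₀
  obtain ⟨q, hq⟩ := exists_volterraSol (memLp_freeRep_zero ψ₀)
  set g : ℝ → ℂ := fun s => cubic (q s) with hgdef
  have hg : MemLp g (4 / 3) volume := memLp_cubic hq.memLp
  let ψ : ℝ → L2 := fun t => free t (ψ₀ - Complex.I • forced 0 t g)
  have hψ : ∀ t, ψ t = free t ψ₀ - Complex.I • free t (forced 0 t g) := fun t => by
    simp only [ψ]
    rw [free_sub, free_smul]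
  have hψ0 : ψ 0 = ψ₀ := by
    simp only [ψ]
    rw [forced_self 0 hg, smul_zero, sub_zero, free_zero]
  have hpoint : ∀ᵐ s, g s = cubic (pointValue (ψ s) 0) := by
    filter_upwards [(representsL4C_freeRep ψ₀).2, ae_rieszPot_lt_top hg, hq.ae_eq] with s e₁ e₂ e₃
    rw [hψ, pointValue_free_sub_forced e₁ hg e₂, ← e₃ (Set.mem_univ s)]
  refine ⟨ψ, ⟨?_, ?_, ?_, 0, Set.mem_univ 0, fun t _ => ?_⟩, hψ0⟩
  · have h1 : Continuous fun t => ψ₀ - Complex.I • forced 0 t g :=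
      continuous_const.sub ((continuous_forced 0 hg).const_smul Complex.I)
    have h2 : Continuous fun t => (t, ψ₀ - Complex.I • forced 0 t g) := continuous_id.prodMk h1
    have h3 : Continuous ((fun p : ℝ × L2 => free p.1 p.2) ∘
      fun t => (t, ψ₀ - Complex.I • forced 0 t g)) := Continuous.comp continuous_free h2
    exact h3.continuousOn
  · refine ⟨‖ψ₀‖ + (5 * eLpNorm g (4 / 3) volume).toReal, fun t _ => ?_⟩
    have hle : ‖forced 0 t g‖ₑ ≤ 5 * eLpNorm g (4 / 3) volume := by
      refine (enorm_forced_le 0 t hg).trans ?_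
      gcongr
      exact Measure.restrict_le_self
    have hle' := ENNReal.toReal_mono (ENNReal.mul_ne_top (by simp) hg.2.ne) hle
    rw [toReal_enorm] at hle'
    simp only [ψ]
    rw [norm_free]
    refine (norm_sub_le _ _).trans ?_
    rw [norm_smul, Complex.norm_I, one_mul]
    linarith
  -- The free and forced parts have representatives in the global Bochner space, so local
  -- integrability holds on every compact interval.
  · obtain ⟨v, hv⟩ := exists_representsL4C_forced hg
    refine ⟨fun t => freeRep ψ₀ t - Complex.I • v t, ?_, fun a _ b _ =>
      (((representsL4C_freeRep ψ₀).1.sub (hv.1.const_smul Complex.I))).restrict _⟩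
    rw [Measure.restrict_univ]
    filter_upwards [(representsL4C_freeRep ψ₀).2, hv.2] with t e₁ e₂
    rw [hψ]
    filter_upwards [e₁, e₂, Lp.coeFn_sub (free t ψ₀) (Complex.I • free t (forced 0 t g)),
      Lp.coeFn_smul Complex.I (free t (forced 0 t g))] with x x₁ x₂ x₃ x₄
    rw [x₃, Pi.sub_apply, x₄, Pi.smul_apply, x₁, x₂]
    rfl
  · rw [duhamel_iff hg (hpoint.mono fun s hs _ => hs), hψ, hψ0, sub_zero]

/-! ### Continuous dependence -/

theorem IsSolution.eLpNorm_cubic_trace_sub_le {φ ψ : ℝ → L2} (hφ : IsSolution Set.univ φ)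
    (hψ : IsSolution Set.univ ψ) {R : ℝ} (hR : 0 ≤ R) :
    eLpNorm (fun t => cubic (trace (-R) R φ t) - cubic (trace (-R) R ψ t)) (4 / 3) volume
      ≤ 45 * (5 * ‖φ 0 - ψ 0‖ₑ) * (5 * ‖φ 0‖ₑ + 5 * ‖ψ 0‖ₑ) ^ 2 := by
  have hm : (0 : ℝ) ∈ Set.Icc (-R) R := ⟨by linarith, hR⟩
  have s₁ := hφ.volterraSol Set.ordConnected_univ (Set.mem_univ (-R)) (Set.mem_univ R) hm
  have s₂ := hψ.volterraSol Set.ordConnected_univ (Set.mem_univ (-R)) (Set.mem_univ R) hm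
  rw [neg_zero, free_zero] at s₁ s₂
  refine (VolterraSol.eLpNorm_cubic_sub_le (by simp) (memLp_freeRep_zero _)
    (memLp_freeRep_zero _) s₁ s₂).trans ?_
  exact mul_le_mul' (mul_le_mul_right (eLpNorm_freeRep_zero_sub_le _ _) _)
    (pow_le_pow_left₀ zero_le
      (add_le_add (eLpNorm_freeRep_zero_le _) (eLpNorm_freeRep_zero_le _)) 2)

theorem IsSolution.sub_eq {φ ψ : ℝ → L2} (hφ : IsSolution Set.univ φ)
    (hψ : IsSolution Set.univ ψ) {R : ℝ} (hR : 0 ≤ R) {t : ℝ} (ht : t ∈ Set.Icc (-R) R) :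
    φ t - ψ t = free t (φ 0 - ψ 0) - Complex.I • free t (forced 0 t
      fun t => cubic (trace (-R) R φ t) - cubic (trace (-R) R ψ t)) := by
  have hm : (0 : ℝ) ∈ Set.Icc (-R) R := ⟨by linarith, hR⟩
  have h : ∀ {ψ : ℝ → L2}, IsSolution Set.univ ψ → ψ t = free t (ψ 0)
      - Complex.I • free t (forced 0 t fun t => cubic (trace (-R) R ψ t)) := fun {ψ} hψ => by
    have e := congrArg (free t) (hψ.profile_eq Set.ordConnected_univ (Set.mem_univ (-R))
      (Set.mem_univ R) hm ht)
    rwa [free_free, add_neg_cancel, free_zero, free_sub, free_smul, neg_zero, free_zero] at e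
  have hc : ∀ {ψ : ℝ → L2}, IsSolution Set.univ ψ →
      MemLp (fun t => cubic (trace (-R) R ψ t)) (4 / 3) volume := fun hψ =>
    memLp_cubic (hψ.memLp_trace Set.ordConnected_univ (Set.mem_univ _) (Set.mem_univ _))
  have e := forced_sub 0 t (hc hφ) (hc hψ)
  have e' : (fun t => cubic (trace (-R) R φ t) - cubic (trace (-R) R ψ t))
      = (fun t => cubic (trace (-R) R φ t)) - fun t => cubic (trace (-R) R ψ t) := rfl
  rw [e', e, h hφ, h hψ, free_sub, free_sub, smul_sub]
  abel

theorem add_pow_four_le (x y : ℝ≥0∞) : (x + y) ^ 4 ≤ 16 * (x ^ 4 + y ^ 4) := by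
  have h : x + y ≤ 2 * max x y := by
    rw [two_mul]
    exact add_le_add (le_max_left _ _) (le_max_right _ _)
  calc (x + y) ^ 4 ≤ (2 * max x y) ^ 4 := by gcongr
    _ = 16 * max x y ^ 4 := by rw [mul_pow]; norm_num
    _ ≤ _ := by
      gcongr
      rcases max_choice x y with e | e <;> rw [e]
      · exact le_self_add
      · exact le_add_self

theorem IsSolution.enorm_sub_le_add {φ ψ : ℝ → L2} (hφ : IsSolution Set.univ φ)
    (hψ : IsSolution Set.univ ψ) {R : ℝ} (hR : 0 ≤ R) {t : ℝ} (ht : t ∈ Set.Icc (-R) R) :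
    ‖φ t - ψ t‖ₑ ≤ ‖φ 0 - ψ 0‖ₑ + 5 * eLpNorm (fun t => cubic (trace (-R) R φ t)
      - cubic (trace (-R) R ψ t)) (4 / 3) volume := by
  have hc : ∀ {ψ : ℝ → L2}, IsSolution Set.univ ψ →
      MemLp (fun t => cubic (trace (-R) R ψ t)) (4 / 3) volume := fun hψ =>
    memLp_cubic (hψ.memLp_trace Set.ordConnected_univ (Set.mem_univ _) (Set.mem_univ _))
  rw [hφ.sub_eq hψ hR ht, ← free_smul, ← free_sub, ← ofReal_norm, norm_free, ofReal_norm]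
  refine enorm_sub_le.trans ?_
  rw [enorm_smul, ← ofReal_norm Complex.I, Complex.norm_I, ENNReal.ofReal_one, one_mul]
  gcongr
  refine (enorm_forced_le 0 t ((hc hφ).sub (hc hψ))).trans ?_
  exact mul_le_mul_right (eLpNorm_mono_measure _ Measure.restrict_le_self) _

theorem IsSolution.lintegral_sub_le {φ ψ : ℝ → L2} (hφ : IsSolution Set.univ φ)
    (hψ : IsSolution Set.univ ψ) {R : ℝ} (hR : 0 ≤ R) :
    ∫⁻ t in Set.Icc (-R) R, eLpNorm (φ t - ψ t : L2) ∞ volume ^ 4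
      ≤ 16 * ((5 * ‖φ 0 - ψ 0‖ₑ) ^ 4 + (20 * eLpNorm (fun t => cubic (trace (-R) R φ t)
      - cubic (trace (-R) R ψ t)) (4 / 3) volume) ^ 4) := by
  have hc : ∀ {ψ : ℝ → L2}, IsSolution Set.univ ψ →
      MemLp (fun t => cubic (trace (-R) R ψ t)) (4 / 3) volume := fun hψ =>
    memLp_cubic (hψ.memLp_trace Set.ordConnected_univ (Set.mem_univ _) (Set.mem_univ _))
  set g : ℝ → ℂ := fun t => cubic (trace (-R) R φ t) - cubic (trace (-R) R ψ t) with hgdef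
  have hg : MemLp g (4 / 3) volume := (hc hφ).sub (hc hψ)
  set u := freeRep (φ 0 - ψ 0)
  have hu := representsL4C_freeRep (φ 0 - ψ 0)
  calc ∫⁻ t in Set.Icc (-R) R, eLpNorm (φ t - ψ t : L2) ∞ volume ^ 4
      ≤ ∫⁻ t in Set.Icc (-R) R, 16 * (‖u t‖ₑ ^ 4 +
        eLpNorm (free t (forced 0 t g)) ∞ volume ^ 4) := by
        refine lintegral_mono_ae ?_
        filter_upwards [ae_restrict_of_ae hu.2, ae_restrict_mem measurableSet_Icc] with t e ht
        refine le_trans (pow_le_pow_left₀ zero_le ?_ 4) (add_pow_four_le _ _)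
        rw [hφ.sub_eq hψ hR ht, eLpNorm_congr_ae (Lp.coeFn_sub _ _)]
        refine (eLpNorm_sub_le (Lp.aestronglyMeasurable _) (Lp.aestronglyMeasurable _)
          le_top).trans (add_le_add (eLpNorm_top_le_enorm e) ?_)
        rw [eLpNorm_congr_ae (Lp.coeFn_smul _ _), eLpNorm_const_smul, ← ofReal_norm Complex.I,
          Complex.norm_I, ENNReal.ofReal_one, one_mul]
    _ ≤ ∫⁻ t, 16 * (‖u t‖ₑ ^ 4 + eLpNorm (free t (forced 0 t g)) ∞ volume ^ 4) :=
        setLIntegral_le_lintegral _ _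
    _ = 16 * ((∫⁻ t, ‖u t‖ₑ ^ 4) +
        ∫⁻ t, eLpNorm (free t (forced 0 t g)) ∞ volume ^ 4) := by
        -- Splitting the integral needs measurability of the first summand only; that of the
        -- essential supremum of the forced part is never used.
        rw [lintegral_const_mul' _ _ (by simp), lintegral_add_left' (hu.1.1.enorm.pow_const 4)]
    _ ≤ _ := by
        gcongr
        · rw [← eLpNorm_four]
          exact pow_le_pow_left₀ zero_le (eLpNorm_freeRep_le _) 4
        · exact lintegral_free_forced_le 0 hg

/-- The traces themselves are never compared in `L⁴`. The Lipschitz bound shows that the cubic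
sources converge in `L^{4/3}`, and the Strichartz estimates carry this to both norms of `ψn - ψ`. -/
theorem continuousDependence : ContinuousDependence := by
  intro ψ ψn hψ hψn hlim T
  set R := |T|
  have hR : 0 ≤ R := abs_nonneg T
  have hTR : Set.Icc (-T) T ⊆ Set.Icc (-R) R :=
    Set.Icc_subset_Icc (neg_le_neg (le_abs_self T)) (le_abs_self T)
  set d : ℕ → ℝ≥0∞ := fun n => eLpNorm (fun t => cubic (trace (-R) R (ψn n) t)
      - cubic (trace (-R) R ψ t)) (4 / 3) volume with hd
  have h0 : Tendsto (fun n => ‖ψn n 0 - ψ 0‖ₑ) atTop (𝓝 0) := by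
    simpa only [edist_eq_enorm_sub] using tendsto_iff_edist_tendsto_0.1 hlim
  have hd0 : Tendsto d atTop (𝓝 0) := by
    have h1 : Tendsto (fun n => 45 * (5 * ‖ψn n 0 - ψ 0‖ₑ)) atTop (𝓝 0) := by
      have := ENNReal.Tendsto.const_mul (a := 45)
        (ENNReal.Tendsto.const_mul (a := 5) h0 (Or.inr (by simp))) (Or.inr (by simp))
      simpa using this
    have h2 : Tendsto (fun n => (5 * ‖ψn n 0‖ₑ + 5 * ‖ψ 0‖ₑ) ^ 2) atTop
        (𝓝 ((5 * ‖ψ 0‖ₑ + 5 * ‖ψ 0‖ₑ) ^ 2)) :=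
      ENNReal.Tendsto.pow ((ENNReal.Tendsto.const_mul hlim.enorm (Or.inr (by simp))).add
        tendsto_const_nhds)
    have h3 := ENNReal.Tendsto.mul h1 (Or.inr (by simp [ENNReal.mul_eq_top])) h2 (Or.inr (by simp))
    rw [zero_mul] at h3
    exact tendsto_of_tendsto_of_tendsto_of_le_of_le tendsto_const_nhds h3 (fun _ => zero_le)
      fun n => (hψn n).eLpNorm_cubic_trace_sub_le hψ hR
  constructor
  · rw [EMetric.tendstoUniformlyOn_iff]
    intro ε hε
    have h1 : Tendsto (fun n => ‖ψn n 0 - ψ 0‖ₑ + 5 * d n) atTop (𝓝 0) := by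
      have := h0.add (ENNReal.Tendsto.const_mul (a := 5) hd0 (Or.inr (by simp)))
      simpa using this
    filter_upwards [h1.eventually (Iio_mem_nhds hε)] with n hn t ht
    rw [edist_comm, edist_eq_enorm_sub]
    exact ((hψn n).enorm_sub_le_add hψ hR (hTR ht)).trans_lt hn
  · have h1 : Tendsto (fun n => 16 * ((5 * ‖ψn n 0 - ψ 0‖ₑ) ^ 4 + (20 * d n) ^ 4)) atTop (𝓝 0) := by
      have e₁ := ENNReal.Tendsto.pow (n := 4)
        (ENNReal.Tendsto.const_mul (a := 5) h0 (Or.inr (by simp)))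
      have e₂ := ENNReal.Tendsto.pow (n := 4)
        (ENNReal.Tendsto.const_mul (a := 20) hd0 (Or.inr (by simp)))
      have := ENNReal.Tendsto.const_mul (a := 16) (e₁.add e₂) (Or.inr (by simp))
      simpa using this
    refine tendsto_of_tendsto_of_tendsto_of_le_of_le tendsto_const_nhds h1 (fun _ => zero_le)
      fun n => ?_
    exact (lintegral_mono_set hTR).trans ((hψn n).lintegral_sub_le hψ hR)

end PointNLS

end

/-! ### The main theorem. -/

theorem theorem1p1 :
    PointNLS.GloballyWellPosed ∧
    (∃ C : NNReal, ∀ ψ : ℝ → PointNLS.L2, PointNLS.IsSolution Set.univ ψ →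
      ∫⁻ t : ℝ, ‖PointNLS.pointValue (ψ t) 0‖ₑ ^ 4 ≤ (C : ℝ≥0∞) * ‖ψ 0‖ₑ ^ 4) ∧
    (∀ ψ : ℝ → PointNLS.L2, PointNLS.IsSolution Set.univ ψ →
      ∃ ψp ψm : PointNLS.L2,
        Tendsto (fun t : ℝ => ‖ψ t - PointNLS.free t ψp‖) atTop (𝓝 0) ∧
        Tendsto (fun t : ℝ => ‖ψ t - PointNLS.free t ψm‖) atBot (𝓝 0)) := by
  refine ⟨⟨PointNLS.globalExistence, PointNLS.uniqueness, PointNLS.continuousDependence⟩,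
    ⟨15 ^ 4, fun ψ hψ => ?_⟩, fun ψ hψ => hψ.exists_scattering⟩
  rw [← PointNLS.eLpNorm_four, ENNReal.coe_pow, ENNReal.coe_ofNat, ← mul_pow]
  exact pow_le_pow_left₀ zero_le hψ.memLp_pointValue.2 4
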